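/- Let $\mathbb{K}=\mathbb{R}$ or $\mathbb{K}=\mathbb{C}$. For a linear subspace $Y$ of a normed space $Z$ over $\mathbb{K}$ let $\lambda(Y,Z)$ be the infimum of $\|P\|$ over all bounded linear projections $P$ of $Z$ onto $Y$. For a normed space $X$ let $\lambda(X)$ be the supremum of $\lambda(T(X),Z)$ over all normed spaces $Z$ over $\mathbb{K}$ and all linear isometric embeddings $T\colon X\to Z$, and let $\lambda_{\mathbb{K}}(n)$ be the supremum of $\lambda(X)$ over all $n$-dimensional normed spaces $X$ over $\mathbb{K}$. Put $d_{\mathbb{R}}(n)=\frac{n(n+1)}{2}$ and $d_{\mathbb{C}}(n)=n^2$. A maximal ETF in $\mathbb{K}^n$ is a system of $d=d_{\mathbb{K}}(n)$ pairwise different unit vectors $w_1,\ldots,w_d\in\mathbb{K}^n$ for which $|\langle w_i,w_j\rangle|$ is the same for all $i\neq j$ and for which there is a constant $\alpha\in\mathbb{K}$ with $x=\alpha\sum_{i=1}^d\langle x,w_i\rangle w_i$ for every $x\in\mathbb{K}^n$. Let $n\geq 2$ be an integer such that a maximal ETF exists in $\mathbb{K}^n$. Then there exists a unique (up to linear isometry)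 $n$-dimensional normed space $X$ over $\mathbb{K}$ satisfying $\lambda(X)=\lambda_{\mathbb{K}}(n)$ if and only if $n=2$ and $\mathbb{K}=\mathbb{R}$. In this case, the unit ball of $X$ is an affine regular hexagon, that is, the image of a regular hexagon under an affine isomorphism. In all other situations, there are infinitely many pairwise non-isometric $n$-dimensional normed spaces $X$ over $\mathbb{K}$ with $\lambda(X)=\lambda_{\mathbb{K}}(n)$. -/

import Mathlib

open scoped ENNReal

universe u

/-! ### Projection constants -/

/-- The relative projection constant `λ(Y, Z)` of a linear subspace `Y` of a normed space `Z`: the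
infimum of the operator norms of the bounded linear projections of `Z` onto `Y`. -/
noncomputable def relProjConst (𝕜 : Type*) [RCLike 𝕜] {Z : Type*} [NormedAddCommGroup Z]
    [NormedSpace 𝕜 Z] (Y : Submodule 𝕜 Z) : ℝ≥0∞ :=
  ⨅ (P : Z →L[𝕜] Z) (_ : LinearMap.IsProj Y P), ‖P‖ₑ

/-- The absolute projection constant `λ(X)`: the supremum of `λ(T(X), Z)` over all normed spaces `Z`
and all linear isometric embeddings `T : X → Z`. -/
noncomputable def absProjConst (𝕜 : Type*) [RCLike 𝕜] (X : Type u) [NormedAddCommGroup X]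
    [NormedSpace 𝕜 X] : ℝ≥0∞ :=
  ⨆ (Z : Type u) (_ : NormedAddCommGroup Z) (_ : NormedSpace 𝕜 Z) (T : X →ₗᵢ[𝕜] Z),
    relProjConst 𝕜 (LinearMap.range T.toLinearMap)

/-- The maximal projection constant `λ_𝕜(n)`: the supremum of `λ(X)` over all `n`-dimensional normed
spaces `X` over `𝕜`. -/
noncomputable def maxProjConst (𝕜 : Type*) [RCLike 𝕜] (n : ℕ) : ℝ≥0∞ :=
  ⨆ (X : Type u) (_ : NormedAddCommGroup X) (_ : NormedSpace 𝕜 X) (_ : FiniteDimensional 𝕜 X)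
    (_ : Module.finrank 𝕜 X = n), absProjConst 𝕜 X

/-- `X` is an `n`-dimensional normed space over `𝕜` with `λ(X) = λ_𝕜(n)`. -/
def IsMaximizer (𝕜 : Type*) [RCLike 𝕜] (n : ℕ) (X : Type u) [NormedAddCommGroup X]
    [NormedSpace 𝕜 X] : Prop :=
  FiniteDimensional 𝕜 X ∧ Module.finrank 𝕜 X = n ∧ absProjConst 𝕜 X = maxProjConst.{u} 𝕜 n

/-- There is an `n`-dimensional normed space over `𝕜` with the maximal projection constant, and any
two such spaces are linearly isometric. -/
def UniqueMaximizer (𝕜 : Type*) [RCLike 𝕜] (n : ℕ) : Prop :=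
  (∃ (X : Type u) (_ : NormedAddCommGroup X) (_ : NormedSpace 𝕜 X), IsMaximizer 𝕜 n X) ∧
  ∀ (X Y : Type u) [NormedAddCommGroup X] [NormedSpace 𝕜 X] [NormedAddCommGroup Y]
    [NormedSpace 𝕜 Y], IsMaximizer 𝕜 n X → IsMaximizer 𝕜 n Y → Nonempty (X ≃ₗᵢ[𝕜] Y)

/-- There are infinitely many pairwise non-isometric `n`-dimensional normed spaces over `𝕜` with the
maximal projection constant. -/
def InfinitelyManyMaximizers (𝕜 : Type*) [RCLike 𝕜] (n : ℕ) : Prop :=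
  ∃ (X : ℕ → Type u) (_ : ∀ k, NormedAddCommGroup (X k)) (_ : ∀ k, NormedSpace 𝕜 (X k)),
    (∀ k, IsMaximizer 𝕜 n (X k)) ∧ ∀ j k, j ≠ k → IsEmpty (X j ≃ₗᵢ[𝕜] X k)

/-! ### Equiangular tight frames -/

/-- Pairwise different unit vectors for which `|⟨w i, w j⟩|` is the same for all `i ≠ j`. -/
def IsEquiangular {𝕜 : Type*} [RCLike 𝕜] {n N : ℕ} (w : Fin N → EuclideanSpace 𝕜 (Fin n)) : Prop :=
  Function.Injective w ∧ (∀ i, ‖w i‖ = 1) ∧ ∃ c : ℝ, ∀ i j, i ≠ j → ‖inner 𝕜 (w i) (w j)‖ = c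

/-- The vectors `w i` form a tight frame with constant `α`: every `x` equals
`α ∑ i, ⟨x, w i⟩ w i`. (Mathlib's `inner` is linear in the second argument.) -/
def IsTightFrame {𝕜 : Type*} [RCLike 𝕜] {n N : ℕ} (α : 𝕜)
    (w : Fin N → EuclideanSpace 𝕜 (Fin n)) : Prop :=
  ∀ x : EuclideanSpace 𝕜 (Fin n), x = α • ∑ i, inner 𝕜 (w i) x • w i

/-- An equiangular tight frame. -/
def IsETF {𝕜 : Type*} [RCLike 𝕜] {n N : ℕ} (w : Fin N → EuclideanSpace 𝕜 (Fin n)) : Prop :=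
  IsEquiangular w ∧ ∃ α : 𝕜, IsTightFrame α w

/-! ### Affine regular hexagons -/

/-- The regular hexagon inscribed in the unit circle of the Euclidean plane. -/
noncomputable def regularHexagon : Set (EuclideanSpace ℝ (Fin 2)) :=
  convexHull ℝ (Set.range fun k : Fin 6 =>
    !₂[Real.cos ((k : ℕ) * (Real.pi / 3)), Real.sin ((k : ℕ) * (Real.pi / 3))])

/-- `S` is the image of a regular hexagon under an affine isomorphism from the Euclidean plane. -/
def IsAffineRegularHexagon {V : Type*} [AddCommGroup V] [Module ℝ V] (S : Set V) : Prop :=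
  ∃ f : EuclideanSpace ℝ (Fin 2) ≃ᵃ[ℝ] V, S = f '' regularHexagon

/-! Let c be the common modulus of the inner products in a maximal ETF of N vectors; then (n + 2)c²
= 1 over ℝ and (n + 1)c² = 1 over ℂ. Put δ = (1 + nc)/(1 + c) and κ = 1/(1 + (N − 1)c). The maximal
projection constant is δ, and the question is how rigid the case of equality is.

Upper bound. If λ(X) ≥ δ', a Hahn–Banach separation gives a functional Φ on the operators of X and a
probability measure μ on the dual ball with Re Φ(id) ≥ δ' and Re Φ(f ⊗ x) ≤ ∫ |g x| dμ(g)
(`exists_dual_certificate`). In coordinates that are isotropic for μ, this becomes δ' ≤ ∬ |⟨F, F'⟩|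
for a random vector F whose second moment is the identity (`exists_isotropic_certificate`). This
energy is bounded by a quartic majorant of t on [0, 1] that touches it at t = c and t = 1, evaluated
at the cosine of the angle between F and F'. Its quadratic term is controlled by isotropy, and its
quartic term by a Cauchy–Schwarz lower bound for fourth moments (`integral_norm_inner_le`). Only
this last bound depends on the field, since real tensors have one more invariant pairing.

Lower bound. Take a polyhedral norm on 𝕜ⁿ that dominates all |⟨wᵢ, x⟩| and is at most κ ∑ᵢ |⟨wᵢ,
x⟩|. Computing the trace of a projection from ℓ_∞ shows that its projection constant is at least
n/(κN) = δ (`le_absProjConst_polySpace`). So every such norm is a maximizer.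

Non-uniqueness. If the two extreme norms differ at some point, further functionals fit between them.
Arbitrarily many of them can be irredundant, and the number of irredundant functionals separates
isometry classes (`le_card_of_irredundant`). A gap arises by perturbing a frame vector, provided
some unimodular ζ makes c² + ζc(1 − c) something other than a nonnegative real (`exists_gap`). Over
ℂ take ζ = i. Over ℝ take ζ = −1, which needs c < 1/2, that is n ≥ 3.

Uniqueness. For the real plane c = 1/2 and δ = 4/3. Equality in the energy estimate forces μ onto
six functionals, the vertices of a regular hexagon in isotropic coordinates. Then Φ is a multiple of
the trace, and the norm is determined (`exists_norm_eq_max_of_le_absProjConst`). -/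

open MeasureTheory Set

/-! ### Separation of a cone by a functional and a probability measure -/

section Riesz

/-- The Riesz–Markov–Kakutani theorem for a normalized positive functional on a compact space. -/
theorem exists_probabilityMeasure_of_positive {K : Type*} [TopologicalSpace K] [CompactSpace K]
    [T2Space K] [MeasurableSpace K] [BorelSpace K] (l : C(K, ℝ) →ₗ[ℝ] ℝ)
    (hpos : ∀ h : C(K, ℝ), 0 ≤ h → 0 ≤ l h) (h1 : l 1 = 1) :
    ∃ μ : Measure K, IsProbabilityMeasure μ ∧ ∀ h : C(K, ℝ), l h = ∫ g, h g ∂μ := by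
  let L : CompactlySupportedContinuousMap K ℝ →ₗ[ℝ] ℝ :=
    { toFun := fun h => l h.toContinuousMap
      map_add' := fun a b => map_add l a.toContinuousMap b.toContinuousMap
      map_smul' := fun t a => map_smul l t a.toContinuousMap }
  let Λ : CompactlySupportedContinuousMap K ℝ →ₚ[ℝ] ℝ :=
    PositiveLinearMap.mk₀ L (fun h hh => hpos _ hh)
  have key : ∀ h : C(K, ℝ), l h = ∫ g, h g ∂(RealRMK.rieszMeasure Λ) := fun h =>
    (RealRMK.integral_rieszMeasure Λ
      (CompactlySupportedContinuousMap.continuousMapEquiv h)).symm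
  refine ⟨RealRMK.rieszMeasure Λ, ⟨?_⟩, key⟩
  have := key 1
  rw [h1] at this
  simp only [ContinuousMap.one_apply, integral_const, smul_eq_mul, mul_one] at this
  rw [Measure.real, eq_comm, ENNReal.toReal_eq_one_iff] at this
  exact this

/-- Separation of a convex cone `A` in `U × C(K, ℝ)` from a point of `U`, in terms of a functional on
`U` and a probability measure on `K`. -/
theorem exists_functional_le_integral {K : Type*} [TopologicalSpace K] [CompactSpace K] [T2Space K]
    [MeasurableSpace K] [BorelSpace K] [Nonempty K] {U : Type*} [NormedAddCommGroup U]
    [NormedSpace ℝ U] {A : Set (U × C(K, ℝ))}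
    (hadd : ∀ p ∈ A, ∀ q ∈ A, p + q ∈ A) (hsmul : ∀ p ∈ A, ∀ t : ℝ, 0 ≤ t → t • p ∈ A)
    (hzero : ∀ h : C(K, ℝ), 0 ≤ h → (0, h) ∈ A) {C : ℝ} (hC : 0 ≤ C)
    (hconst : ∀ u : U, (u, (C * ‖u‖) • (1 : C(K, ℝ))) ∈ A) {δ : ℝ} (hδ : 0 < δ) {u₀ : U}
    (hu₀ : ∀ h : C(K, ℝ), (u₀, h) ∈ A → ∃ g, δ ≤ h g) :
    ∃ (φ : StrongDual ℝ U) (μ : Measure K), IsProbabilityMeasure μ ∧ δ ≤ φ u₀ ∧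
      ∀ u h, (u, h) ∈ A → φ u ≤ ∫ g, h g ∂μ := by
  -- The points (u₀, h) with h < δ are thickened in the U direction to obtain an open set. The
  -- cushion C‖u − u₀‖ is the price, by `hconst`, of moving back to u₀ inside A, so O still misses
  -- A.
  let O : Set (U × C(K, ℝ)) := {p | ∀ g, p.2 g + C * ‖p.1 - u₀‖ < δ}
  have hA : Convex ℝ A := fun p hp q hq a b ha hb _ => hadd _ (hsmul p hp a ha) _ (hsmul q hq b hb)
  have hO : Convex ℝ O := by
    intro p hp q hq a b ha hb hab g
    have h3 : ‖(a • p + b • q).1 - u₀‖ ≤ a * ‖p.1 - u₀‖ + b * ‖q.1 - u₀‖ := by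
      have : (a • p + b • q).1 - u₀ = a • (p.1 - u₀) + b • (q.1 - u₀) := by
        have : u₀ = a • u₀ + b • u₀ := by rw [← add_smul, hab, one_smul]
        conv_lhs => rw [this]
        simp only [Prod.fst_add, Prod.smul_fst, smul_sub]
        abel
      rw [this]
      refine (norm_add_le _ _).trans ?_
      rw [norm_smul, norm_smul, Real.norm_of_nonneg ha, Real.norm_of_nonneg hb]
    have h4 : (a • p + b • q).2 g = a * p.2 g + b * q.2 g := rfl
    have h6 : a * (p.2 g + C * ‖p.1 - u₀‖) + b * (q.2 g + C * ‖q.1 - u₀‖) < δ := by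
      have := convex_Iio (𝕜 := ℝ) δ (hp g) (hq g) ha hb hab
      simpa using this
    rw [h4]
    linarith [mul_le_mul_of_nonneg_left h3 hC]
  have hOo : IsOpen O := by
    have hcont : Continuous fun p : U × C(K, ℝ) => p.2 + (C * ‖p.1 - u₀‖) • (1 : C(K, ℝ)) := by
      fun_prop
    have := (ContinuousMap.isOpen_setOfPred_mapsTo (X := K) isCompact_univ
      (isOpen_Iio (a := δ))).preimage hcont
    convert this using 1
    ext p
    simp [O, MapsTo]
  have hdisj : Disjoint O A := by
    rw [Set.disjoint_left]
    intro p hpO hpA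
    have h1 := hadd _ hpA _ (hconst (u₀ - p.1))
    have h2 : p + (u₀ - p.1, (C * ‖u₀ - p.1‖) • (1 : C(K, ℝ))) =
        (u₀, p.2 + (C * ‖p.1 - u₀‖) • 1) := by
      ext1
      · simp
      · simp [norm_sub_rev]
    rw [h2] at h1
    obtain ⟨g, hg⟩ := hu₀ _ h1
    have := hpO g
    simp only [ContinuousMap.add_apply, ContinuousMap.smul_apply, ContinuousMap.one_apply,
      smul_eq_mul, mul_one] at hg
    linarith
  obtain ⟨F, s, hFO, hFA⟩ := geometric_hahn_banach_open hO hOo hA hdisj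
  have hs : s ≤ 0 := by simpa using hFA 0 (hzero 0 le_rfl)
  -- A is a cone, so a negative value of F could be scaled below the separation level s.
  have hFA' : ∀ p ∈ A, 0 ≤ F p := by
    intro p hp
    by_contra hneg
    push Not at hneg
    have h1 : 0 ≤ (s - 1) / F p := div_nonneg_of_nonpos (by linarith) hneg.le
    have h2 := hFA _ (hsmul p hp _ h1)
    rw [map_smul, smul_eq_mul, div_mul_cancel₀ _ hneg.ne] at h2
    linarith
  let ℓ : C(K, ℝ) →ₗ[ℝ] ℝ := F.toLinearMap ∘ₗ LinearMap.inr ℝ _ _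
  let φ : StrongDual ℝ U := -(F.comp (ContinuousLinearMap.inl ℝ _ _))
  have hsplit : ∀ u h, F (u, h) = ℓ h - φ u := fun u h => by
    have : (u, h) = ((u, 0) : U × C(K, ℝ)) + (0, h) := by simp
    rw [this, map_add]
    simp [ℓ, φ, add_comm]
  have hℓpos : ∀ h : C(K, ℝ), 0 ≤ h → 0 ≤ ℓ h := fun h hh => by
    have := hFA' (0, h) (hzero h hh)
    rwa [hsplit, map_zero, sub_zero] at this
  have hlt : ∀ t < δ, t * ℓ 1 < φ u₀ := fun t ht => by
    have := hFO (u₀, t • 1) (fun g => by simpa using ht)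
    rw [hsplit, map_smul, smul_eq_mul] at this
    linarith
  have hφ : 0 < φ u₀ := by simpa using hlt 0 hδ
  -- If ℓ 1 vanished, F would equal −φ u₀ < 0 at the point (u₀, C‖u₀‖ · 1) of A. Hence ℓ can be
  -- normalized to a probability measure.
  have hℓ1 : 0 < ℓ 1 := by
    refine lt_of_le_of_ne (hℓpos 1 zero_le_one) fun h0 => ?_
    have := hFA' (u₀, _) (hconst u₀)
    rw [hsplit, map_smul, ← h0, smul_zero] at this
    linarith
  have hδφ : δ * ℓ 1 ≤ φ u₀ := by
    by_contra hcon
    push Not at hcon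
    have := hlt (φ u₀ / ℓ 1) (by rwa [div_lt_iff₀ hℓ1])
    rw [div_mul_cancel₀ _ hℓ1.ne'] at this
    exact lt_irrefl _ this
  obtain ⟨μ, hμ, hint⟩ := exists_probabilityMeasure_of_positive ((ℓ 1)⁻¹ • ℓ)
    (fun h hh => mul_nonneg (inv_nonneg.mpr hℓ1.le) (hℓpos h hh))
    (by simp [hℓ1.ne'])
  refine ⟨(ℓ 1)⁻¹ • φ, μ, hμ, ?_, fun u h hh => ?_⟩
  · change δ ≤ (ℓ 1)⁻¹ * φ u₀
    rwa [inv_mul_eq_div, le_div_iff₀ hℓ1]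
  · have h1 := hFA' _ hh
    rw [hsplit] at h1
    rw [← hint h]
    exact mul_le_mul_of_nonneg_left (sub_nonneg.mp h1) (inv_nonneg.mpr hℓ1.le)

end Riesz

/-! ### Trace duality for the projection constant -/

section Duality

variable {𝕜 : Type*} [RCLike 𝕜] {X : Type u} [NormedAddCommGroup X] [NormedSpace 𝕜 X]

/-- The closed unit ball of the dual space. -/
abbrev DualBall (𝕜 : Type*) [RCLike 𝕜] (X : Type*) [NormedAddCommGroup X] [NormedSpace 𝕜 X] :
    Type _ :=
  ↥(Metric.closedBall (0 : StrongDual 𝕜 X) 1)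

theorem DualBall.norm_le (g : DualBall 𝕜 X) : ‖g.1‖ ≤ 1 := mem_closedBall_zero_iff.mp g.2

theorem DualBall.apply_le (g : DualBall 𝕜 X) (x : X) : ‖g.1 x‖ ≤ ‖x‖ :=
  (g.1.le_opNorm x).trans (mul_le_of_le_one_left (norm_nonneg _) g.norm_le)

instance [FiniteDimensional 𝕜 X] : CompactSpace (DualBall 𝕜 X) := by
  have : ProperSpace (StrongDual 𝕜 X) := FiniteDimensional.proper_rclike 𝕜 _
  exact isCompact_iff_compactSpace.mp (isCompact_closedBall _ _)

instance [FiniteDimensional 𝕜 X] : SecondCountableTopology (DualBall 𝕜 X) := by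
  have : ProperSpace (StrongDual 𝕜 X) := FiniteDimensional.proper_rclike 𝕜 _
  infer_instance

theorem DualBall.continuous_apply (x : X) : Continuous fun g : DualBall 𝕜 X => g.1 x := by
  fun_prop

/-- The function `g ↦ |g x|` on the dual unit ball. -/
noncomputable def absEval (𝕜 : Type*) [RCLike 𝕜] {X : Type*} [NormedAddCommGroup X]
    [NormedSpace 𝕜 X] (x : X) : C(DualBall 𝕜 X, ℝ) :=
  ⟨fun g => ‖g.1 x‖, by fun_prop⟩

/-- `u` extends along every isometric embedding `X → Z` to an operator `Z → X` which is dominated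
by `h` on the dual unit ball. -/
def HasDominatedExtensions (u : X →L[𝕜] X) (h : C(DualBall 𝕜 X, ℝ)) : Prop :=
  ∀ (Z : Type u) (_ : NormedAddCommGroup Z) (_ : NormedSpace 𝕜 Z) (T : X →ₗᵢ[𝕜] Z),
    ∃ R : Z →L[𝕜] X, (∀ x, R (T x) = u x) ∧ ∀ (z : Z) (g : DualBall 𝕜 X), ‖g.1 (R z)‖ ≤ h g * ‖z‖

namespace HasDominatedExtensions

/-- Together with `add` and `smul`, this makes the pairs (u, h) a convex cone. Containing all (0, h)
with h ≥ 0 is what makes the separating functional positive on functions. -/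
theorem zero {h : C(DualBall 𝕜 X, ℝ)} (hh : 0 ≤ h) :
    HasDominatedExtensions (0 : X →L[𝕜] X) h :=
  fun Z _ _ T => ⟨0, by simp, fun z g => by simpa using mul_nonneg (hh g) (norm_nonneg z)⟩

theorem add {u v : X →L[𝕜] X} {h k : C(DualBall 𝕜 X, ℝ)} (hu : HasDominatedExtensions u h)
    (hv : HasDominatedExtensions v k) : HasDominatedExtensions (u + v) (h + k) := by
  intro Z _ _ T
  obtain ⟨R, hR, hR'⟩ := hu Z _ _ T
  obtain ⟨S, hS, hS'⟩ := hv Z _ _ T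
  refine ⟨R + S, fun x => by simp [hR, hS], fun z g => ?_⟩
  simp only [add_apply, map_add, ContinuousMap.add_apply, add_mul]
  exact (norm_add_le _ _).trans (add_le_add (hR' z g) (hS' z g))

theorem smul {u : X →L[𝕜] X} {h : C(DualBall 𝕜 X, ℝ)} (hu : HasDominatedExtensions u h)
    {t : ℝ} (ht : 0 ≤ t) : HasDominatedExtensions ((t : 𝕜) • u) (t • h) := by
  intro Z _ _ T
  obtain ⟨R, hR, hR'⟩ := hu Z _ _ T
  refine ⟨(t : 𝕜) • R, fun x => by simp [hR], fun z g => ?_⟩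
  rw [smul_apply, map_smul, norm_smul, RCLike.norm_ofReal, abs_of_nonneg ht,
    ContinuousMap.smul_apply, smul_eq_mul, mul_assoc]
  exact mul_le_mul_of_nonneg_left (hR' z g) ht

theorem exists_extension {Z : Type*} [NormedAddCommGroup Z] [NormedSpace 𝕜 Z] (T : X →ₗᵢ[𝕜] Z)
    (f : StrongDual 𝕜 X) : ∃ F : StrongDual 𝕜 Z, (∀ x, F (T x) = f x) ∧ ‖F‖ ≤ ‖f‖ := by
  let e := T.equivRange
  obtain ⟨F, hF, hF'⟩ := exists_extension_norm_eq (LinearMap.range T.toLinearMap)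
    (f.comp (e.symm.toContinuousLinearEquiv : _ →L[𝕜] X))
  refine ⟨F, fun x => ?_, ?_⟩
  · have := hF (e x)
    simpa [e] using this
  · rw [hF']
    refine ContinuousLinearMap.opNorm_le_bound _ (norm_nonneg _) fun y => ?_
    simpa using f.le_opNorm (e.symm y)

/-- A norm-preserving extension F of f turns f ⊗ x into F ⊗ x, and |g(F(z)x)| ≤ ‖z‖ |g x|. These
pairs later become the domination Re Φ(f ⊗ x) ≤ ∫ |g x| dμ. -/
theorem smulRight (f : DualBall 𝕜 X) (x : X) :
    HasDominatedExtensions (f.1.smulRight x) (absEval 𝕜 x) := by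
  intro Z _ _ T
  obtain ⟨F, hF, hF'⟩ := exists_extension T f.1
  refine ⟨F.smulRight x, fun y => by simp [hF], fun z g => ?_⟩
  simp only [ContinuousLinearMap.smulRight_apply, map_smul, norm_smul]
  rw [mul_comm]
  refine mul_le_mul_of_nonneg_left ((F.le_opNorm z).trans ?_) (norm_nonneg _)
  exact mul_le_of_le_one_left (norm_nonneg _) (hF'.trans f.norm_le)

/-- Extending the coordinate functionals of a basis extends the identity with a norm bound that does
not depend on the embedding; composing with u handles every operator. This supplies the cushion
required for the separation. -/
theorem exists_const [FiniteDimensional 𝕜 X] : ∃ C : ℝ, 0 ≤ C ∧ ∀ u : X →L[𝕜] X,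
    HasDominatedExtensions u ((C * ‖u‖) • 1) := by
  let b := Module.finBasis 𝕜 X
  let c : ∀ i, StrongDual 𝕜 X := fun i => (b.coord i).toContinuousLinearMap
  refine ⟨∑ i, ‖c i‖ * ‖b i‖, by positivity, fun u Z _ _ T => ?_⟩
  choose F hF hF' using fun i => exists_extension T (c i)
  refine ⟨u.comp (∑ i, (F i).smulRight (b i)), fun x => ?_, fun z g => ?_⟩
  · simp only [ContinuousLinearMap.comp_apply, sum_apply,
      ContinuousLinearMap.smulRight_apply, hF]
    congr 1
    exact b.sum_repr x
  · refine (g.apply_le _).trans ((u.le_opNorm _).trans ?_)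
    rw [ContinuousMap.smul_apply, ContinuousMap.one_apply, smul_eq_mul, mul_one, mul_comm _ ‖u‖,
      mul_assoc]
    refine mul_le_mul_of_nonneg_left ?_ (norm_nonneg _)
    change ‖(∑ i, (F i).smulRight (b i)) z‖ ≤ _
    rw [sum_apply, Finset.sum_mul]
    refine (norm_sum_le _ _).trans (Finset.sum_le_sum fun i _ => ?_)
    rw [ContinuousLinearMap.smulRight_apply, norm_smul, mul_right_comm]
    refine mul_le_mul_of_nonneg_right (((F i).le_opNorm z).trans ?_) (norm_nonneg _)
    exact mul_le_mul_of_nonneg_right (hF' i) (norm_nonneg _)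

/-- An extension R of the identity along T gives the projection T ∘ R, and a norming functional of R
z converts the pointwise domination into a norm bound. -/
theorem absProjConst_le {h : C(DualBall 𝕜 X, ℝ)} {δ : ℝ} (hδ : 0 ≤ δ)
    (hh : HasDominatedExtensions (ContinuousLinearMap.id 𝕜 X) h) (hle : ∀ g, h g ≤ δ) :
    absProjConst 𝕜 X ≤ ENNReal.ofReal δ := by
  refine iSup_le fun Z => iSup_le fun _ => iSup_le fun _ => iSup_le fun T => ?_
  obtain ⟨R, hR, hR'⟩ := hh Z _ _ T
  have hP : LinearMap.IsProj (LinearMap.range T.toLinearMap) (T.toContinuousLinearMap.comp R) := by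
    refine ⟨fun z => ⟨R z, rfl⟩, ?_⟩
    rintro _ ⟨x, rfl⟩
    change T (R (T x)) = T x
    simp [hR]
  refine (iInf₂_le _ hP).trans ?_
  · rw [← ofReal_norm]
    refine ENNReal.ofReal_le_ofReal (ContinuousLinearMap.opNorm_le_bound _ hδ fun z => ?_)
    simp only [ContinuousLinearMap.comp_apply, LinearIsometry.coe_toContinuousLinearMap,
      LinearIsometry.norm_map]
    obtain ⟨g, hg, hg'⟩ := exists_dual_vector'' 𝕜 (R z)
    have := hR' z ⟨g, by simpa using hg⟩
    rw [hg'] at this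
    simp only [RCLike.norm_ofReal, abs_norm] at this
    exact this.trans (mul_le_mul_of_nonneg_right (hle _) (norm_nonneg _))

end HasDominatedExtensions

/-- Trace duality for the absolute projection constant, combined with Pietsch domination. -/
theorem exists_dual_certificate [FiniteDimensional 𝕜 X] {δ : ℝ} (hδ : 0 < δ)
    (hX : ENNReal.ofReal δ ≤ absProjConst 𝕜 X) :
    ∃ (Φ : StrongDual 𝕜 (X →L[𝕜] X)) (μ : Measure (DualBall 𝕜 X)), IsProbabilityMeasure μ ∧
      δ ≤ RCLike.re (Φ (ContinuousLinearMap.id 𝕜 X)) ∧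
      ∀ (f : DualBall 𝕜 X) (x : X),
        RCLike.re (Φ (f.1.smulRight x)) ≤ ∫ g, ‖g.1 x‖ ∂μ := by
  let _ : NormedSpace ℝ (X →L[𝕜] X) := NormedSpace.restrictScalars ℝ 𝕜 _
  have hsmul : ∀ (t : ℝ) (u : X →L[𝕜] X), t • u = (t : 𝕜) • u := fun t u => by
    change (algebraMap ℝ 𝕜 t) • u = _
    rw [RCLike.algebraMap_eq_ofReal]
  have : IsScalarTower ℝ 𝕜 (X →L[𝕜] X) := ⟨fun t a u => by
    rw [hsmul, smul_smul, RCLike.real_smul_eq_coe_mul]⟩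
  have : Nonempty (DualBall 𝕜 X) := ⟨⟨0, by simp⟩⟩
  obtain ⟨C, hC, hext⟩ := HasDominatedExtensions.exists_const (𝕜 := 𝕜) (X := X)
  -- The separation is carried out over ℝ at u₀ = id. Any h dominating extensions of the identity
  -- must reach δ somewhere, since otherwise λ(X) < δ. The real functional φ is then the real part
  -- of a 𝕜-linear one.
  obtain ⟨φ, μ, hμ, hφ, hle⟩ := exists_functional_le_integral
    (A := {p : (X →L[𝕜] X) × C(DualBall 𝕜 X, ℝ) | HasDominatedExtensions p.1 p.2})
    (fun p hp q hq => hp.add hq)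
    (fun p hp t ht => by
      have := HasDominatedExtensions.smul hp ht
      rwa [← hsmul] at this)
    (fun h hh => HasDominatedExtensions.zero hh) hC hext hδ
    (u₀ := ContinuousLinearMap.id 𝕜 X) (fun h hh => by
      obtain ⟨g₀, -, hg₀⟩ := isCompact_univ.exists_isMaxOn (univ_nonempty (α := DualBall 𝕜 X))
        h.continuous.continuousOn
      refine ⟨g₀, ?_⟩
      have h2 := HasDominatedExtensions.absProjConst_le (δ := max (h g₀) 0) (le_max_right _ _) hh
        (fun g => (hg₀ (mem_univ g)).trans (le_max_left _ _))
      have h3 := hX.trans h2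
      rw [ENNReal.ofReal_le_ofReal_iff (le_max_right _ _)] at h3
      rcases le_max_iff.mp h3 with h | h
      · exact h
      · exact absurd hδ h.not_gt)
  have hre : ∀ u, RCLike.re ((φ.extendRCLike : StrongDual 𝕜 (X →L[𝕜] X)) u) = φ u := fun u => by
    rw [StrongDual.extendRCLike_apply]; simp
  refine ⟨φ.extendRCLike, μ, hμ, ?_, fun f x => ?_⟩
  · rwa [hre]
  · rw [hre]
    exact hle _ _ (HasDominatedExtensions.smulRight f x)

end Duality

/-! ### Fourth moment tensors -/

section Moments

variable {Ω : Type*} [MeasurableSpace Ω] {μ : Measure Ω} [IsProbabilityMeasure μ]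
  {𝕜 : Type*} [RCLike 𝕜] {ι : Type*} [Fintype ι]

/-- The tensor `v ⊗ v̄ ⊗ v ⊗ v̄`. -/
noncomputable def tensorFour (v : EuclideanSpace 𝕜 ι) : EuclideanSpace 𝕜 (ι × ι × ι × ι) :=
  WithLp.toLp 2 fun p => v p.1 * star (v p.2.1) * (v p.2.2.1 * star (v p.2.2.2))

/-- This rewrites a double integral of |⟨F, F'⟩|⁴ as the squared norm of a mean tensor, which
Cauchy–Schwarz against a fixed tensor bounds from below. -/
theorem inner_tensorFour (v w : EuclideanSpace 𝕜 ι) :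
    inner 𝕜 (tensorFour v) (tensorFour w) = ((‖inner 𝕜 v w‖ ^ 4 : ℝ) : 𝕜) := by
  have h : ((‖inner 𝕜 v w‖ ^ 4 : ℝ) : 𝕜) = (inner 𝕜 v w * star (inner 𝕜 v w)) *
      (inner 𝕜 v w * star (inner 𝕜 v w)) := by
    rw [RCLike.star_def, RCLike.mul_conj]
    push_cast
    ring
  rw [h, PiLp.inner_apply, PiLp.inner_apply, star_sum]
  simp only [Fintype.sum_prod_type, Finset.sum_mul_sum, tensorFour]
  simp only [RCLike.inner_apply, RCLike.star_def, map_mul, RCLike.conj_conj]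
  refine Finset.sum_congr rfl fun i _ => ?_
  rw [Finset.sum_comm]
  refine Finset.sum_congr rfl fun j _ => Finset.sum_congr rfl fun k _ =>
    Finset.sum_congr rfl fun l _ => ?_
  ring

omit [Fintype ι] in
theorem continuous_tensorFour : Continuous (tensorFour : EuclideanSpace 𝕜 ι → _) := by
  unfold tensorFour
  fun_prop

theorem norm_tensorFour (v : EuclideanSpace 𝕜 ι) : ‖tensorFour v‖ = ‖v‖ ^ 4 := by
  have h := inner_tensorFour v v
  rw [inner_self_eq_norm_sq_to_K, inner_self_eq_norm_sq_to_K] at h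
  have h' : ‖tensorFour v‖ ^ 2 = (‖v‖ ^ 4) ^ 2 := by
    have : ((‖tensorFour v‖ ^ 2 : ℝ) : 𝕜) = (((‖v‖ ^ 4) ^ 2 : ℝ) : 𝕜) := by
      push_cast
      rw [h]
      simp
      ring
    exact_mod_cast this
  exact (pow_left_inj₀ (norm_nonneg _) (by positivity) two_ne_zero).mp h'

/-- The tensor `δᵢⱼ δₖₗ + δᵢₗ δₖⱼ`. -/
noncomputable def isoTensor (𝕜 : Type*) [RCLike 𝕜] (ι : Type*) [Fintype ι] [DecidableEq ι] :
    EuclideanSpace 𝕜 (ι × ι × ι × ι) :=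
  WithLp.toLp 2 fun p => (if p.1 = p.2.1 then if p.2.2.1 = p.2.2.2 then 1 else 0 else 0) +
    if p.1 = p.2.2.2 then if p.2.2.1 = p.2.1 then 1 else 0 else 0

/-- The tensor `δᵢⱼ δₖₗ + δᵢₗ δₖⱼ + δᵢₖ δⱼₗ`. -/
noncomputable def isoTensorReal (ι : Type*) [Fintype ι] [DecidableEq ι] :
    EuclideanSpace ℝ (ι × ι × ι × ι) :=
  WithLp.toLp 2 fun p => ((if p.1 = p.2.1 then if p.2.2.1 = p.2.2.2 then 1 else 0 else 0) +
    if p.1 = p.2.2.2 then if p.2.2.1 = p.2.1 then 1 else 0 else 0) +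
    if p.1 = p.2.2.1 then if p.2.1 = p.2.2.2 then 1 else 0 else 0

theorem sum_mul_star_eq (v : EuclideanSpace 𝕜 ι) : ∑ i, v i * star (v i) = ((‖v‖ ^ 2 : ℝ) : 𝕜) := by
  rw [EuclideanSpace.norm_sq_eq]
  push_cast
  refine Finset.sum_congr rfl fun i _ => ?_
  rw [RCLike.star_def, RCLike.mul_conj]

variable [DecidableEq ι]

/-- Both pairings match an entry of v with a conjugated one, hence give ‖v‖⁴ over either field. The
remaining pairing would give |∑ vᵢ²|², which is ‖v‖⁴ for real v only; this is the source of the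
different constants over ℝ and ℂ. -/
theorem inner_isoTensor (v : EuclideanSpace 𝕜 ι) :
    inner 𝕜 (isoTensor 𝕜 ι) (tensorFour v) = 2 * ((‖v‖ ^ 4 : ℝ) : 𝕜) := by
  have h : ((‖v‖ ^ 4 : ℝ) : 𝕜) = (∑ i, v i * star (v i)) * ∑ i, v i * star (v i) := by
    rw [sum_mul_star_eq]; push_cast; ring
  rw [h, PiLp.inner_apply, two_mul]
  simp only [Fintype.sum_prod_type, tensorFour, isoTensor, RCLike.inner_apply, map_add, mul_add,
    Finset.sum_add_distrib, apply_ite (starRingEnd 𝕜), map_zero, map_one, mul_ite, mul_one,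
    mul_zero]
  simp only [Finset.sum_ite_eq, Finset.sum_ite_eq', Finset.mem_univ, if_true, Finset.sum_ite_irrel,
    Finset.sum_const_zero, Finset.sum_mul_sum]
  congr 1
  refine Finset.sum_congr rfl fun i _ => Finset.sum_congr rfl fun j _ => ?_
  ring

theorem norm_isoTensor_sq :
    ‖isoTensor 𝕜 ι‖ ^ 2 = 2 * (Fintype.card ι : ℝ) ^ 2 + 2 * Fintype.card ι := by
  have h : ((‖isoTensor 𝕜 ι‖ ^ 2 : ℝ) : 𝕜) =
      ((2 * (Fintype.card ι : ℝ) ^ 2 + 2 * Fintype.card ι : ℝ) : 𝕜) := by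
    have hd : ∀ x y : ι, (if x = y then if y = x then 1 else 0 else 0 : 𝕜) =
        if x = y then 1 else 0 := fun x y => by by_cases h : x = y <;> simp [h]
    push_cast
    rw [← inner_self_eq_norm_sq_to_K, PiLp.inner_apply]
    simp only [Fintype.sum_prod_type, isoTensor, RCLike.inner_apply, map_add, mul_add,
      Finset.sum_add_distrib, apply_ite (starRingEnd 𝕜), map_zero, map_one, mul_ite, mul_one,
      mul_zero]
    simp only [Finset.sum_ite_eq, Finset.sum_ite_eq', Finset.mem_univ, if_true,
      Finset.sum_ite_irrel, Finset.sum_const_zero, Finset.sum_add_distrib, hd]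
    simp
    ring
  exact_mod_cast h

theorem inner_isoTensorReal (v : EuclideanSpace ℝ ι) :
    inner ℝ (isoTensorReal ι) (tensorFour v) = 3 * ‖v‖ ^ 4 := by
  have h : ‖v‖ ^ 4 = (∑ i, v i * star (v i)) * ∑ i, v i * star (v i) := by
    rw [sum_mul_star_eq]; simp; ring
  rw [h, PiLp.inner_apply]
  simp only [Fintype.sum_prod_type, tensorFour, isoTensorReal, RCLike.inner_apply, map_add, mul_add,
    Finset.sum_add_distrib, apply_ite (starRingEnd ℝ), map_zero, map_one, mul_ite, mul_one,
    mul_zero]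
  simp only [Finset.sum_ite_eq, Finset.sum_ite_eq', Finset.mem_univ, if_true, Finset.sum_ite_irrel,
    Finset.sum_const_zero, Finset.sum_mul_sum, star_trivial]
  simp only [← Finset.sum_add_distrib, Finset.mul_sum]
  refine Finset.sum_congr rfl fun i _ => Finset.sum_congr rfl fun j _ => ?_
  ring

theorem norm_isoTensorReal_sq :
    ‖isoTensorReal ι‖ ^ 2 = 3 * (Fintype.card ι : ℝ) ^ 2 + 6 * Fintype.card ι := by
  have hd : ∀ x y : ι, (if x = y then if y = x then 1 else 0 else 0 : ℝ) =
      if x = y then 1 else 0 := fun x y => by by_cases h : x = y <;> simp [h]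
  rw [← real_inner_self_eq_norm_sq, PiLp.inner_apply]
  simp only [Fintype.sum_prod_type, isoTensorReal, RCLike.inner_apply, map_add, mul_add,
    Finset.sum_add_distrib, apply_ite (starRingEnd ℝ), map_zero, map_one, mul_ite, mul_one,
    mul_zero]
  simp only [Finset.sum_ite_eq, Finset.sum_ite_eq', Finset.mem_univ, if_true,
    Finset.sum_ite_irrel, Finset.sum_const_zero, Finset.sum_add_distrib, hd]
  simp
  ring

end Moments

/-! ### The quartic majorant -/

section QuarticBound

/-- A quartic upper bound for the identity on `[0, 1]`, in homogeneous form, with its remainder. -/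
theorem quartic_remainder {c q p : ℝ} (hqp : p = 0 → q = 0) :
    (c ^ 2 * (2 * c + 1) * p + (3 * c ^ 2 + 2 * c + 1) * (q ^ 2 / p) - q ^ 4 / p ^ 3) -
      2 * c * (1 + c) ^ 2 * q = p * (q / p - c) ^ 2 * (1 - q / p) * (q / p + 2 * c + 1) := by
  -- For p = 0 the quotients take their default value 0, and both sides vanish because q = 0.
  rcases eq_or_ne p 0 with hp | hp
  · simp [hp, hqp hp]
  · field_simp
    ring

/-- With t = q/p in [0, 1] every factor is nonnegative. The double zero at c and the simple zero at
1 are the values of |⟨wᵢ, wⱼ⟩| in the frame; the fourth root −2c − 1 is the one that removes the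
cubic term. -/
theorem quartic_remainder_nonneg {c q p : ℝ} (hc : 0 < c) (hq : 0 ≤ q) (hqp : q ≤ p) :
    0 ≤ p * (q / p - c) ^ 2 * (1 - q / p) * (q / p + 2 * c + 1) := by
  have hp : 0 ≤ p := hq.trans hqp
  have h1 : q / p ≤ 1 := div_le_one_of_le₀ hqp hp
  have h2 : 0 ≤ q / p := div_nonneg hq hp
  have h3 : 0 ≤ 1 - q / p := by linarith
  positivity

end QuarticBound

/-! ### The energy estimate for isotropic random vectors -/

section Moments

variable {Ω : Type*} [MeasurableSpace Ω] {μ : Measure Ω} [IsProbabilityMeasure μ]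
  {𝕜 : Type*} [RCLike 𝕜] {ι : Type*} [Fintype ι]

omit [IsProbabilityMeasure μ] in
/-- Cauchy–Schwarz for the mean of a vector-valued function. -/
theorem norm_integral_inner_sq_le [IsFiniteMeasure μ] {V : Type*} [NormedAddCommGroup V]
    [InnerProductSpace 𝕜 V] [CompleteSpace V] [NormedSpace ℝ V] {G : Ω → V} (hG : Integrable G μ)
    (Ψ : V) : ‖∫ ω, inner 𝕜 Ψ (G ω) ∂μ‖ ^ 2 ≤
      ‖Ψ‖ ^ 2 * ‖∫ ω, ∫ ω', inner 𝕜 (G ω) (G ω') ∂μ ∂μ‖ := by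
  have h1 : ∫ ω, ∫ ω', inner 𝕜 (G ω) (G ω') ∂μ ∂μ = inner 𝕜 (∫ ω, G ω ∂μ) (∫ ω, G ω ∂μ) := by
    simp_rw [integral_inner hG]
    rw [← inner_conj_symm, ← integral_inner hG, ← integral_conj]
    simp
  rw [h1, integral_inner hG, inner_self_eq_norm_sq_to_K]
  have h2 : ‖((‖∫ ω, G ω ∂μ‖ : ℝ) : 𝕜) ^ 2‖ = ‖∫ ω, G ω ∂μ‖ ^ 2 := by simp
  rw [h2, ← mul_pow]
  exact pow_le_pow_left₀ (norm_nonneg _) (norm_inner_le_norm _ _) 2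

variable {F : Ω → EuclideanSpace 𝕜 ι} {C : ℝ}

theorem integrable_of_measurable_of_bound {f : Ω → ℝ} (hf : Measurable f) {C : ℝ}
    (hC : ∀ ω, |f ω| ≤ C) : Integrable f μ :=
  Integrable.of_bound hf.aestronglyMeasurable C (ae_of_all _ hC)

/-- A bound on the mean norm by the fourth moments, from a fixed tensor `Ψ`. -/
theorem sq_integral_norm_le_of_tensor (hF : Measurable F) (hC : ∀ ω, ‖F ω‖ ≤ C)
    {Ψ : EuclideanSpace 𝕜 (ι × ι × ι × ι)} {t : ℝ}
    (hΨ : ∀ v : EuclideanSpace 𝕜 ι, inner 𝕜 Ψ (tensorFour v) = ((t * ‖v‖ ^ 4 : ℝ) : 𝕜)) :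
    (t * ∫ ω, ‖F ω‖ ∂μ) ^ 2 ≤ ‖Ψ‖ ^ 2 *
      ∫ z, ‖inner 𝕜 (F z.1) (F z.2)‖ ^ 4 / (‖F z.1‖ * ‖F z.2‖) ^ 3 ∂(μ.prod μ) := by
  -- The weight ‖F‖⁻³ makes the tensor homogeneous of degree one, so that ‖G‖ = ‖F‖; zeros of F are
  -- harmless since the inverse of 0 is 0.
  let G : Ω → EuclideanSpace 𝕜 (ι × ι × ι × ι) :=
    fun ω => (((‖F ω‖ ^ 3)⁻¹ : ℝ) : 𝕜) • tensorFour (F ω)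
  have hGn : ∀ ω, ‖G ω‖ = ‖F ω‖ := fun ω => by
    simp only [G, norm_smul, norm_tensorFour, RCLike.norm_ofReal]
    rcases eq_or_ne ‖F ω‖ 0 with h | h
    · simp [h]
    · rw [abs_of_nonneg (by positivity)]
      field_simp
  have hGm : Measurable G := by
    have h1 : Measurable fun ω => tensorFour (F ω) := continuous_tensorFour.measurable.comp hF
    have h2 : Measurable fun ω => (((‖F ω‖ ^ 3)⁻¹ : ℝ) : 𝕜) :=
      RCLike.measurable_ofReal.comp (hF.norm.pow_const 3).inv
    exact h2.smul h1
  have hG : Integrable G μ :=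
    Integrable.of_bound hGm.aestronglyMeasurable C (ae_of_all _ fun ω => (hGn ω).trans_le (hC ω))
  have hinner : ∀ ω ω', inner 𝕜 (G ω) (G ω') =
      ((‖inner 𝕜 (F ω) (F ω')‖ ^ 4 / (‖F ω‖ * ‖F ω'‖) ^ 3 : ℝ) : 𝕜) := fun ω ω' => by
    simp only [G, inner_smul_left, inner_smul_right, inner_tensorFour, RCLike.conj_ofReal]
    push_cast
    ring
  have hΨG : ∀ ω, inner 𝕜 Ψ (G ω) = ((t * ‖F ω‖ : ℝ) : 𝕜) := fun ω => by
    simp only [G, inner_smul_right, hΨ]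
    rw [← RCLike.ofReal_mul]
    congr 1
    rcases eq_or_ne ‖F ω‖ 0 with h | h
    · simp [h]
    · field_simp
  have hint : Integrable (fun z : Ω × Ω => ‖inner 𝕜 (F z.1) (F z.2)‖ ^ 4 /
      (‖F z.1‖ * ‖F z.2‖) ^ 3) (μ.prod μ) := by
    have hm : Measurable fun z : Ω × Ω => ‖inner 𝕜 (G z.1) (G z.2)‖ :=
      ((hGm.comp measurable_fst).inner (hGm.comp measurable_snd)).norm
    have h1 : ∀ z : Ω × Ω, ‖inner 𝕜 (G z.1) (G z.2)‖ = ‖inner 𝕜 (F z.1) (F z.2)‖ ^ 4 /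
      (‖F z.1‖ * ‖F z.2‖) ^ 3 := fun z => by
        rw [hinner, RCLike.norm_ofReal, abs_of_nonneg (by positivity)]
    simp_rw [← h1]
    refine integrable_of_measurable_of_bound hm (C := C * C) fun z => ?_
    rw [abs_norm]
    refine (norm_inner_le_norm _ _).trans ?_
    rw [hGn, hGn]
    exact mul_le_mul (hC _) (hC _) (norm_nonneg _) ((norm_nonneg _).trans (hC z.1))
  have key := norm_integral_inner_sq_le (𝕜 := 𝕜) hG Ψ
  simp_rw [hinner, hΨG, integral_ofReal] at key
  rw [integral_prod _ hint]
  rw [integral_const_mul, RCLike.norm_ofReal, RCLike.norm_ofReal, sq_abs] at key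
  rwa [abs_of_nonneg (integral_nonneg fun ω => integral_nonneg fun ω' => by positivity)] at key

/-- The lower bound for fourth moments over an arbitrary field. -/
theorem two_mul_sq_integral_norm_le (hF : Measurable F) (hC : ∀ ω, ‖F ω‖ ≤ C) {n : ℝ} (hn : 0 < n)
    (hcard : Fintype.card ι ≤ n) :
    2 / (n * (n + 1)) * (∫ ω, ‖F ω‖ ∂μ) ^ 2 ≤
      ∫ z, ‖inner 𝕜 (F z.1) (F z.2)‖ ^ 4 / (‖F z.1‖ * ‖F z.2‖) ^ 3 ∂(μ.prod μ) := by
  classical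
  have h := sq_integral_norm_le_of_tensor (μ := μ) hF hC (Ψ := isoTensor 𝕜 ι) (t := 2)
    (fun v => by rw [inner_isoTensor]; push_cast; ring)
  rw [norm_isoTensor_sq] at h
  set J := ∫ z, ‖inner 𝕜 (F z.1) (F z.2)‖ ^ 4 / (‖F z.1‖ * ‖F z.2‖) ^ 3 ∂(μ.prod μ)
  have hJ : 0 ≤ J := integral_nonneg fun z => by positivity
  have h2 : 2 * (Fintype.card ι : ℝ) ^ 2 + 2 * Fintype.card ι ≤ 2 * (n * (n + 1)) := by
    have : (0 : ℝ) ≤ Fintype.card ι := by positivity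
    nlinarith
  have h3 := h.trans (mul_le_mul_of_nonneg_right h2 hJ)
  rw [div_mul_eq_mul_div, div_le_iff₀ (by positivity)]
  nlinarith

/-- The lower bound for fourth moments over the reals. -/
theorem three_mul_sq_integral_norm_le {F : Ω → EuclideanSpace ℝ ι} (hF : Measurable F)
    (hC : ∀ ω, ‖F ω‖ ≤ C) {n : ℝ} (hn : 0 < n) (hcard : Fintype.card ι ≤ n) :
    3 / (n * (n + 2)) * (∫ ω, ‖F ω‖ ∂μ) ^ 2 ≤
      ∫ z, ‖inner ℝ (F z.1) (F z.2)‖ ^ 4 / (‖F z.1‖ * ‖F z.2‖) ^ 3 ∂(μ.prod μ) := by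
  classical
  have h := sq_integral_norm_le_of_tensor (μ := μ) hF hC (Ψ := isoTensorReal ι) (t := 3)
    (fun v => by rw [inner_isoTensorReal]; rfl)
  rw [norm_isoTensorReal_sq] at h
  set J := ∫ z, ‖inner ℝ (F z.1) (F z.2)‖ ^ 4 / (‖F z.1‖ * ‖F z.2‖) ^ 3 ∂(μ.prod μ)
  have hJ : 0 ≤ J := integral_nonneg fun z => by positivity
  have h2 : 3 * (Fintype.card ι : ℝ) ^ 2 + 6 * Fintype.card ι ≤ 3 * (n * (n + 2)) := by
    have : (0 : ℝ) ≤ Fintype.card ι := by positivity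
    nlinarith
  have h3 := h.trans (mul_le_mul_of_nonneg_right h2 hJ)
  rw [div_mul_eq_mul_div, div_le_iff₀ (by positivity)]
  nlinarith

/-- The energy estimate behind the upper bound for projection constants, with the remainder terms
which vanish in the case of equality. -/
theorem integral_norm_inner_add_le (hF : Measurable F) (hC : ∀ ω, ‖F ω‖ ≤ C)
    (hT : ∀ y : EuclideanSpace 𝕜 ι, ∫ ω, ‖inner 𝕜 y (F ω)‖ ^ 2 ∂μ = ‖y‖ ^ 2) {n c κ : ℝ}
    (hc : 0 < c)
    (hκ : κ * (∫ ω, ‖F ω‖ ∂μ) ^ 2 ≤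
      ∫ z, ‖inner 𝕜 (F z.1) (F z.2)‖ ^ 4 / (‖F z.1‖ * ‖F z.2‖) ^ 3 ∂(μ.prod μ)) :
    2 * c * (1 + c) ^ 2 * (∫ ω, ∫ ω', ‖inner 𝕜 (F ω) (F ω')‖ ∂μ ∂μ) +
      (∫ z, ‖F z.1‖ * ‖F z.2‖ *
        (‖inner 𝕜 (F z.1) (F z.2)‖ / (‖F z.1‖ * ‖F z.2‖) - c) ^ 2 *
        (1 - ‖inner 𝕜 (F z.1) (F z.2)‖ / (‖F z.1‖ * ‖F z.2‖)) *
        (‖inner 𝕜 (F z.1) (F z.2)‖ / (‖F z.1‖ * ‖F z.2‖) + 2 * c + 1) ∂(μ.prod μ)) +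
      (c ^ 2 * (2 * c + 1) - κ) * (n - (∫ ω, ‖F ω‖ ∂μ) ^ 2) ≤
    (3 * c ^ 2 + 2 * c + 1) + (c ^ 2 * (2 * c + 1) - κ) * n := by
  have hC0 : ∀ ω : Ω, 0 ≤ C := fun ω => (norm_nonneg _).trans (hC ω)
  set q : Ω × Ω → ℝ := fun z => ‖inner 𝕜 (F z.1) (F z.2)‖ with hq
  set p : Ω × Ω → ℝ := fun z => ‖F z.1‖ * ‖F z.2‖ with hp
  have hqp : ∀ z, q z ≤ p z := fun z => norm_inner_le_norm _ _
  have hq0 : ∀ z, 0 ≤ q z := fun z => norm_nonneg _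
  have hp0 : ∀ z, 0 ≤ p z := fun z => by positivity
  have hpC : ∀ z, p z ≤ C * C := fun z =>
    mul_le_mul (hC _) (hC _) (norm_nonneg _) (hC0 z.1)
  have hFm1 : Measurable fun z : Ω × Ω => F z.1 := hF.comp measurable_fst
  have hFm2 : Measurable fun z : Ω × Ω => F z.2 := hF.comp measurable_snd
  have hqm : Measurable q := (hFm1.inner hFm2).norm
  have hpm : Measurable p := hFm1.norm.mul hFm2.norm
  have hqp0 : ∀ z, p z = 0 → q z = 0 := fun z h => le_antisymm (h ▸ hqp z) (hq0 z)
  have hint : ∀ {f : Ω × Ω → ℝ}, Measurable f → (∀ z, 0 ≤ f z) → (∀ z, f z ≤ p z) →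
      Integrable f (μ.prod μ) := fun {f} hf h0 hle =>
    integrable_of_measurable_of_bound hf (C := C * C) fun z => by
      rw [abs_of_nonneg (h0 z)]; exact (hle z).trans (hpC z)
  have hpi : Integrable p (μ.prod μ) := hint hpm hp0 fun _ => le_rfl
  have hqi : Integrable q (μ.prod μ) := hint hqm hq0 hqp
  have hq2i : Integrable (fun z => q z ^ 2 / p z) (μ.prod μ) := by
    refine hint ((hqm.pow_const 2).div hpm) (fun z => by have := hp0 z; positivity) fun z => ?_
    rcases (hp0 z).eq_or_lt with h | h
    · simp [← h]
    · rw [div_le_iff₀ h]; nlinarith [hqp z, hq0 z]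
  have hq4i : Integrable (fun z => q z ^ 4 / p z ^ 3) (μ.prod μ) := by
    refine hint ((hqm.pow_const 4).div (hpm.pow_const 3))
      (fun z => by have := hp0 z; positivity) fun z => ?_
    rcases (hp0 z).eq_or_lt with h | h
    · simp [← h]
    · rw [div_le_iff₀ (by positivity)]
      calc q z ^ 4 ≤ p z ^ 4 := pow_le_pow_left₀ (hq0 z) (hqp z) 4
        _ = p z * p z ^ 3 := by ring
  -- The quartic identity is integrated with weight p = ‖F‖‖F'‖; its three moments are then treated
  -- separately.
  have hsum : ∫ z, p z * (q z / p z - c) ^ 2 * (1 - q z / p z) * (q z / p z + 2 * c + 1)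
      ∂(μ.prod μ) = c ^ 2 * (2 * c + 1) * ∫ z, p z ∂(μ.prod μ) +
        (3 * c ^ 2 + 2 * c + 1) * (∫ z, q z ^ 2 / p z ∂(μ.prod μ)) -
        (∫ z, q z ^ 4 / p z ^ 3 ∂(μ.prod μ)) - 2 * c * (1 + c) ^ 2 * ∫ z, q z ∂(μ.prod μ) := by
    rw [← integral_const_mul, ← integral_const_mul, ← integral_const_mul, ← integral_add,
      ← integral_sub, ← integral_sub]
    · exact integral_congr_ae (ae_of_all _ fun z => (quartic_remainder (hqp0 z)).symm)
    · exact ((hpi.const_mul _).add (hq2i.const_mul _)).sub hq4i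
    · exact hqi.const_mul _
    · exact (hpi.const_mul _).add (hq2i.const_mul _)
    · exact hq4i
    · exact hpi.const_mul _
    · exact hq2i.const_mul _
  have hpint : ∫ z, p z ∂(μ.prod μ) = (∫ ω, ‖F ω‖ ∂μ) ^ 2 := by
    rw [sq]
    exact integral_prod_mul (L := ℝ) (fun ω => ‖F ω‖) fun ω => ‖F ω‖
  -- the quadratic term, by the arithmetic-geometric mean inequality and tightness
  have hq2 : ∫ z, q z ^ 2 / p z ∂(μ.prod μ) ≤ 1 := by
    have hle : ∀ z : Ω × Ω, q z ^ 2 / ‖F z.1‖ ^ 2 ≤ C ^ 2 := fun z => by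
      refine div_le_of_le_mul₀ (by positivity) (by positivity) ?_
      rw [← mul_pow, mul_comm]
      refine pow_le_pow_left₀ (hq0 z) ((hqp z).trans ?_) 2
      exact mul_le_mul_of_nonneg_left (hC _) (norm_nonneg _)
    have hle' : ∀ z : Ω × Ω, q z ^ 2 / ‖F z.2‖ ^ 2 ≤ C ^ 2 := fun z => by
      refine div_le_of_le_mul₀ (by positivity) (by positivity) ?_
      rw [← mul_pow]
      refine pow_le_pow_left₀ (hq0 z) ((hqp z).trans ?_) 2
      exact mul_le_mul_of_nonneg_right (hC _) (norm_nonneg _)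
    have hi1 : Integrable (fun z : Ω × Ω => q z ^ 2 / ‖F z.1‖ ^ 2) (μ.prod μ) :=
      integrable_of_measurable_of_bound ((hqm.pow_const 2).div (hFm1.norm.pow_const 2))
        fun z => by rw [abs_of_nonneg (by positivity)]; exact hle z
    have hi2 : Integrable (fun z : Ω × Ω => q z ^ 2 / ‖F z.2‖ ^ 2) (μ.prod μ) :=
      integrable_of_measurable_of_bound ((hqm.pow_const 2).div (hFm2.norm.pow_const 2))
        fun z => by rw [abs_of_nonneg (by positivity)]; exact hle' z
    have h1 : ∫ z, q z ^ 2 / ‖F z.1‖ ^ 2 ∂(μ.prod μ) ≤ 1 := by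
      rw [integral_prod _ hi1]
      -- Isotropy at y = F ω evaluates the numerator to ‖F ω‖². The quotient is 1, or 0 where F
      -- vanishes.
      have : ∀ ω, ∫ ω', q (ω, ω') ^ 2 / ‖F ω‖ ^ 2 ∂μ ≤ 1 := fun ω => by
        rw [integral_div]
        simp only [hq]
        rw [hT (F ω)]
        exact div_self_le_one _
      calc _ ≤ ∫ ω, (1 : ℝ) ∂μ := integral_mono hi1.integral_prod_left (integrable_const _) this
        _ = 1 := by simp
    have h2 : ∫ z, q z ^ 2 / ‖F z.2‖ ^ 2 ∂(μ.prod μ) ≤ 1 := by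
      rw [← integral_prod_swap]
      refine le_of_eq_of_le (integral_congr_ae (ae_of_all _ fun z => ?_)) h1
      simp only [hq, Prod.fst_swap, Prod.snd_swap]
      rw [norm_inner_symm]
    have h3 : ∫ z, q z ^ 2 / p z ∂(μ.prod μ) ≤
        ∫ z, (q z ^ 2 / ‖F z.1‖ ^ 2 + q z ^ 2 / ‖F z.2‖ ^ 2) / 2 ∂(μ.prod μ) := by
      refine integral_mono hq2i ((hi1.add hi2).div_const 2) fun z => ?_
      change q z ^ 2 / (‖F z.1‖ * ‖F z.2‖) ≤ (q z ^ 2 / ‖F z.1‖ ^ 2 + q z ^ 2 / ‖F z.2‖ ^ 2) / 2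
      have := two_mul_le_add_sq (q z / ‖F z.1‖) (q z / ‖F z.2‖)
      have e : q z ^ 2 / (‖F z.1‖ * ‖F z.2‖) = q z / ‖F z.1‖ * (q z / ‖F z.2‖) := by
        rw [div_mul_div_comm, sq]
      rw [e, ← div_pow, ← div_pow]
      linarith
    rw [integral_div, integral_add hi1 hi2] at h3
    linarith
  have hb : 0 ≤ 3 * c ^ 2 + 2 * c + 1 := by positivity
  have hqq : ∫ ω, ∫ ω', ‖inner 𝕜 (F ω) (F ω')‖ ∂μ ∂μ = ∫ z, q z ∂(μ.prod μ) :=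
    (integral_prod _ hqi).symm
  rw [hqq]
  change _ + (∫ z, p z * (q z / p z - c) ^ 2 * (1 - q z / p z) * (q z / p z + 2 * c + 1)
      ∂(μ.prod μ)) + _ ≤ _
  rw [hsum, hpint]
  change κ * _ ≤ ∫ z, q z ^ 4 / p z ^ 3 ∂(μ.prod μ) at hκ
  nlinarith [mul_le_mul_of_nonneg_left hq2 hb]

/-- Tightness determines the second moment of the norm. -/
theorem integral_norm_sq_eq_card (hF : Measurable F) (hC : ∀ ω, ‖F ω‖ ≤ C)
    (hT : ∀ y : EuclideanSpace 𝕜 ι, ∫ ω, ‖inner 𝕜 y (F ω)‖ ^ 2 ∂μ = ‖y‖ ^ 2) :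
    ∫ ω, ‖F ω‖ ^ 2 ∂μ = Fintype.card ι := by
  classical
  have h : ∀ i, ∫ ω, ‖F ω i‖ ^ 2 ∂μ = 1 := fun i => by
    have := hT (EuclideanSpace.single i 1)
    simpa [EuclideanSpace.inner_single_left] using this
  simp_rw [EuclideanSpace.norm_sq_eq]
  rw [integral_finsetSum]
  · simp [h]
  · intro i _
    have hm : Measurable fun ω => F ω i := by fun_prop
    refine integrable_of_measurable_of_bound (hm.norm.pow_const 2) (C := C ^ 2) fun ω => ?_
    rw [abs_of_nonneg (by positivity)]
    exact pow_le_pow_left₀ (norm_nonneg _) ((PiLp.norm_apply_le _ i).trans (hC ω)) 2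

/-- The variance of ‖F‖ serves twice: its nonnegativity bounds the squared mean by the dimension,
and its vanishing makes ‖F‖ constant in the case of equality. -/
theorem integral_norm_sub_mean_sq (hF : Measurable F) (hC : ∀ ω, ‖F ω‖ ≤ C)
    (hT : ∀ y : EuclideanSpace 𝕜 ι, ∫ ω, ‖inner 𝕜 y (F ω)‖ ^ 2 ∂μ = ‖y‖ ^ 2) :
    ∫ ω, (‖F ω‖ - ∫ ω, ‖F ω‖ ∂μ) ^ 2 ∂μ = Fintype.card ι - (∫ ω, ‖F ω‖ ∂μ) ^ 2 := by
  set m := ∫ ω, ‖F ω‖ ∂μ with hm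
  have h1 : Integrable (fun ω => ‖F ω‖) μ :=
    integrable_of_measurable_of_bound hF.norm (C := C) fun ω => by simpa using hC ω
  have h2 : Integrable (fun ω => ‖F ω‖ ^ 2) μ :=
    integrable_of_measurable_of_bound (hF.norm.pow_const 2) (C := C ^ 2) fun ω => by
      rw [abs_of_nonneg (by positivity)]
      exact pow_le_pow_left₀ (norm_nonneg _) (hC ω) 2
  have : ∀ ω, (‖F ω‖ - m) ^ 2 = ‖F ω‖ ^ 2 - 2 * m * ‖F ω‖ + m ^ 2 := fun ω => by ring
  simp_rw [this]
  rw [integral_add (f := fun ω => ‖F ω‖ ^ 2 - 2 * m * ‖F ω‖) (g := fun _ => m ^ 2)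
      (h2.sub (h1.const_mul _)) (integrable_const _),
    integral_sub h2 (h1.const_mul _), integral_norm_sq_eq_card hF hC hT, integral_const_mul, ← hm]
  simp
  ring

/-- The energy estimate: the upper bound for projection constants and the case of equality. -/
theorem integral_norm_inner_le (hF : Measurable F) (hC : ∀ ω, ‖F ω‖ ≤ C)
    (hT : ∀ y : EuclideanSpace 𝕜 ι, ∫ ω, ‖inner 𝕜 y (F ω)‖ ^ 2 ∂μ = ‖y‖ ^ 2) {n c κ : ℝ}
    (hc : 0 < c) (hn : Fintype.card ι ≤ n) (hnκ : n * κ = 1 - (n - 1) * c ^ 2)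
    (hκc : κ < c ^ 2 * (2 * c + 1))
    (hκ : κ * (∫ ω, ‖F ω‖ ∂μ) ^ 2 ≤
      ∫ z, ‖inner 𝕜 (F z.1) (F z.2)‖ ^ 4 / (‖F z.1‖ * ‖F z.2‖) ^ 3 ∂(μ.prod μ)) :
    ∫ ω, ∫ ω', ‖inner 𝕜 (F ω) (F ω')‖ ∂μ ∂μ ≤ (1 + n * c) / (1 + c) ∧
    ((1 + n * c) / (1 + c) ≤ ∫ ω, ∫ ω', ‖inner 𝕜 (F ω) (F ω')‖ ∂μ ∂μ →
      Fintype.card ι = n ∧ (∀ᵐ ω ∂μ, ‖F ω‖ ^ 2 = n) ∧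
      ∀ᵐ ω ∂μ, ∀ᵐ ω' ∂μ,
        ‖inner 𝕜 (F ω) (F ω')‖ = c * n ∨ ‖inner 𝕜 (F ω) (F ω')‖ = n) := by
  have hmain := integral_norm_inner_add_le (n := n) hF hC hT hc hκ
  have hvar := integral_norm_sub_mean_sq hF hC hT
  set m := ∫ ω, ‖F ω‖ ∂μ with hm
  set J := ∫ ω, ∫ ω', ‖inner 𝕜 (F ω) (F ω')‖ ∂μ ∂μ with hJ
  have hm0 : 0 ≤ m := integral_nonneg fun ω => norm_nonneg _
  set rem : Ω × Ω → ℝ := fun z => ‖F z.1‖ * ‖F z.2‖ *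
        (‖inner 𝕜 (F z.1) (F z.2)‖ / (‖F z.1‖ * ‖F z.2‖) - c) ^ 2 *
        (1 - ‖inner 𝕜 (F z.1) (F z.2)‖ / (‖F z.1‖ * ‖F z.2‖)) *
        (‖inner 𝕜 (F z.1) (F z.2)‖ / (‖F z.1‖ * ‖F z.2‖) + 2 * c + 1) with hrem
  have hrem0 : ∀ z, 0 ≤ rem z := fun z =>
    quartic_remainder_nonneg hc (norm_nonneg _) (norm_inner_le_norm _ _)
  have hR : 0 ≤ ∫ z, rem z ∂(μ.prod μ) := integral_nonneg hrem0
  have hvar0 : 0 ≤ ∫ ω, (‖F ω‖ - m) ^ 2 ∂μ := integral_nonneg fun ω => sq_nonneg _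
  have hmn : m ^ 2 ≤ n := by linarith
  have hsub : 0 < c ^ 2 * (2 * c + 1) - κ := by linarith
  have hcc : 0 < 2 * c * (1 + c) ^ 2 := by positivity
  -- The relation `hnκ` between κ and c is exactly what makes the bound collapse to (1 + nc)/(1 +
  -- c).
  have hδ : (3 * c ^ 2 + 2 * c + 1) + (c ^ 2 * (2 * c + 1) - κ) * n =
      2 * c * (1 + c) ^ 2 * ((1 + n * c) / (1 + c)) := by
    have : (1 + c) ≠ 0 := by positivity
    field_simp
    linear_combination -hnκ
  rw [hδ] at hmain
  have hmul : 0 ≤ (c ^ 2 * (2 * c + 1) - κ) * (n - m ^ 2) :=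
    mul_nonneg hsub.le (by linarith)
  refine ⟨?_, fun hge => ?_⟩
  · refine le_of_mul_le_mul_left ?_ hcc
    linarith
  have hge' := mul_le_mul_of_nonneg_left hge hcc.le
  -- Equality leaves no room for either nonnegative slack: the quartic remainder, and n − m², whose
  -- coefficient is positive by `hκc`.
  have h1 : ∫ z, rem z ∂(μ.prod μ) = 0 := by linarith
  have h2 : (c ^ 2 * (2 * c + 1) - κ) * (n - m ^ 2) = 0 := by linarith
  have h3 : m ^ 2 = n := by
    rcases mul_eq_zero.mp h2 with h | h
    · exact absurd h hsub.ne'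
    · linarith
  have h4 : (Fintype.card ι : ℝ) = n := by linarith
  have h5 : ∀ᵐ ω ∂μ, ‖F ω‖ = m := by
    have hi : Integrable (fun ω => (‖F ω‖ - m) ^ 2) μ := by
      refine integrable_of_measurable_of_bound ((hF.norm.sub_const m).pow_const 2)
        (C := (C + m) ^ 2) fun ω => ?_
      rw [abs_of_nonneg (sq_nonneg _)]
      refine sq_le_sq' ?_ ?_ <;> linarith [hC ω, norm_nonneg (F ω)]
    have := (integral_eq_zero_iff_of_nonneg (fun ω => sq_nonneg (‖F ω‖ - m)) hi).mp (by linarith)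
    filter_upwards [this] with ω hω
    have : ‖F ω‖ - m = 0 := pow_eq_zero_iff two_ne_zero |>.mp hω
    linarith
  refine ⟨h4, h5.mono fun ω hω => by rw [hω, h3], ?_⟩
  have hremi : Integrable rem (μ.prod μ) := by
    have hFm1 : Measurable fun z : Ω × Ω => F z.1 := hF.comp measurable_fst
    have hFm2 : Measurable fun z : Ω × Ω => F z.2 := hF.comp measurable_snd
    have hqm : Measurable fun z : Ω × Ω => ‖inner 𝕜 (F z.1) (F z.2)‖ := (hFm1.inner hFm2).norm
    have hpm : Measurable fun z : Ω × Ω => ‖F z.1‖ * ‖F z.2‖ := hFm1.norm.mul hFm2.norm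
    have hsm := hqm.div hpm
    refine integrable_of_measurable_of_bound (C := C * C * (1 + c) ^ 2 * 1 * (1 + 2 * c + 1))
      (((hpm.mul ((hsm.sub_const c).pow_const 2)).mul (measurable_const.sub hsm)).mul
        ((hsm.add_const _).add_const _)) fun z => ?_
    rw [abs_of_nonneg (hrem0 z), hrem]
    have hs1 : ‖inner 𝕜 (F z.1) (F z.2)‖ / (‖F z.1‖ * ‖F z.2‖) ≤ 1 :=
      div_le_one_of_le₀ (norm_inner_le_norm _ _) (by positivity)
    have hs0 : 0 ≤ ‖inner 𝕜 (F z.1) (F z.2)‖ / (‖F z.1‖ * ‖F z.2‖) := by positivity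
    have hp : ‖F z.1‖ * ‖F z.2‖ ≤ C * C :=
      mul_le_mul (hC _) (hC _) (norm_nonneg _) ((norm_nonneg _).trans (hC z.1))
    have hC2 : 0 ≤ C * C := le_trans (by positivity) hp
    dsimp only
    generalize ‖inner 𝕜 (F z.1) (F z.2)‖ / (‖F z.1‖ * ‖F z.2‖) = s at *
    have hs2 : (s - c) ^ 2 ≤ (1 + c) ^ 2 := sq_le_sq' (by linarith) (by linarith)
    have hs3 : 0 ≤ 1 - s := by linarith
    gcongr
    linarith
  have h6 : ∀ᵐ z ∂(μ.prod μ), rem z = 0 :=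
    (integral_eq_zero_iff_of_nonneg hrem0 hremi).mp h1
  have h7 := Measure.ae_ae_of_ae_prod h6
  filter_upwards [h5, h7] with ω hω h7ω
  filter_upwards [h5, h7ω] with ω' hω' h
  simp only [hrem, hω, hω', ← sq, h3] at h
  by_cases hn0 : n = 0
  · right
    have hm' : m = 0 := by rw [hn0] at h3; exact pow_eq_zero_iff two_ne_zero |>.mp h3
    have := norm_inner_le_norm (𝕜 := 𝕜) (F ω) (F ω')
    rw [hω, hω', hm', mul_zero] at this
    rw [hn0]
    exact le_antisymm this (norm_nonneg _)
  have hn1 : 0 < n := lt_of_le_of_ne (by rw [← h4]; positivity) (Ne.symm hn0)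
  rcases mul_eq_zero.mp h with h | h
  · rcases mul_eq_zero.mp h with h | h
    · rcases mul_eq_zero.mp h with h | h
      · exact absurd h hn0
      · left
        have := pow_eq_zero_iff two_ne_zero |>.mp h
        rw [sub_eq_zero, div_eq_iff hn0] at this
        exact this
    · right
      rw [sub_eq_zero, eq_comm, div_eq_iff hn0, one_mul] at h
      exact h
  · exfalso
    have : 0 ≤ ‖inner 𝕜 (F ω) (F ω')‖ / n := by positivity
    linarith

end Moments

/-! ### From the certificate to the upper bound -/

section UpperBound

variable {𝕜 : Type*} [RCLike 𝕜] {X : Type u} [NormedAddCommGroup X] [NormedSpace 𝕜 X]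

/-- The coordinates `(g (x i))ᵢ` of a functional `g` in the dual unit ball. -/
noncomputable def dualCoords {k : ℕ} (x : Fin k → X) (g : DualBall 𝕜 X) :
    EuclideanSpace 𝕜 (Fin k) :=
  WithLp.toLp 2 fun i => g.1 (x i)

/-- The vector `∑ᵢ conj (f (x i)) x i` dual to the functional `f`. -/
noncomputable def dualVector {k : ℕ} (x : Fin k → X) (f : DualBall 𝕜 X) : X :=
  ∑ i, (starRingEnd 𝕜) (f.1 (x i)) • x i

theorem inner_dualCoords {k : ℕ} (x : Fin k → X) (y : EuclideanSpace 𝕜 (Fin k))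
    (g : DualBall 𝕜 X) :
    inner 𝕜 y (dualCoords x g) = g.1 (∑ i, (starRingEnd 𝕜) (y i) • x i) := by
  rw [PiLp.inner_apply, map_sum]
  refine Finset.sum_congr rfl fun i _ => ?_
  rw [map_smul, smul_eq_mul, RCLike.inner_apply, mul_comm]
  rfl

theorem apply_dualVector {k : ℕ} (x : Fin k → X) (f g : DualBall 𝕜 X) :
    g.1 (dualVector x f) = inner 𝕜 (dualCoords x f) (dualCoords x g) :=
  (inner_dualCoords x (dualCoords x f) g).symm

theorem continuous_dualCoords {k : ℕ} (x : Fin k → X) :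
    Continuous (dualCoords x : DualBall 𝕜 X → _) := by
  unfold dualCoords
  fun_prop

theorem continuous_dualVector {k : ℕ} (x : Fin k → X) :
    Continuous (dualVector x : DualBall 𝕜 X → X) := by
  exact continuous_finsetSum _ fun i _ =>
    (RCLike.continuous_conj.comp (DualBall.continuous_apply _)).smul continuous_const

theorem exists_norm_dualCoords_le [FiniteDimensional 𝕜 X] {k : ℕ} (x : Fin k → X) :
    ∃ C, ∀ g : DualBall 𝕜 X, ‖dualCoords x g‖ ≤ C := by
  obtain ⟨C, hC⟩ := isCompact_univ.exists_bound_of_continuousOn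
    (continuous_dualCoords (𝕜 := 𝕜) x).continuousOn
  exact ⟨C, fun g => hC g (mem_univ g)⟩

variable [FiniteDimensional 𝕜 X]

/-- A family of vectors which is orthonormal in `L²(μ)` and spans `X` up to `μ`-null vectors. -/
theorem exists_isotropic_family (μ : Measure (DualBall 𝕜 X)) [IsProbabilityMeasure μ] :
    ∃ k ≤ Module.finrank 𝕜 X, ∃ x : Fin k → X,
      (∀ y : EuclideanSpace 𝕜 (Fin k), ∫ g, ‖inner 𝕜 y (dualCoords x g)‖ ^ 2 ∂μ = ‖y‖ ^ 2) ∧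
      ∀ z : X, ∫ g : DualBall 𝕜 X,
        ‖g.1 (z - ∑ i, (∫ g : DualBall 𝕜 X, (starRingEnd 𝕜) (g.1 (x i)) * g.1 z ∂μ) • x i)‖ ∂μ
          = 0 := by
  let ev : X →ₗ[𝕜] C(DualBall 𝕜 X, 𝕜) :=
    { toFun := fun z => ⟨fun g => g.1 z, by fun_prop⟩
      map_add' := fun a b => by ext; simp
      map_smul' := fun a b => by ext; simp }
  let J : X →ₗ[𝕜] Lp 𝕜 2 μ := (ContinuousMap.toLp (E := 𝕜) 2 μ 𝕜).toLinearMap ∘ₗ ev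
  have hJ : ∀ y z, inner 𝕜 (J y) (J z) =
      ∫ g : DualBall 𝕜 X, (starRingEnd 𝕜) (g.1 y) * g.1 z ∂μ := fun y z => by
    change inner 𝕜 (ContinuousMap.toLp (E := 𝕜) 2 μ 𝕜 (ev y)) (ContinuousMap.toLp 2 μ 𝕜 (ev z)) = _
    rw [ContinuousMap.inner_toLp]
    exact integral_congr_ae (ae_of_all _ fun g => mul_comm _ _)
  have hJn : ∀ z, ∫ g : DualBall 𝕜 X, ‖g.1 z‖ ^ 2 ∂μ = ‖J z‖ ^ 2 := fun z => by
    have h := hJ z z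
    rw [inner_self_eq_norm_sq_to_K] at h
    have : ∀ g : DualBall 𝕜 X, (starRingEnd 𝕜) (g.1 z) * g.1 z = ((‖g.1 z‖ ^ 2 : ℝ) : 𝕜) :=
      fun g => by rw [RCLike.conj_mul]; push_cast; rfl
    simp_rw [this, integral_ofReal] at h
    exact_mod_cast h.symm
  -- J has a kernel when μ sits on a proper subspace of the dual. An orthonormal basis is therefore
  -- taken in its range, and k may be smaller than dim X.
  let b := stdOrthonormalBasis 𝕜 (LinearMap.range J)
  choose x hx using fun i => (b i).2
  have hxo : Orthonormal 𝕜 fun i => J (x i) := by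
    simp_rw [hx]
    exact b.orthonormal.comp_linearIsometry (LinearMap.range J).subtypeₗᵢ
  refine ⟨_, LinearMap.finrank_range_le J, x, fun y => ?_, fun z => ?_⟩
  · simp_rw [inner_dualCoords]
    rw [hJn, map_sum]
    simp_rw [map_smul]
    have h := hxo.inner_sum (fun i => (starRingEnd 𝕜) (y i)) (fun i => (starRingEnd 𝕜) (y i))
      Finset.univ
    rw [inner_self_eq_norm_sq_to_K] at h
    rw [EuclideanSpace.norm_sq_eq]
    have h' : ∀ i, (starRingEnd 𝕜) ((starRingEnd 𝕜) (y i)) * (starRingEnd 𝕜) (y i) =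
        ((‖y i‖ ^ 2 : ℝ) : 𝕜) := fun i => by
      rw [RCLike.conj_conj, RCLike.mul_conj]; push_cast; rfl
    simp_rw [h'] at h
    exact_mod_cast h
  · set w := z - ∑ i, (∫ g : DualBall 𝕜 X, (starRingEnd 𝕜) (g.1 (x i)) * g.1 z ∂μ) • x i with hw
    have hw0 : J w = 0 := by
      rw [hw, map_sub, map_sum, sub_eq_zero]
      simp_rw [map_smul, ← hJ, hx]
      have := congrArg Subtype.val (b.sum_repr' ⟨J z, z, rfl⟩)
      rw [Submodule.coe_sum] at this
      exact this.symm
    have h0 := hJn w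
    rw [hw0, norm_zero, zero_pow two_ne_zero] at h0
    have hcont : Continuous fun g : DualBall 𝕜 X => ‖g.1 w‖ := by fun_prop
    have hi : Integrable (fun g : DualBall 𝕜 X => ‖g.1 w‖ ^ 2) μ :=
      integrable_of_measurable_of_bound (hcont.pow 2).measurable (C := ‖w‖ ^ 2) fun g => by
        rw [abs_of_nonneg (by positivity)]
        exact pow_le_pow_left₀ (norm_nonneg _) (g.apply_le w) 2
    have h1 := (integral_eq_zero_iff_of_nonneg (fun g => by positivity) hi).mp h0
    rw [integral_eq_zero_iff_of_nonneg (fun g => norm_nonneg _)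
      (integrable_of_measurable_of_bound hcont.measurable (C := ‖w‖)
        fun g => by rw [abs_norm]; exact g.apply_le w)]
    filter_upwards [h1] with g hg
    exact pow_eq_zero_iff two_ne_zero |>.mp hg

omit [FiniteDimensional 𝕜 X] in
theorem re_apply_smulRight_le {Φ : StrongDual 𝕜 (X →L[𝕜] X)} {μ : Measure (DualBall 𝕜 X)}
    (hΦ : ∀ (f : DualBall 𝕜 X) (x : X), RCLike.re (Φ (f.1.smulRight x)) ≤ ∫ g, ‖g.1 x‖ ∂μ)
    (f : StrongDual 𝕜 X) (x : X) :
    RCLike.re (Φ (f.smulRight x)) ≤ ‖f‖ * ∫ g : DualBall 𝕜 X, ‖g.1 x‖ ∂μ := by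
  rcases eq_or_ne f 0 with rfl | hf
  · have : (0 : StrongDual 𝕜 X).smulRight x = 0 := by ext; simp
    simp [this]
  have hf' : 0 < ‖f‖ := norm_pos_iff.mpr hf
  let f' : DualBall 𝕜 X := ⟨((‖f‖⁻¹ : ℝ) : 𝕜) • f, by
    rw [mem_closedBall_zero_iff, norm_smul, RCLike.norm_ofReal, abs_of_pos (by positivity),
      inv_mul_cancel₀ hf'.ne']⟩
  have h1 : f.smulRight x = ((‖f‖ : ℝ) : 𝕜) • f'.1.smulRight x := by
    ext y
    simp only [ContinuousLinearMap.smulRight_apply, smul_apply, f', smul_eq_mul,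
      smul_smul]
    rw [← mul_assoc, ← RCLike.ofReal_mul, mul_inv_cancel₀ hf'.ne', RCLike.ofReal_one, one_mul]
  rw [h1, map_smul, smul_eq_mul, RCLike.re_ofReal_mul]
  exact mul_le_mul_of_nonneg_left (hΦ f' x) hf'.le

/-- The value of a dual certificate at the identity is controlled by its values at the rank one
operators `f ⊗ dualVector x f`. -/
theorem re_apply_id_le_integral {Φ : StrongDual 𝕜 (X →L[𝕜] X)} {μ : Measure (DualBall 𝕜 X)}
    [IsProbabilityMeasure μ]
    (hΦ : ∀ (f : DualBall 𝕜 X) (x : X), RCLike.re (Φ (f.1.smulRight x)) ≤ ∫ g, ‖g.1 x‖ ∂μ)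
    {k : ℕ} {x : Fin k → X}
    (hx : ∀ z : X, ∫ g : DualBall 𝕜 X,
        ‖g.1 (z - ∑ i, (∫ g : DualBall 𝕜 X, (starRingEnd 𝕜) (g.1 (x i)) * g.1 z ∂μ) • x i)‖ ∂μ
          = 0) :
    RCLike.re (Φ (ContinuousLinearMap.id 𝕜 X)) ≤
      ∫ f : DualBall 𝕜 X, RCLike.re (Φ (f.1.smulRight (dualVector x f))) ∂μ := by
  have : CompleteSpace (StrongDual 𝕜 X) := FiniteDimensional.complete 𝕜 _
  have hci : ∀ i, Integrable (fun g : DualBall 𝕜 X => (starRingEnd 𝕜) (g.1 (x i)) • g.1) μ :=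
    fun i => by
      have hc : Continuous fun g : DualBall 𝕜 X => (starRingEnd 𝕜) (g.1 (x i)) • g.1 :=
        (RCLike.continuous_conj.comp (DualBall.continuous_apply _)).smul continuous_subtype_val
      refine Integrable.of_bound hc.aestronglyMeasurable ‖x i‖ (ae_of_all _ fun g => ?_)
      rw [norm_smul, RCLike.norm_conj]
      exact (mul_le_of_le_one_right (norm_nonneg _) g.norm_le).trans (g.apply_le _)
  let L : Fin k → StrongDual 𝕜 X := fun i =>
    ∫ g : DualBall 𝕜 X, (starRingEnd 𝕜) (g.1 (x i)) • g.1 ∂μ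
  have hL : ∀ i z, L i z = ∫ g : DualBall 𝕜 X, (starRingEnd 𝕜) (g.1 (x i)) * g.1 z ∂μ :=
    fun i z => by
      rw [ContinuousLinearMap.integral_apply (hci i)]
      rfl
  let W : X →L[𝕜] X := ContinuousLinearMap.id 𝕜 X - ∑ i, (L i).smulRight (x i)
  have hWz : ∀ z, ∫ g : DualBall 𝕜 X, ‖g.1 (W z)‖ ∂μ = 0 := fun z => by
    have : W z = z - ∑ i, (∫ g : DualBall 𝕜 X, (starRingEnd 𝕜) (g.1 (x i)) * g.1 z ∂μ) • x i := by
      simp only [W, sub_apply, sum_apply,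
        ContinuousLinearMap.smulRight_apply, hL, ContinuousLinearMap.id_apply]
    rw [this]
    exact hx z
  -- W is the part of the identity that μ does not see. Expanded in a basis it is a sum of rank one
  -- operators c i ⊗ W(b i), each bounded through ∫ |g(W(b i))| dμ = 0.
  have hW : RCLike.re (Φ W) ≤ 0 := by
    let b := Module.finBasis 𝕜 X
    let c : ∀ i, StrongDual 𝕜 X := fun i => (b.coord i).toContinuousLinearMap
    have hWs : W = ∑ i, (c i).smulRight (W (b i)) := by
      ext z
      rw [sum_apply]
      conv_lhs => rw [← b.sum_repr z, map_sum]
      refine Finset.sum_congr rfl fun i _ => ?_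
      rw [map_smul]
      rfl
    rw [hWs, map_sum, map_sum]
    refine Finset.sum_nonpos fun i _ => ?_
    have := re_apply_smulRight_le hΦ (c i) (W (b i))
    rwa [hWz, mul_zero] at this
  have hid : ContinuousLinearMap.id 𝕜 X = (∑ i, (L i).smulRight (x i)) + W := by simp [W]
  have hterm : ∀ i, Φ ((L i).smulRight (x i)) =
      ∫ g : DualBall 𝕜 X, Φ (((starRingEnd 𝕜) (g.1 (x i)) • g.1).smulRight (x i)) ∂μ := fun i => by
    let A : StrongDual 𝕜 X →L[𝕜] 𝕜 := Φ.comp ((ContinuousLinearMap.smulRightL 𝕜 X X).flip (x i))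
    exact (ContinuousLinearMap.integral_comp_comm A (hci i)).symm
  have hcont : ∀ i, Continuous fun g : DualBall 𝕜 X =>
      Φ (((starRingEnd 𝕜) (g.1 (x i)) • g.1).smulRight (x i)) := fun i => by
    let A : StrongDual 𝕜 X →L[𝕜] 𝕜 := Φ.comp ((ContinuousLinearMap.smulRightL 𝕜 X X).flip (x i))
    have hc : Continuous fun g : DualBall 𝕜 X => (starRingEnd 𝕜) (g.1 (x i)) • g.1 :=
        (RCLike.continuous_conj.comp (DualBall.continuous_apply _)).smul continuous_subtype_val
    exact A.continuous.comp hc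
  have hint : ∀ i, Integrable (fun g : DualBall 𝕜 X =>
      Φ (((starRingEnd 𝕜) (g.1 (x i)) • g.1).smulRight (x i))) μ := fun i => by
    obtain ⟨C, hC⟩ := isCompact_univ.exists_bound_of_continuousOn (hcont i).continuousOn
    exact Integrable.of_bound (hcont i).aestronglyMeasurable C
      (ae_of_all _ fun g => hC g (mem_univ g))
  have hsum : ∀ f : DualBall 𝕜 X, Φ (f.1.smulRight (dualVector x f)) =
      ∑ i, Φ (((starRingEnd 𝕜) (f.1 (x i)) • f.1).smulRight (x i)) := fun f => by
    rw [← map_sum]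
    congr 1
    ext z
    simp only [dualVector, ContinuousLinearMap.smulRight_apply, sum_apply, smul_apply,
      Finset.smul_sum, smul_eq_mul, smul_smul, mul_comm]
  rw [hid, map_add, map_add]
  -- Each L i is an integral of functionals, so Φ passes under the integral sign and the sum over i
  -- reassembles f ⊗ `dualVector x f`.
  have hfin : RCLike.re (Φ (∑ i, (L i).smulRight (x i))) =
      ∫ f : DualBall 𝕜 X, RCLike.re (Φ (f.1.smulRight (dualVector x f))) ∂μ := by
    simp_rw [hsum]
    rw [integral_re (integrable_finsetSum _ fun i _ => hint i), integral_finsetSum _ fun i _ => hint i,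
      map_sum]
    simp_rw [hterm]
  linarith

theorem integrable_norm_inner_dualCoords (μ : Measure (DualBall 𝕜 X)) [IsProbabilityMeasure μ]
    {k : ℕ} (x : Fin k → X) :
    Integrable (fun f => ∫ g, ‖inner 𝕜 (dualCoords x f) (dualCoords x g)‖ ∂μ) μ := by
  obtain ⟨C, hC⟩ := exists_norm_dualCoords_le (𝕜 := 𝕜) x
  have hm := (continuous_dualCoords (𝕜 := 𝕜) x).measurable
  have hi : Integrable (fun z : DualBall 𝕜 X × DualBall 𝕜 X =>
      ‖inner 𝕜 (dualCoords x z.1) (dualCoords x z.2)‖) (μ.prod μ) := by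
    refine integrable_of_measurable_of_bound (C := C * C)
      ((hm.comp measurable_fst).inner (hm.comp measurable_snd)).norm fun z => ?_
    rw [abs_norm]
    exact (norm_inner_le_norm _ _).trans
      (mul_le_mul (hC _) (hC _) (norm_nonneg _) ((norm_nonneg _).trans (hC z.1)))
  exact hi.integral_prod_left

theorem integrable_re_apply_dualVector (Φ : StrongDual 𝕜 (X →L[𝕜] X)) (μ : Measure (DualBall 𝕜 X))
    [IsProbabilityMeasure μ] {k : ℕ} (x : Fin k → X) :
    Integrable (fun f : DualBall 𝕜 X => RCLike.re (Φ (f.1.smulRight (dualVector x f)))) μ := by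
  have hc : Continuous fun f : DualBall 𝕜 X => RCLike.re (Φ (f.1.smulRight (dualVector x f))) := by
    have h1 : Continuous fun f : DualBall 𝕜 X =>
        ContinuousLinearMap.smulRightL 𝕜 X X f.1 (dualVector x f) :=
      (ContinuousLinearMap.smulRightL 𝕜 X X).continuous₂.comp
        (continuous_subtype_val.prodMk (continuous_dualVector x))
    exact RCLike.continuous_re.comp (Φ.continuous.comp h1)
  obtain ⟨C, hC⟩ := isCompact_univ.exists_bound_of_continuousOn hc.continuousOn
  exact Integrable.of_bound hc.aestronglyMeasurable C (ae_of_all _ fun g => hC g (mem_univ g))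

omit [FiniteDimensional 𝕜 X] in
theorem re_apply_dualVector_le {Φ : StrongDual 𝕜 (X →L[𝕜] X)} {μ : Measure (DualBall 𝕜 X)}
    (hΦ : ∀ (f : DualBall 𝕜 X) (x : X), RCLike.re (Φ (f.1.smulRight x)) ≤ ∫ g, ‖g.1 x‖ ∂μ)
    {k : ℕ} (x : Fin k → X) (f : DualBall 𝕜 X) :
    RCLike.re (Φ (f.1.smulRight (dualVector x f))) ≤
      ∫ g, ‖inner 𝕜 (dualCoords x f) (dualCoords x g)‖ ∂μ := by
  refine (hΦ f (dualVector x f)).trans_eq ?_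
  simp_rw [apply_dualVector]

/-- The dual certificate in isotropic position. -/
theorem exists_isotropic_certificate {δ : ℝ} (hδ : 0 < δ)
    (hX : ENNReal.ofReal δ ≤ absProjConst 𝕜 X) :
    ∃ (Φ : StrongDual 𝕜 (X →L[𝕜] X)) (μ : Measure (DualBall 𝕜 X)) (k : ℕ) (x : Fin k → X),
      IsProbabilityMeasure μ ∧ k ≤ Module.finrank 𝕜 X ∧
      (∀ (f : DualBall 𝕜 X) (x : X), RCLike.re (Φ (f.1.smulRight x)) ≤ ∫ g, ‖g.1 x‖ ∂μ) ∧
      (∀ y : EuclideanSpace 𝕜 (Fin k), ∫ g, ‖inner 𝕜 y (dualCoords x g)‖ ^ 2 ∂μ = ‖y‖ ^ 2) ∧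
      δ ≤ ∫ f : DualBall 𝕜 X, RCLike.re (Φ (f.1.smulRight (dualVector x f))) ∂μ := by
  obtain ⟨Φ, μ, hμ, hid, hΦ⟩ := exists_dual_certificate hδ hX
  obtain ⟨k, hk, x, hT, hx⟩ := exists_isotropic_family μ
  exact ⟨Φ, μ, k, x, hμ, hk, hΦ, hT, hid.trans (re_apply_id_le_integral hΦ hx)⟩

/-- The upper bound for absolute projection constants, given a fourth moment inequality. -/
theorem absProjConst_le_of_fourth_moment {n : ℕ} (hn : Module.finrank 𝕜 X = n) {c κ : ℝ}
    (hc : 0 < c) (hnκ : n * κ = 1 - (n - 1) * c ^ 2) (hκc : κ < c ^ 2 * (2 * c + 1))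
    (hκ : ∀ (μ : Measure (DualBall 𝕜 X)) [IsProbabilityMeasure μ] (k : ℕ) (x : Fin k → X),
      k ≤ n → κ * (∫ f, ‖dualCoords x f‖ ∂μ) ^ 2 ≤
        ∫ z, ‖inner 𝕜 (dualCoords x z.1) (dualCoords x z.2)‖ ^ 4 /
          (‖dualCoords x z.1‖ * ‖dualCoords x z.2‖) ^ 3 ∂(μ.prod μ)) :
    absProjConst 𝕜 X ≤ ENNReal.ofReal ((1 + n * c) / (1 + c)) := by
  by_contra hlt
  push Not at hlt
  -- The certificate needs a finite level, while the projection constant is not yet known to be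
  -- finite.
  obtain ⟨δ, hδ1, hδ2⟩ := ENNReal.lt_iff_exists_nnreal_btwn.mp hlt
  have hδ0 : 0 ≤ (1 + n * c) / (1 + c) := by positivity
  have hδ : (1 + n * c) / (1 + c) < δ := by
    rw [← ENNReal.ofReal_coe_nnreal, ENNReal.ofReal_lt_ofReal_iff_of_nonneg hδ0] at hδ1
    exact hδ1
  obtain ⟨Φ, μ, k, x, hμ, hk, hΦ, hT, hle⟩ := exists_isotropic_certificate (X := X)
    (hδ0.trans_lt hδ) (by rw [ENNReal.ofReal_coe_nnreal]; exact hδ2.le)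
  obtain ⟨C, hC⟩ := exists_norm_dualCoords_le (𝕜 := 𝕜) x
  have h1 := (integral_norm_inner_le (continuous_dualCoords x).measurable hC hT hc
    (n := n) (by rw [Fintype.card_fin]; exact_mod_cast hn ▸ hk) hnκ hκc (hκ μ k x (hn ▸ hk))).1
  have h2 := integral_mono (integrable_re_apply_dualVector Φ μ x)
    (integrable_norm_inner_dualCoords μ x) (re_apply_dualVector_le hΦ x)
  linarith

end UpperBound

/-- `δ_ℝ(n)` is an upper bound for absolute projection constants. -/
theorem absProjConst_real_le {X : Type u} [NormedAddCommGroup X] [NormedSpace ℝ X]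
    [FiniteDimensional ℝ X] {n : ℕ} (hn2 : 2 ≤ n) (hn : Module.finrank ℝ X = n) {c : ℝ}
    (hc : 0 < c) (hcn : (n + 2) * c ^ 2 = 1) :
    absProjConst ℝ X ≤ ENNReal.ofReal ((1 + n * c) / (1 + c)) := by
  have hn' : (2 : ℝ) ≤ n := by exact_mod_cast hn2
  have hc2 : c ^ 2 = 1 / (n + 2) := by field_simp; linarith
  refine absProjConst_le_of_fourth_moment hn hc (κ := 3 / (n * (n + 2))) ?_ ?_
    fun μ _ k x hk => ?_
  · rw [hc2]; field_simp; ring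
  · rw [hc2, div_lt_iff₀ (by positivity)]
    have : 1 / ((n : ℝ) + 2) * (2 * c + 1) * (n * (n + 2)) = n * (2 * c + 1) := by field_simp
    rw [this]
    -- The claim is 3 < n(2c + 1). For n ≥ 3 it suffices that c > 0; for n = 2 one needs c > 1/4,
    -- which follows from 4c² = 1.
    rcases hn2.eq_or_lt with h | h
    · subst h
      push_cast at *
      nlinarith
    · have : (3 : ℝ) ≤ n := by exact_mod_cast h
      nlinarith
  · obtain ⟨C, hC⟩ := exists_norm_dualCoords_le (𝕜 := ℝ) x
    exact three_mul_sq_integral_norm_le (continuous_dualCoords x).measurable hC (by positivity)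
      (by rw [Fintype.card_fin]; exact_mod_cast hk)

/-- `δ_ℂ(n)` is an upper bound for absolute projection constants. -/
theorem absProjConst_complex_le {X : Type u} [NormedAddCommGroup X] [NormedSpace ℂ X]
    [FiniteDimensional ℂ X] {n : ℕ} (hn2 : 2 ≤ n) (hn : Module.finrank ℂ X = n) {c : ℝ}
    (hc : 0 < c) (hcn : (n + 1) * c ^ 2 = 1) :
    absProjConst ℂ X ≤ ENNReal.ofReal ((1 + n * c) / (1 + c)) := by
  have hn' : (2 : ℝ) ≤ n := by exact_mod_cast hn2
  have hc2 : c ^ 2 = 1 / (n + 1) := by field_simp; linarith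
  refine absProjConst_le_of_fourth_moment hn hc (κ := 2 / (n * (n + 1))) ?_ ?_
    fun μ _ k x hk => ?_
  · rw [hc2]; field_simp; ring
  · rw [hc2, div_lt_iff₀ (by positivity)]
    have : 1 / ((n : ℝ) + 1) * (2 * c + 1) * (n * (n + 1)) = n * (2 * c + 1) := by field_simp
    rw [this]
    nlinarith
  · obtain ⟨C, hC⟩ := exists_norm_dualCoords_le (𝕜 := ℂ) x
    exact two_mul_sq_integral_norm_le (continuous_dualCoords x).measurable hC (by positivity)
      (by rw [Fintype.card_fin]; exact_mod_cast hk)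

/-! ### Equality in the real plane -/

section Hexagon

variable {X : Type u} [NormedAddCommGroup X] [NormedSpace ℝ X]

/-- Testing Φ on fᵢ ⊗ (zᵢ − zⱼ) gives Φ(fᵢ ⊗ zⱼ) ≥ −2/3. Since the zⱼ sum to 0 and the diagonal
values are 4/3, equality holds, so Φ(g ⊗ x) = (2/3) g(x) in general. For g norming x this yields
2‖x‖ ≤ ∑ |fᵢ x|. As f₀ + f₁ + f₂ = 0, that sum is twice the largest |fᵢ x|, which in turn is at most
‖x‖. -/
theorem norm_eq_max_of_certificate {Φ : StrongDual ℝ (X →L[ℝ] X)} {f : Fin 3 → StrongDual ℝ X}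
    {z : Fin 3 → X} (hfz : ∀ i j, f i (z j) = if i = j then 2 else -1)
    (hx : ∀ x : X, x = (1 / 3 : ℝ) • ∑ i, f i x • z i) (hf0 : ∑ i, f i = 0) (hz0 : ∑ i, z i = 0)
    (hf1 : ∀ i, ‖f i‖ ≤ 1) (hdiag : ∀ i, Φ ((f i).smulRight (z i)) = 4 / 3)
    (hΦ : ∀ g : StrongDual ℝ X, ‖g‖ ≤ 1 → ∀ x, Φ (g.smulRight x) ≤ 1 / 3 * ∑ i, |f i x|) (x : X) :
    ‖x‖ = max (max |f 0 x| |f 1 x|) |f 0 x + f 1 x| := by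
  have hadd : ∀ (g : StrongDual ℝ X) (y y' : X),
      g.smulRight (y + y') = g.smulRight y + g.smulRight y' := fun g y y' => by ext; simp
  have hsub : ∀ (g : StrongDual ℝ X) (y y' : X),
      g.smulRight (y - y') = g.smulRight y - g.smulRight y' := fun g y y' => by
        ext; simp [smul_sub]
  have hsumz : ∀ i, Φ ((f i).smulRight (z 0)) + Φ ((f i).smulRight (z 1)) +
      Φ ((f i).smulRight (z 2)) = 0 := fun i => by
    rw [← map_add, ← map_add, ← hadd, ← hadd, ← Fin.sum_univ_three, hz0]
    have : (f i).smulRight (0 : X) = 0 := by ext; simp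
    rw [this, map_zero]
  have hoff : ∀ i j, i ≠ j → -(2 / 3) ≤ Φ ((f i).smulRight (z j)) := fun i j hij => by
    have h := hΦ (f i) (hf1 i) (z i - z j)
    rw [hsub, map_sub, hdiag, Fin.sum_univ_three] at h
    simp only [map_sub, hfz] at h
    have : |(if (0 : Fin 3) = i then (2 : ℝ) else -1) - if (0 : Fin 3) = j then 2 else -1| +
        |(if (1 : Fin 3) = i then (2 : ℝ) else -1) - if (1 : Fin 3) = j then 2 else -1| +
        |(if (2 : Fin 3) = i then (2 : ℝ) else -1) - if (2 : Fin 3) = j then 2 else -1| = 6 := by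
      fin_cases i <;> fin_cases j <;> first | exact absurd rfl hij | norm_num [Fin.ext_iff]
    rw [this] at h
    linarith
  have hA : ∀ i j, Φ ((f i).smulRight (z j)) = 2 / 3 * f i (z j) := fun i j => by
    have h0 := hsumz i
    have hd := hdiag i
    rw [hfz]
    fin_cases i <;> fin_cases j <;> simp <;> simp at h0 hd <;>
      linarith [hoff 0 1 (by decide), hoff 0 2 (by decide), hoff 1 0 (by decide),
        hoff 1 2 (by decide), hoff 2 0 (by decide), hoff 2 1 (by decide)]
  have hf : ∀ g : StrongDual ℝ X, g = (1 / 3 : ℝ) • ∑ i, g (z i) • f i := fun g => by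
    ext y
    conv_lhs => rw [hx y]
    simp [Fin.sum_univ_three]
    ring
  have hscal : ∀ (g : StrongDual ℝ X) (y : X), Φ (g.smulRight y) = 2 / 3 * g y := fun g y => by
    let β : StrongDual ℝ X →L[ℝ] X →L[ℝ] ℝ :=
      ((ContinuousLinearMap.compL ℝ X (X →L[ℝ] X) ℝ) Φ).comp (ContinuousLinearMap.smulRightL ℝ X X)
    have hβ : ∀ g y, Φ (g.smulRight y) = β g y := fun g y => rfl
    have hA' : ∀ i j, β (f i) (z j) = 2 / 3 * f i (z j) := hA
    have h1 : ∀ i, β (f i) y = 2 / 3 * f i y := fun i => by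
      conv_lhs => rw [hx y]
      conv_rhs => rw [hx y]
      simp only [map_smul, map_sum, hA', smul_eq_mul, Finset.mul_sum]
      refine Finset.sum_congr rfl fun j _ => by ring
    rw [hβ]
    conv_lhs => rw [hf g]
    conv_rhs => rw [hf g]
    simp only [map_smul, map_sum, smul_apply, sum_apply, h1, smul_eq_mul, Finset.mul_sum]
    refine Finset.sum_congr rfl fun j _ => by ring
  have h2 : f 2 x = -(f 0 x + f 1 x) := by
    have := congrArg (fun g : StrongDual ℝ X => g x) hf0
    simp only [Fin.sum_univ_three, add_apply, zero_apply] at this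
    linarith
  apply le_antisymm
  · obtain ⟨g, hg, hgx⟩ := exists_dual_vector'' ℝ x
    have h := hΦ g hg x
    rw [hscal, hgx, Fin.sum_univ_three, h2, abs_neg] at h
    simp only [RCLike.ofReal_real_eq_id, id] at h
    have key : |f 0 x| + |f 1 x| + |f 0 x + f 1 x| ≤
        2 * max (max |f 0 x| |f 1 x|) |f 0 x + f 1 x| := by
      generalize f 0 x = a
      generalize f 1 x = b
      have i1 : |a| ≤ max (max |a| |b|) |a + b| := le_max_of_le_left (le_max_left _ _)
      have i2 : |b| ≤ max (max |a| |b|) |a + b| := le_max_of_le_left (le_max_right _ _)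
      have i3 : |a + b| ≤ max (max |a| |b|) |a + b| := le_max_right _ _
      generalize max (max |a| |b|) |a + b| = M at *
      rw [abs_le] at i1 i2 i3
      rcases abs_cases a with h1 | h1 <;> rcases abs_cases b with h2 | h2 <;>
        rcases abs_cases (a + b) with h3 | h3 <;> linarith
    linarith
  · have hb : ∀ i, |f i x| ≤ ‖x‖ := fun i =>
      ((f i).le_opNorm x).trans (mul_le_of_le_one_left (norm_nonneg _) (hf1 i))
    refine max_le (max_le (hb 0) (hb 1)) ?_
    have := hb 2
    rwa [h2, abs_neg] at this

/-- The position of a vector which makes an angle of `0`, `60`, `120` or `180` degrees with `(p, q)`. -/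
theorem eq_or_eq_neg_of_abs_inner {p q a b s : ℝ} (hs : s ^ 2 = 3) (hpq : p ^ 2 + q ^ 2 = 2)
    (hab : a ^ 2 + b ^ 2 = 2) (h : |p * a + q * b| = 1 ∨ |p * a + q * b| = 2) :
    ((a = p ∧ b = q) ∨ (a = -p ∧ b = -q)) ∨
    ((a = (-p - s * q) / 2 ∧ b = (-q + s * p) / 2) ∨
      (a = -((-p - s * q) / 2) ∧ b = -((-q + s * p) / 2))) ∨
    ((a = (-p + s * q) / 2 ∧ b = (-q - s * p) / 2) ∨
      (a = -((-p + s * q) / 2) ∧ b = -((-q - s * p) / 2))) := by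
  -- u and v are, up to scaling, the components of (a, b) along (p, q) and along its quarter turn.
  -- Here |u| is 1 or 2 and u² + v² = 4.
  obtain ⟨u, hu⟩ : ∃ u, u = p * a + q * b := ⟨_, rfl⟩
  obtain ⟨v, hv⟩ : ∃ v, v = p * b - q * a := ⟨_, rfl⟩
  have ha : a = (p * u - q * v) / 2 := by rw [hu, hv]; linear_combination (-a / 2) * hpq
  have hb : b = (q * u + p * v) / 2 := by rw [hu, hv]; linear_combination (-b / 2) * hpq
  have huv : u ^ 2 + v ^ 2 = 4 := by
    rw [hu, hv]; linear_combination (a ^ 2 + b ^ 2) * hpq + 2 * hab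
  rw [← hu] at h
  rcases h with h | h
  · have hu2 : u ^ 2 = 1 := by rw [← sq_abs, h]; norm_num
    have hv2 : (v - s) * (v + s) = 0 := by linear_combination huv - hu2 - hs
    rcases abs_eq (by norm_num : (0 : ℝ) ≤ 1) |>.mp h with h | h <;>
      rcases mul_eq_zero.mp hv2 with h' | h'
    · have : v = s := by linarith
      right; right; right; constructor <;> [rw [ha]; rw [hb]] <;> rw [h, this] <;> ring
    · have : v = -s := by linarith
      right; left; right; constructor <;> [rw [ha]; rw [hb]] <;> rw [h, this] <;> ring
    · have : v = s := by linarith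
      right; left; left; constructor <;> [rw [ha]; rw [hb]] <;> rw [h, this] <;> ring
    · have : v = -s := by linarith
      right; right; left; constructor <;> [rw [ha]; rw [hb]] <;> rw [h, this] <;> ring
  · have hu2 : u ^ 2 = 4 := by rw [← sq_abs, h]; norm_num
    have hv0 : v = 0 := by
      have : v ^ 2 = 0 := by linarith
      exact pow_eq_zero_iff two_ne_zero |>.mp this
    rcases abs_eq (by norm_num : (0 : ℝ) ≤ 2) |>.mp h with h | h
    · left; left; constructor <;> [rw [ha]; rw [hb]] <;> rw [h, hv0] <;> ring
    · left; right; constructor <;> [rw [ha]; rw [hb]] <;> rw [h, hv0] <;> ring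

/-- A two-dimensional real space with projection constant at least `4 / 3` has a hexagonal norm. -/
theorem exists_norm_eq_max_of_le_absProjConst [FiniteDimensional ℝ X]
    (h2 : Module.finrank ℝ X = 2) (hX : ENNReal.ofReal (4 / 3) ≤ absProjConst ℝ X) :
    ∃ f₀ f₁ : StrongDual ℝ X, ∀ x, ‖x‖ = max (max |f₀ x| |f₁ x|) |f₀ x + f₁ x| := by
  obtain ⟨Φ, μ, k, x, hμ, hk, hΦ, hT, hle⟩ := exists_isotropic_certificate (by norm_num) hX
  obtain ⟨C, hC⟩ := exists_norm_dualCoords_le (𝕜 := ℝ) x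
  have hmeas := (continuous_dualCoords (𝕜 := ℝ) x).measurable
  have hk2 : (k : ℝ) ≤ 2 := by exact_mod_cast h2 ▸ hk
  have hI1 := integrable_re_apply_dualVector Φ μ x
  have hI2 := integrable_norm_inner_dualCoords μ x
  have hpt := re_apply_dualVector_le hΦ x
  have h4 := three_mul_sq_integral_norm_le (μ := μ) hmeas hC (n := 2) (by norm_num)
    (by rwa [Fintype.card_fin])
  rw [show (3 : ℝ) / (2 * (2 + 2)) = 3 / 8 by norm_num] at h4
  obtain ⟨hJle, hJeq⟩ := integral_norm_inner_le hmeas hC hT (n := 2) (c := 1 / 2) (κ := 3 / 8)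
    (by norm_num) (by rwa [Fintype.card_fin]) (by norm_num) (by norm_num)
    h4
  have h43 : (1 + 2 * (1 / 2)) / (1 + 1 / 2) = (4 / 3 : ℝ) := by norm_num
  rw [h43] at hJle hJeq
  -- The chain 4/3 ≤ ∫ Re Φ ≤ energy ≤ 4/3 is an equality throughout: this fixes norms and angles
  -- almost everywhere and makes the domination by Φ sharp almost everywhere.
  have hmono := integral_mono hI1 hI2 hpt
  obtain ⟨hcard, hnorm, hangle⟩ := hJeq (by linarith)
  have heq : ∀ᵐ f ∂μ, RCLike.re (Φ (f.1.smulRight (dualVector x f))) =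
      ∫ g, ‖inner ℝ (dualCoords x f) (dualCoords x g)‖ ∂μ := by
    have h0 : ∫ f, ((∫ g, ‖inner ℝ (dualCoords x f) (dualCoords x g)‖ ∂μ) -
        RCLike.re (Φ (f.1.smulRight (dualVector x f)))) ∂μ = 0 := by
      rw [integral_sub hI2 hI1]; linarith
    rw [integral_eq_zero_iff_of_nonneg (fun f => sub_nonneg.mpr (hpt f)) (hI2.sub hI1)] at h0
    filter_upwards [h0] with f hf
    exact (sub_eq_zero.mp hf).symm
  rw [Fintype.card_fin] at hcard
  obtain rfl : k = 2 := by exact_mod_cast hcard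
  have hin : ∀ (y : EuclideanSpace ℝ (Fin 2)) (g : DualBall ℝ X),
      inner ℝ y (dualCoords x g) = y 0 * g.1 (x 0) + y 1 * g.1 (x 1) := fun y g => by
    rw [inner_dualCoords]; simp [Fin.sum_univ_two]
  have hns : ∀ g : DualBall ℝ X, ‖dualCoords x g‖ ^ 2 = g.1 (x 0) ^ 2 + g.1 (x 1) ^ 2 := fun g => by
    rw [EuclideanSpace.norm_sq_eq, Fin.sum_univ_two]; simp [dualCoords]
  have hli : LinearIndependent ℝ x := by
    rw [Fintype.linearIndependent_iff]
    intro c hc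
    have h := hT (WithLp.toLp 2 c)
    simp_rw [inner_dualCoords] at h
    simp only [conj_trivial, hc, map_zero, norm_zero] at h
    have h' : (WithLp.toLp 2 c : EuclideanSpace ℝ (Fin 2)) = 0 := by
      rw [← norm_eq_zero]
      refine pow_eq_zero_iff two_ne_zero |>.mp ?_
      rw [← h]; simp
    intro i
    exact congrArg (fun v : EuclideanSpace ℝ (Fin 2) => v i) h'
  let b := basisOfLinearIndependentOfCardEqFinrank hli (by simp [h2])
  have hb : ∀ i, b i = x i := fun i => by simp [b]
  have hext : ∀ g g' : StrongDual ℝ X, g (x 0) = g' (x 0) → g (x 1) = g' (x 1) → g = g' :=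
    fun g g' h0 h1 => by
      refine ContinuousLinearMap.coe_injective (b.ext fun i => ?_)
      rw [hb]
      fin_cases i
      · exact h0
      · exact h1
  -- One typical functional fixes the hexagon. The pairs (α i, β i) below are its coordinates (p, q)
  -- turned by 0, 120 and 240 degrees.
  obtain ⟨g₀, hg₀, hang₀⟩ := (hnorm.and hangle).exists
  rw [hns] at hg₀
  set p := g₀.1 (x 0) with hp
  set q := g₀.1 (x 1) with hq
  obtain ⟨s, hs⟩ : ∃ s : ℝ, s ^ 2 = 3 := ⟨√3, Real.sq_sqrt (by norm_num)⟩
  let α : Fin 3 → ℝ := ![p, (-p - s * q) / 2, (-p + s * q) / 2]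
  let β : Fin 3 → ℝ := ![q, (-q + s * p) / 2, (-q - s * p) / 2]
  let f : Fin 3 → StrongDual ℝ X := fun i => (b.constr ℝ ![α i, β i]).toContinuousLinearMap
  have hfx0 : ∀ i, f i (x 0) = α i := fun i => by
    rw [← hb]; exact b.constr_basis ℝ _ 0
  have hfx1 : ∀ i, f i (x 1) = β i := fun i => by
    rw [← hb]; exact b.constr_basis ℝ _ 1
  have hαβ : ∀ i j, α i * α j + β i * β j = if i = j then 2 else -1 := by
    have e00 : p * p + q * q = 2 := by linarith
    have e01 : p * ((-p - s * q) / 2) + q * ((-q + s * p) / 2) = -1 := by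
      linear_combination (-1 / 2) * hg₀
    have e02 : p * ((-p + s * q) / 2) + q * ((-q - s * p) / 2) = -1 := by
      linear_combination (-1 / 2) * hg₀
    have e11 : (-p - s * q) / 2 * ((-p - s * q) / 2) + (-q + s * p) / 2 * ((-q + s * p) / 2) = 2 := by
      linear_combination ((p ^ 2 + q ^ 2) / 4) * hs + hg₀
    have e22 : (-p + s * q) / 2 * ((-p + s * q) / 2) + (-q - s * p) / 2 * ((-q - s * p) / 2) = 2 := by
      linear_combination ((p ^ 2 + q ^ 2) / 4) * hs + hg₀
    have e12 : (-p - s * q) / 2 * ((-p + s * q) / 2) + (-q + s * p) / 2 * ((-q - s * p) / 2) = -1 := by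
      linear_combination (-(p ^ 2 + q ^ 2) / 4) * hs - (1 / 2) * hg₀
    intro i j
    fin_cases i <;> fin_cases j <;> simp [α, β] <;> linarith
  have hα2 : α 0 ^ 2 + α 1 ^ 2 + α 2 ^ 2 = 3 := by
    change p ^ 2 + ((-p - s * q) / 2) ^ 2 + ((-p + s * q) / 2) ^ 2 = 3
    linear_combination (q ^ 2 / 2) * hs + (3 / 2) * hg₀
  have hβ2 : β 0 ^ 2 + β 1 ^ 2 + β 2 ^ 2 = 3 := by
    change q ^ 2 + ((-q + s * p) / 2) ^ 2 + ((-q - s * p) / 2) ^ 2 = 3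
    linear_combination (p ^ 2 / 2) * hs + (3 / 2) * hg₀
  have hαβ0 : α 0 * β 0 + α 1 * β 1 + α 2 * β 2 = 0 := by
    change p * q + (-p - s * q) / 2 * ((-q + s * p) / 2) + (-p + s * q) / 2 * ((-q - s * p) / 2) = 0
    linear_combination (-p * q / 2) * hs
  have hα0 : α 0 + α 1 + α 2 = 0 := by
    change p + (-p - s * q) / 2 + (-p + s * q) / 2 = 0
    ring
  have hβ0 : β 0 + β 1 + β 2 = 0 := by
    change q + (-q + s * p) / 2 + (-q - s * p) / 2 = 0
    ring
  let z : Fin 3 → X := fun i => α i • x 0 + β i • x 1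
  have hfz : ∀ i j, f i (z j) = if i = j then 2 else -1 := fun i j => by
    rw [← hαβ i j]
    simp only [z, map_add, map_smul, hfx0, hfx1, smul_eq_mul]
    ring
  -- almost every functional is one of the six vertices
  have hsix : ∀ᵐ g : DualBall ℝ X ∂μ, ∃ j, g.1 = f j ∨ g.1 = -f j := by
    filter_upwards [hnorm, hang₀] with g hg1 hg2
    rw [hns] at hg1
    have hinner : inner ℝ (dualCoords x g₀) (dualCoords x g) = p * g.1 (x 0) + q * g.1 (x 1) :=
      hin _ _
    rw [hinner, Real.norm_eq_abs, show (1 / 2 * 2 : ℝ) = 1 by norm_num] at hg2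
    rcases eq_or_eq_neg_of_abs_inner hs hg₀ hg1 hg2 with h | h | h
    · refine ⟨0, h.imp (fun h => hext _ _ ?_ ?_) fun h => hext _ _ ?_ ?_⟩
      · rw [hfx0]; exact h.1
      · rw [hfx1]; exact h.2
      · rw [neg_apply, hfx0]; exact h.1
      · rw [neg_apply, hfx1]; exact h.2
    · refine ⟨1, h.imp (fun h => hext _ _ ?_ ?_) fun h => hext _ _ ?_ ?_⟩
      · rw [hfx0]; exact h.1
      · rw [hfx1]; exact h.2
      · rw [neg_apply, hfx0]; exact h.1
      · rw [neg_apply, hfx1]; exact h.2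
    · refine ⟨2, h.imp (fun h => hext _ _ ?_ ?_) fun h => hext _ _ ?_ ?_⟩
      · rw [hfx0]; exact h.1
      · rw [hfx1]; exact h.2
      · rw [neg_apply, hfx0]; exact h.1
      · rw [neg_apply, hfx1]; exact h.2
  -- the indicator functions of the three antipodal pairs
  let χ : Fin 3 → DualBall ℝ X → ℝ := fun i g => (g.1 (z i) ^ 2 - 1) / 3
  have hχi : ∀ i, Integrable (χ i) μ := fun i => by
    have hc : Continuous (χ i) := by
      have := DualBall.continuous_apply (𝕜 := ℝ) (z i)
      fun_prop
    obtain ⟨D, hD⟩ := isCompact_univ.exists_bound_of_continuousOn hc.continuousOn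
    exact Integrable.of_bound hc.aestronglyMeasurable D (ae_of_all _ fun g => hD g (mem_univ g))
  -- Isotropy gives ∫ g(z i)² dμ = α i² + β i² = 2, so each antipodal pair carries mass (2 − 1)/3.
  have hχint : ∀ i, ∫ g, χ i g ∂μ = 1 / 3 := fun i => by
    have h : ∫ g, (3 * χ i g + 1) ∂μ = ‖!₂[α i, β i]‖ ^ 2 := by
      rw [← hT]
      refine integral_congr_ae (ae_of_all _ fun g => ?_)
      simp only [χ, z, map_add, map_smul, smul_eq_mul, Real.norm_eq_abs, sq_abs, hin]
      simp
      ring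
    rw [integral_add ((hχi i).const_mul 3) (integrable_const _), integral_const_mul,
      EuclideanSpace.norm_sq_eq, Fin.sum_univ_two] at h
    have := hαβ i i
    simp at h this
    nlinarith
  have hχval : ∀ (g : DualBall ℝ X) (i j : Fin 3), (g.1 = f j ∨ g.1 = -f j) →
      χ i g = if j = i then 1 else 0 := fun g i j hg => by
    have : g.1 (z i) ^ 2 = (f j (z i)) ^ 2 := by
      rcases hg with hg | hg <;> rw [hg]
      rw [neg_apply, neg_sq]
    simp only [χ, this, hfz]
    split_ifs <;> norm_num
  have hmean : ∀ y, ∫ g : DualBall ℝ X, ‖g.1 y‖ ∂μ = 1 / 3 * ∑ i, |f i y| := fun y => by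
    have h1 : ∀ᵐ g : DualBall ℝ X ∂μ, ‖g.1 y‖ = ∑ i, χ i g * |f i y| := by
      filter_upwards [hsix] with g ⟨j, hj⟩
      simp_rw [hχval g _ j hj]
      have : ‖g.1 y‖ = |f j y| := by
        rcases hj with hj | hj <;> rw [hj]
        · rfl
        · rw [neg_apply, norm_neg]; rfl
      simp [this]
    rw [integral_congr_ae h1, integral_finsetSum _ fun i _ => (hχi i).mul_const _, Finset.mul_sum]
    refine Finset.sum_congr rfl fun i _ => ?_
    rw [integral_mul_const, hχint]
  -- A pair of positive mass cannot avoid the almost sure equality. This puts f i in the dual ball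
  -- and yields the diagonal values of Φ; the sign is irrelevant, as f ⊗ z is unchanged when both
  -- factors change sign.
  have hexists : ∀ i, ∃ g : DualBall ℝ X, (g.1 = f i ∨ g.1 = -f i) ∧
      RCLike.re (Φ (g.1.smulRight (dualVector x g))) =
        ∫ h, ‖inner ℝ (dualCoords x g) (dualCoords x h)‖ ∂μ := fun i => by
    by_contra hcon
    push Not at hcon
    have h0 : ∀ᵐ g : DualBall ℝ X ∂μ, χ i g = 0 := by
      filter_upwards [hsix, heq] with g ⟨j, hj⟩ hg
      rw [hχval g i j hj, if_neg]
      rintro rfl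
      exact hcon g hj hg
    have := hχint i
    rw [integral_congr_ae h0] at this
    simp at this
  refine ⟨f 0, f 1, norm_eq_max_of_certificate (Φ := Φ) (z := z) hfz (fun y => ?_) ?_ ?_ (fun i => ?_)
    (fun i => ?_) fun g hg y => ?_⟩
  · conv_lhs => rw [← b.sum_repr y]
    conv_rhs => rw [← b.sum_repr y]
    simp only [Fin.sum_univ_two, Fin.sum_univ_three, hb, map_add, map_smul, hfx0, hfx1, z,
      smul_eq_mul]
    match_scalars
    · linear_combination (-(b.repr y) 0 / 3) * hα2 + (-(b.repr y) 1 / 3) * hαβ0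
    · linear_combination (-(b.repr y) 0 / 3) * hαβ0 + (-(b.repr y) 1 / 3) * hβ2
  · refine hext _ _ ?_ ?_
    · simpa [Fin.sum_univ_three, hfx0] using hα0
    · simpa [Fin.sum_univ_three, hfx1] using hβ0
  · simp only [z, Fin.sum_univ_three]
    match_scalars
    · linear_combination hα0
    · linear_combination hβ0
  · obtain ⟨g, hg, -⟩ := hexists i
    rcases hg with hg | hg
    · exact hg ▸ g.norm_le
    · rw [← norm_neg, ← hg]; exact g.norm_le
  · obtain ⟨g, hg, hg'⟩ := hexists i
    simp_rw [← apply_dualVector] at hg'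
    rw [hmean] at hg'
    have hdv : dualVector x g = g.1 (x 0) • x 0 + g.1 (x 1) • x 1 := by
      simp [dualVector, Fin.sum_univ_two]
    have hsum : ∑ j, |f j (z i)| = 4 := by
      simp only [hfz, Fin.sum_univ_three]
      fin_cases i <;> norm_num [Fin.ext_iff]
    rcases hg with hg | hg
    · have hz : dualVector x g = z i := by rw [hdv, hg, hfx0, hfx1]
      rw [hz, hg, hsum] at hg'
      simp only [RCLike.re_to_real] at hg'
      linarith
    · have hz : dualVector x g = -z i := by
        rw [hdv, hg, neg_apply, neg_apply, hfx0, hfx1]; simp only [z]; module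
      have hr : (-f i).smulRight (-z i) = (f i).smulRight (z i) := by ext; simp
      rw [hz, hg, hr] at hg'
      simp only [map_neg, abs_neg, hsum, RCLike.re_to_real] at hg'
      linarith
  · have := hΦ ⟨g, mem_closedBall_zero_iff.mpr hg⟩ y
    rw [hmean] at this
    simpa using this

end Hexagon

/-! ### Hexagonal norms and the regular hexagon -/

section HexagonBall

theorem cos_sin_mul_pi_div_three (k : Fin 6) :
    (Real.cos ((k : ℕ) * (Real.pi / 3)), Real.sin ((k : ℕ) * (Real.pi / 3))) =
      (![((1 : ℝ), (0 : ℝ)), (1 / 2, √3 / 2), (-(1 / 2), √3 / 2), (-1, 0), (-(1 / 2), -(√3 / 2)),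
        (1 / 2, -(√3 / 2))] : Fin 6 → ℝ × ℝ) k := by
  have h2 : (2 : ℝ) * (Real.pi / 3) = Real.pi - Real.pi / 3 := by ring
  have h3 : (3 : ℝ) * (Real.pi / 3) = Real.pi := by ring
  have h4 : (4 : ℝ) * (Real.pi / 3) = Real.pi / 3 + Real.pi := by ring
  have h5 : (5 : ℝ) * (Real.pi / 3) = 2 * Real.pi - Real.pi / 3 := by ring
  fin_cases k
  · simp
  · simp
  · simp [h2, Real.cos_pi_sub, Real.sin_pi_sub]
  · simp [h3]
  · simp [h4, Real.cos_add_pi, Real.sin_add_pi]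
  · simp [h5, Real.cos_two_pi_sub, Real.sin_two_pi_sub]

/-- The regular hexagon is the unit ball of a hexagonal norm. -/
theorem mem_regularHexagon_iff (v : EuclideanSpace ℝ (Fin 2)) :
    v ∈ regularHexagon ↔ |v 0 - v 1 / √3| ≤ 1 ∧ |2 * v 1 / √3| ≤ 1 ∧ |v 0 + v 1 / √3| ≤ 1 := by
  have h30 : √3 ≠ 0 := by positivity
  constructor
  · let S : Set (EuclideanSpace ℝ (Fin 2)) :=
      {v | |v 0 - v 1 / √3| ≤ 1 ∧ |2 * v 1 / √3| ≤ 1 ∧ |v 0 + v 1 / √3| ≤ 1}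
    have hS : Convex ℝ S := by
      intro v hv w hw a b ha hb hab
      have key : ∀ s t : ℝ, |s| ≤ 1 → |t| ≤ 1 → |a * s + b * t| ≤ 1 := fun s t hs ht => by
        have := convex_closedBall (0 : ℝ) 1 (by simpa using hs) (by simpa using ht) ha hb hab
        simpa using this
      refine ⟨?_, ?_, ?_⟩
      · convert key _ _ hv.1 hw.1 using 2
        simp; ring
      · convert key _ _ hv.2.1 hw.2.1 using 2
        simp; ring
      · convert key _ _ hv.2.2 hw.2.2 using 2
        simp; ring
    refine fun hv => convexHull_min ?_ hS hv
    rintro _ ⟨k, rfl⟩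
    have h := cos_sin_mul_pi_div_three k
    have e1 : √3 / 2 / √3 = 1 / 2 := by field_simp
    have e2 : 2 * (√3 / 2) / √3 = 1 := by field_simp
    simp only [S, mem_ofPred_eq]
    rw [Prod.ext_iff] at h
    simp only [Matrix.cons_val_zero, Matrix.cons_val_one, Matrix.cons_val_fin_one]
    obtain ⟨hc, hs⟩ := h
    dsimp only at hc hs
    rw [hc, hs]
    fin_cases k <;> simp [neg_div, e1, e2] <;> norm_num
  · rintro ⟨hs, ht, hst⟩
    obtain ⟨s, hs'⟩ : ∃ s, s = v 0 - v 1 / √3 := ⟨_, rfl⟩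
    obtain ⟨t, ht'⟩ : ∃ t, t = 2 * v 1 / √3 := ⟨_, rfl⟩
    have hst' : v 0 + v 1 / √3 = s + t := by rw [hs', ht']; ring
    rw [← hs'] at hs
    rw [← ht'] at ht
    rw [hst'] at hst
    have hv1 : v 1 = √3 / 2 * t := by rw [ht']; field_simp
    have hv0 : v 0 = s + t / 2 := by rw [hs', ht']; ring
    rw [abs_le] at hs ht hst
    have hconv : Convex ℝ regularHexagon := convex_convexHull ℝ _
    have hvert : ∀ k : Fin 6, !₂[Real.cos ((k : ℕ) * (Real.pi / 3)),
        Real.sin ((k : ℕ) * (Real.pi / 3))] ∈ regularHexagon :=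
      fun k => subset_convexHull ℝ _ ⟨k, rfl⟩
    have hvert' : ∀ k : Fin 6, ∀ a b : ℝ, (a, b) = (![((1 : ℝ), (0 : ℝ)), (1 / 2, √3 / 2),
        (-(1 / 2), √3 / 2), (-1, 0), (-(1 / 2), -(√3 / 2)), (1 / 2, -(√3 / 2))] : Fin 6 → ℝ × ℝ) k →
        !₂[a, b] ∈ regularHexagon := fun k a b h => by
      have := hvert k
      rw [← cos_sin_mul_pi_div_three, Prod.ext_iff] at h
      obtain ⟨hc, hs⟩ := h
      dsimp only at hc hs
      rwa [hc, hs]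
    have v0 := hvert' 0 1 0 rfl
    have v1 := hvert' 1 (1 / 2) (√3 / 2) rfl
    have v2 := hvert' 2 (-(1 / 2)) (√3 / 2) rfl
    have v3 := hvert' 3 (-1) 0 rfl
    have v4 := hvert' 4 (-(1 / 2)) (-(√3 / 2)) rfl
    have v5 := hvert' 5 (1 / 2) (-(√3 / 2)) rfl
    have vz : (0 : EuclideanSpace ℝ (Fin 2)) ∈ regularHexagon := by
      convert hconv v0 v3 (a := 1 / 2) (b := 1 / 2) (by norm_num) (by norm_num) (by norm_num) using 1
      ext i; fin_cases i <;> simp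
    have tri : ∀ {P Q : EuclideanSpace ℝ (Fin 2)} {a b : ℝ}, P ∈ regularHexagon →
        Q ∈ regularHexagon → 0 ≤ a → 0 ≤ b → a + b ≤ 1 → a • P + b • Q ∈ regularHexagon := by
      intro P Q a b hP hQ ha hb hab
      rcases (add_nonneg ha hb).eq_or_lt with h | h
      · have ha0 : a = 0 := by linarith
        have hb0 : b = 0 := by linarith
        simpa [ha0, hb0] using vz
      · have h1 := hconv hP hQ (a := a / (a + b)) (b := b / (a + b)) (by positivity) (by positivity)
          (by field_simp)
        have h2 := hconv.smul_mem_of_zero_mem vz h1 ⟨h.le, hab⟩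
        convert h2 using 1
        rw [smul_add, smul_smul, smul_smul, mul_div_cancel₀ _ h.ne', mul_div_cancel₀ _ h.ne']
    have hfin : ∀ {P Q : EuclideanSpace ℝ (Fin 2)} {a b : ℝ}, P ∈ regularHexagon →
        Q ∈ regularHexagon → 0 ≤ a → 0 ≤ b → a + b ≤ 1 → v 0 = a * P 0 + b * Q 0 →
        v 1 = a * P 1 + b * Q 1 → v ∈ regularHexagon := by
      intro P Q a b hP hQ ha hb hab e0 e1
      convert tri hP hQ ha hb hab using 1
      ext i
      fin_cases i
      · simpa using e0
      · simpa using e1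
    -- The signs of s, t and s + t cut the plane into six sectors. In each, v is a nonnegative
    -- combination of two adjacent vertices with coefficients of sum at most 1.
    rcases le_total 0 s with h | h <;> rcases le_total 0 t with h' | h'
    · exact hfin (a := s) (b := t) v0 v1 h h' (by linarith) (by rw [hv0]; simp; ring)
        (by rw [hv1]; simp; ring)
    · rcases le_total 0 (s + t) with h'' | h''
      · exact hfin (a := -t) (b := s + t) v5 v0 (by linarith) h'' (by linarith)
          (by rw [hv0]; simp; ring) (by rw [hv1]; simp; ring)
      · exact hfin (a := s) (b := -(s + t)) v5 v4 h (by linarith) (by linarith)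
          (by rw [hv0]; simp; ring) (by rw [hv1]; simp; ring)
    · rcases le_total 0 (s + t) with h'' | h''
      · exact hfin (a := -s) (b := s + t) v2 v1 (by linarith) h'' (by linarith)
          (by rw [hv0]; simp; ring) (by rw [hv1]; simp; ring)
      · exact hfin (a := t) (b := -(s + t)) v2 v3 h' (by linarith) (by linarith)
          (by rw [hv0]; simp; ring) (by rw [hv1]; simp; ring)
    · exact hfin (a := -s) (b := -t) v3 v4 (by linarith) (by linarith) (by linarith)
        (by rw [hv0]; simp; ring) (by rw [hv1]; simp; ring)

variable {X : Type u} [NormedAddCommGroup X] [NormedSpace ℝ X] [FiniteDimensional ℝ X]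

/-- Linear coordinates which turn a hexagonal norm into the standard one. -/
theorem exists_linearEquiv_of_norm_eq_max (h2 : Module.finrank ℝ X = 2) {f₀ f₁ : StrongDual ℝ X}
    (h : ∀ x, ‖x‖ = max (max |f₀ x| |f₁ x|) |f₀ x + f₁ x|) :
    ∃ e : X ≃ₗ[ℝ] (Fin 2 → ℝ), ∀ x, ‖x‖ = max (max |e x 0| |e x 1|) |e x 0 + e x 1| := by
  let L : X →ₗ[ℝ] (Fin 2 → ℝ) := LinearMap.pi ![f₀.toLinearMap, f₁.toLinearMap]
  have hL0 : ∀ x, L x 0 = f₀ x := fun x => rfl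
  have hL1 : ∀ x, L x 1 = f₁ x := fun x => rfl
  have hinj : Function.Injective L := by
    rw [← LinearMap.ker_eq_bot, LinearMap.ker_eq_bot']
    intro x hx
    have h0 : f₀ x = 0 := by rw [← hL0, hx]; rfl
    have h1 : f₁ x = 0 := by rw [← hL1, hx]; rfl
    rw [← norm_eq_zero, h, h0, h1]
    simp
  refine ⟨LinearMap.linearEquivOfInjective L hinj (by simp [h2]), fun x => ?_⟩
  simp only [LinearMap.linearEquivOfInjective_apply, hL0, hL1]
  exact h x

theorem isAffineRegularHexagon_closedBall (h2 : Module.finrank ℝ X = 2) {f₀ f₁ : StrongDual ℝ X}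
    (h : ∀ x, ‖x‖ = max (max |f₀ x| |f₁ x|) |f₀ x + f₁ x|) :
    IsAffineRegularHexagon (Metric.closedBall (0 : X) 1) := by
  obtain ⟨e, he⟩ := exists_linearEquiv_of_norm_eq_max h2 h
  have h30 : √3 ≠ 0 := by positivity
  -- The coordinates from `mem_regularHexagon_iff` in which the regular hexagon is max(|s|, |t|, |s
  -- + t|) ≤ 1.
  let M : EuclideanSpace ℝ (Fin 2) ≃ₗ[ℝ] (Fin 2 → ℝ) :=
    { toFun := fun v => ![v 0 - v 1 / √3, 2 * v 1 / √3]
      invFun := fun y => !₂[y 0 + y 1 / 2, √3 / 2 * y 1]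
      map_add' := fun v w => by ext i; fin_cases i <;> simp <;> ring
      map_smul' := fun t v => by ext i; fin_cases i <;> simp <;> ring
      left_inv := fun v => by
        ext i; fin_cases i
        · simp; ring
        · simp
      right_inv := fun y => by
        ext i; fin_cases i
        · simp; field_simp; try ring
        · simp; field_simp }
  refine ⟨(M.trans e.symm).toAffineEquiv, ?_⟩
  ext x
  rw [mem_closedBall_zero_iff, he]
  have hmem : x ∈ (M.trans e.symm).toAffineEquiv '' regularHexagon ↔
      M.symm (e x) ∈ regularHexagon := by
    constructor
    · rintro ⟨v, hv, rfl⟩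
      simpa using hv
    · exact fun hx => ⟨_, hx, by simp⟩
  rw [hmem, mem_regularHexagon_iff, max_le_iff, max_le_iff, and_assoc]
  have e0 : (M.symm (e x)) 0 - (M.symm (e x)) 1 / √3 = e x 0 :=
    congrFun (M.apply_symm_apply (e x)) 0
  have e1 : 2 * (M.symm (e x)) 1 / √3 = e x 1 := congrFun (M.apply_symm_apply (e x)) 1
  have e2 : (M.symm (e x)) 0 + (M.symm (e x)) 1 / √3 = e x 0 + e x 1 := by
    rw [← e0, ← e1]; ring
  rw [e0, e1, e2]

theorem nonempty_linearIsometryEquiv_of_norm_eq_max (h2 : Module.finrank ℝ X = 2)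
    {f₀ f₁ : StrongDual ℝ X} (h : ∀ x, ‖x‖ = max (max |f₀ x| |f₁ x|) |f₀ x + f₁ x|)
    {Y : Type u} [NormedAddCommGroup Y] [NormedSpace ℝ Y] [FiniteDimensional ℝ Y]
    (h2' : Module.finrank ℝ Y = 2) {g₀ g₁ : StrongDual ℝ Y}
    (h' : ∀ y, ‖y‖ = max (max |g₀ y| |g₁ y|) |g₀ y + g₁ y|) : Nonempty (X ≃ₗᵢ[ℝ] Y) := by
  obtain ⟨e, he⟩ := exists_linearEquiv_of_norm_eq_max h2 h
  obtain ⟨e', he'⟩ := exists_linearEquiv_of_norm_eq_max h2' h'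
  refine ⟨⟨e.trans e'.symm, fun x => ?_⟩⟩
  rw [he', he]
  simp

end HexagonBall

/-! ### Lower bounds by traces of projections -/

section LowerBound

variable {𝕜 : Type} [RCLike 𝕜]

/-- A number of modulus at most one which rotates `a` to its modulus. -/
theorem exists_phase (a : 𝕜) : ∃ ε : 𝕜, ‖ε‖ ≤ 1 ∧ ε * a = (‖a‖ : 𝕜) := by
  rcases eq_or_ne a 0 with rfl | ha
  · exact ⟨0, by simp, by simp⟩
  · have h : (‖a‖ : 𝕜) ≠ 0 := by simpa using ha
    refine ⟨(starRingEnd 𝕜) a / ‖a‖, ?_, ?_⟩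
    · rw [norm_div, RCLike.norm_conj, RCLike.norm_ofReal, abs_norm]
      exact div_self_le_one _
    · rw [div_mul_eq_mul_div, RCLike.conj_mul, sq, mul_div_assoc, div_self h, mul_one]

/-- The dual norm of ℓ_∞ is the ℓ₁ norm: evaluate φ at a vector of phases, which lies in the unit
ball. -/
theorem sum_norm_apply_single_le {ι : Type u} [Fintype ι] [DecidableEq ι]
    (φ : (ι → 𝕜) →ₗ[𝕜] 𝕜) {C : ℝ} (hC : ∀ v, ‖φ v‖ ≤ C * ‖v‖) (hC0 : 0 ≤ C) :
    ∑ k, ‖φ (Pi.single k 1)‖ ≤ C := by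
  choose ε hε hε' using fun k => exists_phase (φ (Pi.single k 1))
  have h : φ ε = ((∑ k, ‖φ (Pi.single k 1)‖ : ℝ) : 𝕜) := by
    rw [LinearMap.pi_apply_eq_sum_univ φ ε]
    push_cast
    refine Finset.sum_congr rfl fun k _ => ?_
    refine Eq.trans ?_ (hε' k)
    rw [smul_eq_mul]
    congr 2
    ext j
    simp [Pi.single_apply, eq_comm]
  have h1 := hC ε
  rw [h, RCLike.norm_ofReal, abs_of_nonneg (Finset.sum_nonneg fun _ _ => norm_nonneg _)] at h1
  exact h1.trans (mul_le_of_le_one_right hC0 ((pi_norm_le_iff_of_nonneg zero_le_one).mpr hε))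

/-- Trace duality bounds the projection constant of a subspace of `ℓ_∞(ι)` from below. -/
theorem le_relProjConst_of_norm_le_sum {ι : Type u} [Fintype ι] {E : Submodule 𝕜 (ι → 𝕜)} {N : ℕ}
    (f : Fin N → E →ₗ[𝕜] 𝕜) (hf : ∀ i x, ‖f i x‖ ≤ ‖x‖) {κ : ℝ} (hκ : 0 < κ)
    (hE : ∀ x : E, ‖x‖ ≤ κ * ∑ i, ‖f i x‖) :
    ENNReal.ofReal (Module.finrank 𝕜 E / (κ * N)) ≤ relProjConst 𝕜 E := by
  classical
  refine le_iInf₂ fun P hP => ?_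
  rw [← ofReal_norm]
  refine ENNReal.ofReal_le_ofReal ?_
  let Q : (ι → 𝕜) →ₗ[𝕜] E := P.toLinearMap.codRestrict E hP.map_mem
  have hQ : ∀ v, ‖Q v‖ ≤ ‖P‖ * ‖v‖ := fun v => P.le_opNorm v
  -- The trace of a projection is its rank. Bounding the diagonal entries by ‖P eₖ‖ ≤ κ ∑ᵢ |fᵢ(P
  -- eₖ)| and exchanging the sums leaves N functionals on ℓ_∞ of norm at most ‖P‖.
  have htr : (Module.finrank 𝕜 E : 𝕜) = ∑ k, P (Pi.single k 1) k := by
    have hP' : LinearMap.IsProj E P.toLinearMap := ⟨hP.map_mem, hP.map_id⟩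
    rw [← hP'.trace, LinearMap.trace_eq_matrix_trace 𝕜 (Pi.basisFun 𝕜 ι), Matrix.trace]
    refine Finset.sum_congr rfl fun k _ => ?_
    simp
  have h1 : (Module.finrank 𝕜 E : ℝ) ≤ ∑ k, ‖Q (Pi.single k 1)‖ := by
    have h := congrArg norm htr
    rw [RCLike.norm_natCast] at h
    rw [h]
    refine (norm_sum_le _ _).trans (Finset.sum_le_sum fun k _ => ?_)
    exact norm_le_pi_norm (P (Pi.single k 1)) k
  have h2 : ∀ i, ∑ k, ‖f i (Q (Pi.single k 1))‖ ≤ ‖P‖ := fun i =>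
    sum_norm_apply_single_le (f i ∘ₗ Q) (fun v => (hf i _).trans (hQ v)) (norm_nonneg _)
  have h3 : (Module.finrank 𝕜 E : ℝ) ≤ κ * (N * ‖P‖) := by
    calc (Module.finrank 𝕜 E : ℝ) ≤ ∑ k, ‖Q (Pi.single k 1)‖ := h1
      _ ≤ ∑ k, κ * ∑ i, ‖f i (Q (Pi.single k 1))‖ := Finset.sum_le_sum fun k _ => hE _
      _ = κ * ∑ i, ∑ k, ‖f i (Q (Pi.single k 1))‖ := by
        rw [← Finset.mul_sum, Finset.sum_comm]
      _ ≤ κ * ∑ i : Fin N, ‖P‖ := by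
        gcongr with i
        exact h2 i
      _ = κ * (N * ‖P‖) := by simp
  refine div_le_of_le_mul₀ (by positivity) (norm_nonneg _) ?_
  linarith

theorem relProjConst_le_absProjConst {ι : Type u} [Fintype ι] (E : Submodule 𝕜 (ι → 𝕜)) :
    relProjConst 𝕜 E ≤ absProjConst 𝕜 E := by
  have h : LinearMap.range E.subtypeₗᵢ.toLinearMap = E := E.range_subtype
  refine le_iSup_of_le (ι → 𝕜) (le_iSup_of_le inferInstance (le_iSup_of_le inferInstance
    (le_iSup_of_le E.subtypeₗᵢ ?_)))
  rw [h]

end LowerBound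

/-! ### Frame parameters and polyhedral maximizers -/

section Frames

variable {𝕜 : Type} [RCLike 𝕜] {n N : ℕ} {w : Fin N → EuclideanSpace 𝕜 (Fin n)}

/-- The parameters of an equiangular tight frame. -/
theorem IsETF.exists_parameters (hw : IsETF w) (hN : 2 ≤ N) :
    ∃ c : ℝ, 0 ≤ c ∧ (∀ i j, i ≠ j → ‖inner 𝕜 (w i) (w j)‖ = c) ∧
      (N : ℝ) = n * (1 + (N - 1) * c ^ 2) ∧
      ∀ x, (N : 𝕜) • x = (n : 𝕜) • ∑ i, inner 𝕜 (w i) x • w i := by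
  obtain ⟨⟨-, hnorm, c, hc⟩, α, hα⟩ := hw
  have hαN : (n : 𝕜) = α * N := by
    -- These are the diagonal entries of the frame identity; adding them takes its trace and
    -- determines α = n/N.
    have h1 : ∀ j : Fin n, (1 : 𝕜) = α * ∑ i, ((‖w i j‖ ^ 2 : ℝ) : 𝕜) := fun j => by
      have h := congrArg (fun v : EuclideanSpace 𝕜 (Fin n) => v j)
        (hα (EuclideanSpace.single j (1 : 𝕜)))
      simp only [EuclideanSpace.inner_single_right, PiLp.smul_apply, smul_eq_mul, PiLp.single_apply,
        if_true, one_mul, WithLp.ofLp_sum, Finset.sum_apply] at h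
      rw [h]
      congr 1
      refine Finset.sum_congr rfl fun i _ => ?_
      rw [RCLike.conj_mul]
      push_cast
      rfl
    have h2 : ∑ j : Fin n, (1 : 𝕜) = α * ∑ i, ∑ j, ((‖w i j‖ ^ 2 : ℝ) : 𝕜) := by
      rw [Finset.sum_comm, Finset.mul_sum]
      exact Finset.sum_congr rfl fun j _ => h1 j
    have h3 : ∀ i, ∑ j, ((‖w i j‖ ^ 2 : ℝ) : 𝕜) = 1 := fun i => by
      rw [← RCLike.ofReal_sum, ← EuclideanSpace.norm_sq_eq, hnorm]
      simp
    simp_rw [h3] at h2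
    simpa using h2
  let i₀ : Fin N := ⟨0, by omega⟩
  let i₁ : Fin N := ⟨1, by omega⟩
  have hc0 : 0 ≤ c := by
    rw [← hc i₀ i₁ (by simp [i₀, i₁])]
    exact norm_nonneg _
  have hself : (1 : 𝕜) = α * ((1 + (N - 1) * c ^ 2 : ℝ) : 𝕜) := by
    have h := congrArg (fun v => inner 𝕜 (w i₀) v) (hα (w i₀))
    simp only [inner_smul_right, inner_sum] at h
    rw [inner_self_eq_norm_sq_to_K, hnorm] at h
    have h1 : ∀ i, inner 𝕜 (w i) (w i₀) * inner 𝕜 (w i₀) (w i) =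
        (((if i = i₀ then 1 - c ^ 2 else 0) + c ^ 2 : ℝ) : 𝕜) := fun i => by
      rw [← inner_conj_symm (w i₀) (w i), RCLike.mul_conj]
      split_ifs with hi
      · rw [hi, inner_self_eq_norm_sq_to_K, hnorm]; simp
      · rw [hc i i₀ hi]; simp
    simp_rw [h1, ← RCLike.ofReal_sum] at h
    rw [Finset.sum_add_distrib, Finset.sum_ite_eq' Finset.univ i₀] at h
    simp only [Finset.mem_univ, if_true, Finset.sum_const, Finset.card_univ, Fintype.card_fin,
      nsmul_eq_mul] at h
    simp only [map_one, one_pow] at h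
    rw [h]
    congr 2
    ring
  have hNn : (N : ℝ) = n * (1 + (N - 1) * c ^ 2) := by
    have h : (N : 𝕜) = n * ((1 + (N - 1) * c ^ 2 : ℝ) : 𝕜) := by
      rw [hαN, mul_right_comm, ← hself, one_mul]
    have h' : ((N : ℝ) : 𝕜) = ((n * (1 + (N - 1) * c ^ 2) : ℝ) : 𝕜) := by
      rw [RCLike.ofReal_mul, RCLike.ofReal_natCast, RCLike.ofReal_natCast, h]
    exact_mod_cast h'
  refine ⟨c, hc0, hc, hNn, fun x => ?_⟩
  conv_lhs => rw [hα x]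
  rw [smul_smul, hαN, mul_comm]

/-- The space `𝕜ⁿ` with the polyhedral norm `maxₗ |g l x|`, as a subspace of `ℓ_∞`. -/
abbrev polySpace {ι : Type u} (g : ι → EuclideanSpace 𝕜 (Fin n) →ₗ[𝕜] 𝕜) :
    Submodule 𝕜 (ι → 𝕜) :=
  LinearMap.range (LinearMap.pi g)

variable {ι : Type u} [Fintype ι] {g : ι → EuclideanSpace 𝕜 (Fin n) →ₗ[𝕜] 𝕜}

omit [Fintype ι] in
theorem injective_pi_of_frame
    (hfr : ∀ x, (N : 𝕜) • x = (n : 𝕜) • ∑ i, inner 𝕜 (w i) x • w i) (hNn : N ≠ 0)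
    (hgw : ∀ i, ∃ l, ∀ x, g l x = inner 𝕜 (w i) x) :
    Function.Injective (LinearMap.pi g) := by
  rw [← LinearMap.ker_eq_bot, LinearMap.ker_eq_bot']
  intro x hx
  have h0 : ∀ i, inner 𝕜 (w i) x = 0 := fun i => by
    obtain ⟨l, hl⟩ := hgw i
    rw [← hl]
    exact congrFun hx l
  have h := hfr x
  simp only [h0, zero_smul, Finset.sum_const_zero, smul_zero] at h
  exact (smul_eq_zero.mp h).resolve_left (by exact_mod_cast hNn)

omit [Fintype ι] in
theorem finrank_polySpace
    (hfr : ∀ x, (N : 𝕜) • x = (n : 𝕜) • ∑ i, inner 𝕜 (w i) x • w i) (hNn : N ≠ 0)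
    (hgw : ∀ i, ∃ l, ∀ x, g l x = inner 𝕜 (w i) x) :
    Module.finrank 𝕜 (polySpace g) = n := by
  rw [LinearMap.finrank_range_of_inj (injective_pi_of_frame hfr hNn hgw)]
  simp

/-- Polyhedral norms between `maxᵢ |⟨w i, x⟩|` and `κ ∑ᵢ |⟨w i, x⟩|` have large projection
constants. -/
theorem le_absProjConst_polySpace (hN : N ≠ 0)
    (hfr : ∀ x, (N : 𝕜) • x = (n : 𝕜) • ∑ i, inner 𝕜 (w i) x • w i) {κ : ℝ} (hκ : 0 < κ)
    (hgw : ∀ i, ∃ l, ∀ x, g l x = inner 𝕜 (w i) x)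
    (hgle : ∀ l x, ‖g l x‖ ≤ κ * ∑ i, ‖inner 𝕜 (w i) x‖) :
    ENNReal.ofReal (n / (κ * N)) ≤ absProjConst 𝕜 (polySpace g) := by
  choose l hl using hgw
  refine le_trans ?_ (relProjConst_le_absProjConst (polySpace g))
  have h := le_relProjConst_of_norm_le_sum (E := polySpace g) (N := N)
    (fun i => LinearMap.proj (l i) ∘ₗ (polySpace g).subtype)
    (fun i x => norm_le_pi_norm (x : ι → 𝕜) (l i)) hκ ?_
  · rwa [finrank_polySpace hfr hN fun i => ⟨l i, hl i⟩] at h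
  · rintro ⟨_, x, rfl⟩
    change ‖LinearMap.pi g x‖ ≤ κ * ∑ i, ‖g (l i) x‖
    simp_rw [hl]
    exact (pi_norm_le_iff_of_nonneg (mul_nonneg hκ.le
      (Finset.sum_nonneg fun _ _ => norm_nonneg _))).mpr fun k => hgle k x

/-- The lower bound for the polyhedral space meets the universal upper bound, which pins down the
maximal constant as well. -/
theorem isMaximizer_polySpace {δ : ℝ}
    (hupper : ∀ (X : Type u) [NormedAddCommGroup X] [NormedSpace 𝕜 X] [FiniteDimensional 𝕜 X],
      Module.finrank 𝕜 X = n → absProjConst 𝕜 X ≤ ENNReal.ofReal δ) (hN : N ≠ 0)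
    (hfr : ∀ x, (N : 𝕜) • x = (n : 𝕜) • ∑ i, inner 𝕜 (w i) x • w i) {κ : ℝ} (hκ : 0 < κ)
    (hδ : n / (κ * N) = δ)
    (hgw : ∀ i, ∃ l, ∀ x, g l x = inner 𝕜 (w i) x)
    (hgle : ∀ l x, ‖g l x‖ ≤ κ * ∑ i, ‖inner 𝕜 (w i) x‖) :
    IsMaximizer.{u} 𝕜 n (polySpace g) ∧ maxProjConst.{u} 𝕜 n = ENNReal.ofReal δ := by
  have h1 := le_absProjConst_polySpace hN hfr hκ hgw hgle
  rw [hδ] at h1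
  have hfin := finrank_polySpace hfr hN hgw
  have h2 : absProjConst 𝕜 (polySpace g) ≤ maxProjConst.{u} 𝕜 n :=
    le_iSup_of_le (polySpace g) (le_iSup_of_le inferInstance (le_iSup_of_le inferInstance
      (le_iSup_of_le inferInstance (le_iSup_of_le hfin le_rfl))))
  have h3 : maxProjConst.{u} 𝕜 n ≤ ENNReal.ofReal δ :=
    iSup_le fun X => iSup_le fun _ => iSup_le fun _ => iSup_le fun _ => iSup_le fun h => hupper X h
  exact ⟨⟨inferInstance, hfin, h2.antisymm (h3.trans h1)⟩, h3.antisymm (h1.trans h2)⟩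

/-- The value of the maximal projection constant in terms of the angle of the frame. -/
theorem frame_constant_eq {n N c : ℝ} (hN : 2 ≤ N) (hc : 0 < c)
    (hNn : N = n * (1 + (N - 1) * c ^ 2)) :
    n / ((1 + (N - 1) * c)⁻¹ * N) = (1 + n * c) / (1 + c) := by
  have h1 : 0 < 1 + (N - 1) * c := by nlinarith
  field_simp
  linear_combination -hNn

end Frames

/-! ### Irredundant functionals as an isometry invariant -/

section Counting

variable {𝕜 : Type*} [RCLike 𝕜] {E : Type*} [AddCommGroup E] [Module 𝕜 E]

/-- If `|u|` attains at `p` the value of a maximum of moduli of functionals which dominates `|u|`, and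
only `|h|` contributes to that maximum at `p`, then `|u| = |h|`. -/
theorem norm_apply_eq_of_unique_max {ι : Type*} [Fintype ι] (g : ι → E →ₗ[𝕜] 𝕜) (u : E →ₗ[𝕜] 𝕜)
    (hu : ∀ x, ‖u x‖ ≤ ‖LinearMap.pi g x‖) {k : ι} {p : E} (h0 : 0 < ‖g k p‖)
    (hp : ∀ l, l ≠ k → ‖g l p‖ < ‖g k p‖) (hup : ‖u p‖ = ‖g k p‖) (x : E) : ‖u x‖ = ‖g k x‖ := by
  have hgk : g k p ≠ 0 := norm_pos_iff.mp h0
  have huk : u p ≠ 0 := norm_pos_iff.mp (hup ▸ h0)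
  -- If u y ≠ 0, move p slightly along y with the phase that increases |u|. The maximum stays at |g
  -- k p|, since g k does not change and the other functionals have room, so u would exceed it.
  -- Hence u is a multiple of g k, and the moduli agree at p.
  have hker : ∀ y, g k y = 0 → u y = 0 := by
    intro y hy
    by_contra hne
    have hev : ∀ᶠ t : ℝ in nhdsWithin 0 (Ioi 0), ∀ l, l ≠ k →
        ‖g l p + ((t : 𝕜) * (u p / u y)) * g l y‖ < ‖g k p‖ := by
      rw [Filter.eventually_all]
      intro l
      by_cases hl : l = k
      · simp [hl]
      have hc : Continuous fun t : ℝ => ‖g l p + ((t : 𝕜) * (u p / u y)) * g l y‖ := by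
        have := RCLike.continuous_ofReal (K := 𝕜)
        fun_prop
      have := hc.tendsto 0
      simp only [RCLike.ofReal_zero, zero_mul, add_zero] at this
      filter_upwards [(this.mono_left nhdsWithin_le_nhds).eventually_lt_const (hp l hl)] with t ht _
      exact ht
    obtain ⟨t, ht, ht0⟩ := (hev.and self_mem_nhdsWithin).exists
    have ht0 : 0 < t := ht0
    have h1 := hu (p + ((t : 𝕜) * (u p / u y)) • y)
    have h2 : u (p + ((t : 𝕜) * (u p / u y)) • y) = ((1 + t : ℝ) : 𝕜) * u p := by
      rw [map_add, map_smul, smul_eq_mul, mul_assoc, div_mul_cancel₀ _ hne]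
      push_cast
      ring
    have h3 : ‖LinearMap.pi g (p + ((t : 𝕜) * (u p / u y)) • y)‖ ≤ ‖g k p‖ := by
      refine (pi_norm_le_iff_of_nonneg h0.le).mpr fun l => ?_
      rw [LinearMap.pi_apply, map_add, map_smul, smul_eq_mul]
      by_cases hl : l = k
      · rw [hl, hy, mul_zero, add_zero]
      · exact (ht l hl).le
    rw [h2, norm_mul, RCLike.norm_ofReal, abs_of_pos (by linarith), hup] at h1
    nlinarith
  have h := hker (x - (g k x / g k p) • p) (by
    rw [map_sub, map_smul, smul_eq_mul, div_mul_cancel₀ _ hgk, sub_self])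
  rw [map_sub, map_smul, smul_eq_mul, sub_eq_zero] at h
  rw [h, norm_mul, norm_div, hup, div_mul_cancel₀ _ h0.ne']

/-- A polyhedral norm with `m` irredundant functionals needs at least `m` functionals. -/
theorem le_card_of_irredundant {ι₁ ι₂ : Type*} [Fintype ι₁] [Fintype ι₂]
    (g : ι₁ → E →ₗ[𝕜] 𝕜) (u : ι₂ → E →ₗ[𝕜] 𝕜)
    (hgu : ∀ x, ‖LinearMap.pi u x‖ = ‖LinearMap.pi g x‖) {m : ℕ} (s : Fin m → ι₁)
    (hs : Function.Injective s) (p : Fin m → E) (h0 : ∀ k, 0 < ‖g (s k) (p k)‖)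
    (hp : ∀ k l, l ≠ s k → ‖g l (p k)‖ < ‖g (s k) (p k)‖) : m ≤ Fintype.card ι₂ := by
  have hmax : ∀ k, ‖LinearMap.pi g (p k)‖ = ‖g (s k) (p k)‖ := fun k => by
    refine le_antisymm ((pi_norm_le_iff_of_nonneg (h0 k).le).mpr fun l => ?_)
      (norm_le_pi_norm (LinearMap.pi g (p k)) (s k))
    by_cases hl : l = s k
    · rw [hl]; rfl
    · exact (hp k l hl).le
  have hex : ∀ k, ∃ j, ∀ x, ‖u j x‖ = ‖g (s k) x‖ := fun k => by
    have hne : Nonempty ι₂ := by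
      by_contra hemp
      rw [not_nonempty_iff] at hemp
      have := hgu (p k)
      rw [hmax, Subsingleton.elim (LinearMap.pi u (p k)) 0, norm_zero] at this
      exact (h0 k).ne this
    obtain ⟨j, hj⟩ := Finite.exists_max fun j => ‖u j (p k)‖
    refine ⟨j, norm_apply_eq_of_unique_max g (u j)
      (fun x => (norm_le_pi_norm (LinearMap.pi u x) j).trans_eq (hgu x)) (h0 k) (hp k) ?_⟩
    rw [← hmax, ← hgu]
    exact le_antisymm (norm_le_pi_norm (LinearMap.pi u (p k)) j)
      ((pi_norm_le_iff_of_nonneg (norm_nonneg _)).mpr hj)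
  choose j hj using hex
  have hinj : Function.Injective j := by
    intro a b hab
    by_contra hne
    have h1 := hp a (s b) fun h => hne (hs h).symm
    rw [← hj a, ← hj b, hab] at h1
    exact lt_irrefl _ h1
  simpa using Fintype.card_le_of_injective j hinj

end Counting

/-! ### Infinitely many norms between the extremes -/

section Family

variable {𝕜 : Type} [RCLike 𝕜] {n N : ℕ} {w : Fin N → EuclideanSpace 𝕜 (Fin n)}

theorem exists_ne_zero_of_apply_eq_zero (hn : 2 ≤ n) (φ : EuclideanSpace 𝕜 (Fin n) →ₗ[𝕜] 𝕜) :
    ∃ y, y ≠ 0 ∧ φ y = 0 := by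
  have h := LinearMap.ker_ne_bot_of_finrank_lt (f := φ) (by simp; omega)
  obtain ⟨y, hy, hy0⟩ := Submodule.exists_mem_ne_zero_of_ne_bot h
  exact ⟨y, hy0, hy⟩

/-- The two extreme norms attached to the frame differ. -/
theorem exists_gap (hn : 2 ≤ n) (hN : 2 ≤ N) {c : ℝ} (hc0 : 0 < c) (hc1 : c < 1)
    (hnorm : ∀ i, ‖w i‖ = 1) (hc : ∀ i j, i ≠ j → ‖inner 𝕜 (w i) (w j)‖ = c)
    (hNn : (N : ℝ) = n * (1 + (N - 1) * c ^ 2))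
    (hfr : ∀ x, (N : 𝕜) • x = (n : 𝕜) • ∑ i, inner 𝕜 (w i) x • w i) {ζ : 𝕜} (hζ : ‖ζ‖ = 1)
    (hζc : RCLike.re ((c : 𝕜) ^ 2 + ζ * (c * (1 - c))) < ‖(c : 𝕜) ^ 2 + ζ * (c * (1 - c))‖) :
    ∃ x : EuclideanSpace 𝕜 (Fin n), (∀ i, ‖inner 𝕜 (w i) x‖ ≤ 1) ∧
      1 < (1 + (N - 1) * c)⁻¹ * ∑ i, ‖inner 𝕜 (w i) x‖ := by
  have hn0 : (n : ℝ) ≠ 0 := by positivity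
  have hN' : (2 : ℝ) ≤ N := by exact_mod_cast hN
  let i₀ : Fin N := ⟨0, by omega⟩
  have hself : ∀ i, inner 𝕜 (w i) (w i) = (1 : 𝕜) := fun i => by
    rw [inner_self_eq_norm_sq_to_K, hnorm]; simp
  obtain ⟨y₀, hy₀, hy₀'⟩ := exists_ne_zero_of_apply_eq_zero hn (innerₛₗ 𝕜 (w i₀))
  change inner 𝕜 (w i₀) y₀ = 0 at hy₀'
  have : Nonempty (Fin N) := ⟨i₀⟩
  obtain ⟨k, hk⟩ := Finite.exists_max fun i => ‖inner 𝕜 (w i) y₀‖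
  have hM : inner 𝕜 (w k) y₀ ≠ 0 := by
    intro h0
    have hall : ∀ i, inner 𝕜 (w i) y₀ = 0 := fun i => by
      have := hk i
      rw [h0, norm_zero] at this
      exact norm_le_zero_iff.mp this
    have h := hfr y₀
    simp only [hall, zero_smul, Finset.sum_const_zero, smul_zero] at h
    exact hy₀ ((smul_eq_zero.mp h).resolve_left (by
      have : N ≠ 0 := by omega
      exact_mod_cast this))
  have hki : k ≠ i₀ := fun h => hM (h ▸ hy₀')
  have hτ : inner 𝕜 (w i₀) (w k) ≠ 0 := by
    rw [← norm_ne_zero_iff, hc _ _ hki.symm]; exact hc0.ne'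
  set τ := inner 𝕜 (w i₀) (w k) * inner 𝕜 (w k) y₀ with hτdef
  have hτ0 : τ ≠ 0 := mul_ne_zero hτ hM
  have hτn : ‖τ‖ = c * ‖inner 𝕜 (w k) y₀‖ := by rw [hτdef, norm_mul, hc _ _ hki.symm]
  -- The modulus of z makes the largest |⟨w i, z y₀⟩| equal to 1 − c, so adding z y₀ to w i₀ keeps
  -- all inner products in the unit disc. Its phase places ζ in the term with index k.
  set z : 𝕜 := ζ * (c * (1 - c)) / τ with hz
  have hzn : ‖z‖ = (1 - c) / ‖inner 𝕜 (w k) y₀‖ := by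
    have h1 : ‖(1 - c : 𝕜)‖ = 1 - c := by
      rw [← RCLike.ofReal_one, ← RCLike.ofReal_sub, RCLike.norm_ofReal, abs_of_pos (by linarith)]
    rw [hz, norm_div, norm_mul, norm_mul, hζ, hτn, RCLike.norm_ofReal, abs_of_pos hc0, h1]
    have := norm_ne_zero_iff.mpr hM
    field_simp
  have hzle : ∀ i, ‖inner 𝕜 (w i) (z • y₀)‖ ≤ 1 - c := fun i => by
    rw [inner_smul_right, norm_mul, hzn, div_mul_eq_mul_div]
    refine div_le_of_le_mul₀ (norm_nonneg _) (by linarith) ?_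
    exact mul_le_mul_of_nonneg_left (hk i) (by linarith)
  have hx0 : inner 𝕜 (w i₀) (w i₀ + z • y₀) = (1 : 𝕜) := by
    rw [inner_add_right, inner_smul_right, hy₀', mul_zero, add_zero, hself]
  refine ⟨w i₀ + z • y₀, fun i => ?_, ?_⟩
  · by_cases hi : i = i₀
    · rw [hi, hx0, norm_one]
    · rw [inner_add_right]
      have := norm_add_le (inner 𝕜 (w i) (w i₀)) (inner 𝕜 (w i) (z • y₀))
      rw [hc i i₀ hi] at this
      linarith [hzle i]
  · set x := w i₀ + z • y₀ with hx
    have h1 := congrArg (fun v => inner 𝕜 (w i₀) v) (hfr x)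
    simp only [inner_smul_right, inner_sum, hx0, mul_one] at h1
    rw [← Finset.add_sum_erase _ _ (Finset.mem_univ i₀), hx0, hself, one_mul] at h1
    set S := ∑ i ∈ Finset.univ.erase i₀, inner 𝕜 (w i) x * inner 𝕜 (w i₀) (w i) with hS
    have hreS : (N : ℝ) = n * (1 + RCLike.re S) := by
      have := congrArg RCLike.re h1
      rw [RCLike.natCast_re, ← RCLike.ofReal_natCast (K := 𝕜) n, RCLike.re_ofReal_mul, map_add,
        RCLike.one_re] at this
      exact this
    have hreS' : RCLike.re S = (N - 1) * c ^ 2 := by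
      have := mul_left_cancel₀ hn0 (hNn.symm.trans hreS)
      linarith
    -- The frame identity fixes Re S independently of the perturbation, and the triangle inequality
    -- is strict in the term k by the choice of ζ.
    have hlt : RCLike.re S < ∑ i ∈ Finset.univ.erase i₀, c * ‖inner 𝕜 (w i) x‖ := by
      rw [hS, map_sum]
      have hterm : ∀ i ∈ Finset.univ.erase i₀, ‖inner 𝕜 (w i) x * inner 𝕜 (w i₀) (w i)‖ =
          c * ‖inner 𝕜 (w i) x‖ := fun i hi => by
        rw [norm_mul, hc i₀ i (Finset.ne_of_mem_erase hi).symm, mul_comm]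
      refine Finset.sum_lt_sum (fun i hi => ?_) ⟨k, Finset.mem_erase.mpr ⟨hki, Finset.mem_univ _⟩, ?_⟩
      · rw [← hterm i hi]
        exact RCLike.re_le_norm _
      · rw [← hterm k (Finset.mem_erase.mpr ⟨hki, Finset.mem_univ _⟩)]
        have hval : inner 𝕜 (w k) x * inner 𝕜 (w i₀) (w k) = (c : 𝕜) ^ 2 + ζ * (c * (1 - c)) := by
          have e1 : inner 𝕜 (w k) (w i₀) * inner 𝕜 (w i₀) (w k) = (c : 𝕜) ^ 2 := by
            rw [← inner_conj_symm (w k) (w i₀), RCLike.conj_mul, hc _ _ hki.symm]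
          have e2 : z * τ = ζ * (c * (1 - c)) := div_mul_cancel₀ _ hτ0
          rw [hx, inner_add_right, inner_smul_right, add_mul, e1, ← e2, hτdef]
          ring
        rw [hval]
        exact hζc
    rw [hreS', ← Finset.mul_sum] at hlt
    rw [← Finset.add_sum_erase _ _ (Finset.mem_univ i₀), hx0, norm_one]
    have hpos : 0 < 1 + ((N : ℝ) - 1) * c := by nlinarith
    rw [inv_mul_eq_div, one_lt_div hpos]
    have : (N - 1) * c < ∑ i ∈ Finset.univ.erase i₀, ‖inner 𝕜 (w i) x‖ := by
      refine lt_of_mul_lt_mul_left ?_ hc0.le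
      linarith
    linarith

/-- A sequence of functionals below `κ ∑ᵢ |⟨w i, x⟩|`, each of which dominates the others and all
`⟨w i, x⟩` at some point. -/
theorem exists_irredundant_sequence (hn : 2 ≤ n) (hN : N ≠ 0)
    (hfr : ∀ x, (N : 𝕜) • x = (n : 𝕜) • ∑ i, inner 𝕜 (w i) x • w i) {κ : ℝ} (hκ : 0 < κ)
    {x₀ : EuclideanSpace 𝕜 (Fin n)} (hx₀ : ∀ i, ‖inner 𝕜 (w i) x₀‖ ≤ 1)
    (hx₀' : 1 < κ * ∑ i, ‖inner 𝕜 (w i) x₀‖) :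
    ∃ (G : ℕ → EuclideanSpace 𝕜 (Fin n) →ₗ[𝕜] 𝕜) (p : ℕ → EuclideanSpace 𝕜 (Fin n)),
      (∀ k x, ‖G k x‖ ≤ κ * ∑ i, ‖inner 𝕜 (w i) x‖) ∧
      (∀ k i, ‖inner 𝕜 (w i) (p k)‖ < ‖G k (p k)‖) ∧
      ∀ j k, j ≠ k → ‖G j (p k)‖ < ‖G k (p k)‖ := by
  set R := κ * ∑ i, ‖inner 𝕜 (w i) x₀‖ with hR
  have hR0 : 0 < R := by linarith
  choose ε hε hε' using fun i => exists_phase (inner 𝕜 (w i) x₀)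
  let g : EuclideanSpace 𝕜 (Fin n) →ₗ[𝕜] 𝕜 := (κ : 𝕜) • ∑ i, ε i • innerₛₗ 𝕜 (w i)
  have hg : ∀ x, g x = κ * ∑ i, ε i * inner 𝕜 (w i) x := fun x => by
    simp [g, LinearMap.sum_apply, RCLike.real_smul_eq_coe_mul]
  have hgle : ∀ x, ‖g x‖ ≤ κ * ∑ i, ‖inner 𝕜 (w i) x‖ := fun x => by
    rw [hg, norm_mul, RCLike.norm_ofReal, abs_of_pos hκ]
    refine mul_le_mul_of_nonneg_left ((norm_sum_le _ _).trans (Finset.sum_le_sum fun i _ => ?_)) hκ.le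
    rw [norm_mul]
    exact mul_le_of_le_one_left (norm_nonneg _) (hε i)
  have hgx₀ : g x₀ = R := by
    rw [hg, hR]
    simp_rw [hε']
    push_cast
    rfl
  have hRK : (R : 𝕜) ≠ 0 := by exact_mod_cast hR0.ne'
  obtain ⟨x₁, hx₁, hgx₁⟩ := exists_ne_zero_of_apply_eq_zero hn g
  -- A second direction: h vanishes at x₀ and g vanishes at x₁, so g and h can be mixed
  -- independently.
  let h : EuclideanSpace 𝕜 (Fin n) →ₗ[𝕜] 𝕜 :=
    innerₛₗ 𝕜 x₁ - ((R : 𝕜)⁻¹ * inner 𝕜 x₁ x₀) • g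
  have hh : ∀ x, h x = inner 𝕜 x₁ x - ((R : 𝕜)⁻¹ * inner 𝕜 x₁ x₀) * g x := fun x => rfl
  have hhx₀ : h x₀ = 0 := by rw [hh, hgx₀]; field_simp; simp
  have hhx₁ : h x₁ ≠ 0 := by
    rw [hh, hgx₁, mul_zero, sub_zero]
    exact inner_self_ne_zero.mpr hx₁
  obtain ⟨C, hC0, hC⟩ : ∃ C : ℝ, 0 < C ∧ ∀ x, ‖h x‖ ≤ C * (κ * ∑ i, ‖inner 𝕜 (w i) x‖) := by
    refine ⟨n / N * (∑ i, ‖h (w i)‖) / κ + 1, by positivity, fun x => ?_⟩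
    have hNK : (N : 𝕜) ≠ 0 := by exact_mod_cast hN
    have hx : h x = n / N * ∑ i, inner 𝕜 (w i) x * h (w i) := by
      have := congrArg h (hfr x)
      rw [map_smul, map_smul, map_sum] at this
      simp only [map_smul, smul_eq_mul] at this
      field_simp
      rw [mul_comm]
      exact this
    have h1 : ‖h x‖ ≤ n / N * ((∑ i, ‖inner 𝕜 (w i) x‖) * ∑ i, ‖h (w i)‖) := by
      rw [hx, norm_mul, norm_div, RCLike.norm_natCast, RCLike.norm_natCast]
      refine mul_le_mul_of_nonneg_left ((norm_sum_le _ _).trans ?_) (by positivity)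
      rw [Finset.sum_mul]
      refine Finset.sum_le_sum fun i _ => ?_
      rw [norm_mul]
      exact mul_le_mul_of_nonneg_left
        (Finset.single_le_sum (f := fun i => ‖h (w i)‖) (fun _ _ => norm_nonneg _)
          (Finset.mem_univ i)) (norm_nonneg _)
    have h2 : (n / N * (∑ i, ‖h (w i)‖) / κ + 1) * (κ * ∑ i, ‖inner 𝕜 (w i) x‖) =
        n / N * ((∑ i, ‖inner 𝕜 (w i) x‖) * ∑ i, ‖h (w i)‖) + κ * ∑ i, ‖inner 𝕜 (w i) x‖ := by
      field_simp
    rw [h2]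
    have : 0 ≤ κ * ∑ i, ‖inner 𝕜 (w i) x‖ := by positivity
    linarith
  -- the scaling parameters
  obtain ⟨ρ, hρR, hρ1⟩ : ∃ ρ : ℝ, 1 / R < ρ ∧ ρ < 1 :=
    exists_between (by rw [div_lt_one hR0]; exact hx₀')
  have hρ0 : 0 < ρ := lt_trans (by positivity) hρR
  obtain ⟨η, hη0, hη⟩ : ∃ η : ℝ, 0 < η ∧ ρ * (1 + η * C) = 1 := by
    refine ⟨(1 / ρ - 1) / C, div_pos ?_ hC0, ?_⟩
    · rw [sub_pos, lt_div_iff₀ hρ0]; linarith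
    · field_simp; ring
  have hηK : (η : 𝕜) ≠ 0 := by exact_mod_cast hη0.ne'
  let x₂ : EuclideanSpace 𝕜 (Fin n) := ((η : 𝕜) * h x₁)⁻¹ • x₁
  obtain ⟨K, hK0, hK⟩ : ∃ K : ℝ, 0 ≤ K ∧ ∀ i, ‖inner 𝕜 (w i) x₂‖ ≤ K :=
    ⟨∑ i, ‖inner 𝕜 (w i) x₂‖, by positivity, fun i =>
      Finset.single_le_sum (f := fun i => ‖inner 𝕜 (w i) x₂‖) (fun _ _ => norm_nonneg _)
        (Finset.mem_univ i)⟩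
  -- For angles up to θ₀ the points p k stay so close to the line of x₀ that |⟨w i, p k⟩| remains
  -- below ρ, the value of |G k| there. This is possible because ρ > 1/R.
  obtain ⟨θ₀, hθ0, hθ1, hθK⟩ : ∃ θ₀ : ℝ, 0 < θ₀ ∧ θ₀ ≤ 1 ∧ 1 / R + θ₀ * K < ρ := by
    have hd : 0 < ρ - 1 / R := by linarith
    refine ⟨min 1 ((ρ - 1 / R) / (K + 1)), by positivity, min_le_left _ _, ?_⟩
    have h1 : min 1 ((ρ - 1 / R) / (K + 1)) ≤ (ρ - 1 / R) / (K + 1) := min_le_right _ _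
    have h2 : (ρ - 1 / R) / (K + 1) * K < ρ - 1 / R := by
      rw [div_mul_eq_mul_div, div_lt_iff₀ (by positivity)]
      nlinarith
    nlinarith [mul_le_mul_of_nonneg_right h1 hK0]
  let θ : ℕ → ℝ := fun k => θ₀ / (k + 1)
  have hθpos : ∀ k, 0 < θ k := fun k => by positivity
  have hθle : ∀ k, θ k ≤ θ₀ := fun k => by
    refine div_le_self hθ0.le ?_
    have : (0 : ℝ) ≤ k := by positivity
    linarith
  have hθinj : ∀ j k, θ j = θ k → j = k := fun j k hjk => by
    have : (j : ℝ) + 1 = k + 1 := by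
      have hjk' : θ₀ / (j + 1) = θ₀ / (k + 1) := hjk
      rw [div_eq_div_iff (by positivity) (by positivity)] at hjk'
      exact (mul_left_cancel₀ hθ0.ne' hjk').symm
    have : (j : ℝ) = k := by linarith
    exact_mod_cast this
  -- Functionals and points run along dual arcs of ellipses, normalized so that G j (p k) = ρ cos(θ
  -- j − θ k), which is largest in modulus only for j = k. The condition ρ(1 + ηC) = 1 keeps every G
  -- k below the upper extreme norm.
  let G : ℕ → EuclideanSpace 𝕜 (Fin n) →ₗ[𝕜] 𝕜 := fun k =>
    (ρ : 𝕜) • (((Real.cos (θ k) : ℝ) : 𝕜) • g + ((η * Real.sin (θ k) : ℝ) : 𝕜) • h)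
  let p : ℕ → EuclideanSpace 𝕜 (Fin n) := fun k =>
    ((Real.cos (θ k) / R : ℝ) : 𝕜) • x₀ + ((Real.sin (θ k) : ℝ) : 𝕜) • x₂
  have hGp : ∀ j k, G j (p k) = ((ρ * Real.cos (θ j - θ k) : ℝ) : 𝕜) := fun j k => by
    have e1 : g (p k) = ((Real.cos (θ k) : ℝ) : 𝕜) := by
      simp only [p, x₂, map_add, map_smul, hgx₀, hgx₁, smul_eq_mul, mul_zero, add_zero]
      push_cast
      field_simp
    have e2 : h (p k) = ((Real.sin (θ k) / η : ℝ) : 𝕜) := by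
      simp only [p, x₂, map_add, map_smul, hhx₀, smul_eq_mul, mul_zero, zero_add]
      push_cast
      field_simp
    change (ρ : 𝕜) * (((Real.cos (θ j) : ℝ) : 𝕜) * g (p k) +
      ((η * Real.sin (θ j) : ℝ) : 𝕜) * h (p k)) = _
    rw [e1, e2, Real.cos_sub]
    push_cast
    field_simp
  have hGpn : ∀ k, ‖G k (p k)‖ = ρ := fun k => by
    rw [hGp, sub_self, Real.cos_zero, mul_one, RCLike.norm_ofReal, abs_of_pos hρ0]
  refine ⟨G, p, fun k x => ?_, fun k i => ?_, fun j k hjk => ?_⟩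
  · have e : G k x = (ρ : 𝕜) * (((Real.cos (θ k) : ℝ) : 𝕜) * g x +
      ((η * Real.sin (θ k) : ℝ) : 𝕜) * h x) := rfl
    rw [e, norm_mul, RCLike.norm_ofReal, abs_of_pos hρ0]
    have h1 : ‖((Real.cos (θ k) : ℝ) : 𝕜) * g x + ((η * Real.sin (θ k) : ℝ) : 𝕜) * h x‖ ≤
        ‖g x‖ + η * ‖h x‖ := by
      refine (norm_add_le _ _).trans (add_le_add ?_ ?_)
      · rw [norm_mul, RCLike.norm_ofReal]
        exact mul_le_of_le_one_left (norm_nonneg _) (Real.abs_cos_le_one _)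
      · rw [norm_mul, RCLike.norm_ofReal, abs_mul, abs_of_pos hη0]
        refine mul_le_mul_of_nonneg_right ?_ (norm_nonneg _)
        exact mul_le_of_le_one_right hη0.le (Real.abs_sin_le_one _)
    have h2 : ‖g x‖ + η * ‖h x‖ ≤ (1 + η * C) * (κ * ∑ i, ‖inner 𝕜 (w i) x‖) := by
      have := mul_le_mul_of_nonneg_left (hC x) hη0.le
      linarith [hgle x]
    calc _ ≤ ρ * ((1 + η * C) * (κ * ∑ i, ‖inner 𝕜 (w i) x‖)) :=
          mul_le_mul_of_nonneg_left (h1.trans h2) hρ0.le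
      _ = _ := by rw [← mul_assoc, hη, one_mul]
  · rw [hGpn]
    simp only [p]
    rw [inner_add_right, inner_smul_right, inner_smul_right]
    have hcos0 : 0 ≤ Real.cos (θ k) :=
      (Real.cos_pos_of_le_one (by rw [abs_of_pos (hθpos k)]; exact (hθle k).trans hθ1)).le
    have hsin : |Real.sin (θ k)| ≤ θ₀ := by
      refine (Real.abs_sin_le_abs).trans ?_
      rw [abs_of_pos (hθpos k)]
      exact hθle k
    refine lt_of_le_of_lt (norm_add_le _ _) (lt_of_le_of_lt (add_le_add ?_ ?_) hθK)
    · rw [norm_mul, RCLike.norm_ofReal, abs_of_nonneg (by positivity)]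
      calc Real.cos (θ k) / R * ‖inner 𝕜 (w i) x₀‖ ≤ 1 / R * 1 := by
            gcongr
            · exact Real.cos_le_one _
            · exact hx₀ i
        _ = 1 / R := mul_one _
    · rw [norm_mul, RCLike.norm_ofReal]
      exact mul_le_mul hsin (hK i) (norm_nonneg _) hθ0.le
  · rw [hGpn, hGp, RCLike.norm_ofReal, abs_mul, abs_of_pos hρ0]
    refine mul_lt_of_lt_one_right hρ0 ?_
    have hne : θ j - θ k ≠ 0 := sub_ne_zero.mpr fun h => hjk (hθinj j k h)
    have hle : |θ j - θ k| ≤ 1 := by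
      rw [abs_le]
      constructor <;> linarith [hθpos j, hθpos k, hθle j, hθle k]
    rw [abs_of_pos (Real.cos_pos_of_le_one hle), ← Real.cos_abs, ← Real.cos_zero]
    refine Real.cos_lt_cos_of_nonneg_of_le_pi le_rfl ?_ (abs_pos.mpr hne)
    linarith [Real.pi_gt_three]

/-- If the two extreme norms attached to the frame differ, then there are infinitely many
maximizers. -/
theorem infinitelyManyMaximizers_of_gap {δ : ℝ}
    (hupper : ∀ (X : Type u) [NormedAddCommGroup X] [NormedSpace 𝕜 X] [FiniteDimensional 𝕜 X],
      Module.finrank 𝕜 X = n → absProjConst 𝕜 X ≤ ENNReal.ofReal δ) (hn : 2 ≤ n) (hN : N ≠ 0)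
    (hfr : ∀ x, (N : 𝕜) • x = (n : 𝕜) • ∑ i, inner 𝕜 (w i) x • w i) {κ : ℝ} (hκ : 0 < κ)
    (hδ : n / (κ * N) = δ)
    (hwle : ∀ i x, ‖inner 𝕜 (w i) x‖ ≤ κ * ∑ i, ‖inner 𝕜 (w i) x‖)
    {x₀ : EuclideanSpace 𝕜 (Fin n)} (hx₀ : ∀ i, ‖inner 𝕜 (w i) x₀‖ ≤ 1)
    (hx₀' : 1 < κ * ∑ i, ‖inner 𝕜 (w i) x₀‖) : InfinitelyManyMaximizers.{u} 𝕜 n := by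
  obtain ⟨G, p, hG, hp, hpj⟩ := exists_irredundant_sequence hn hN hfr hκ hx₀ hx₀'
  let g : ∀ m : ℕ, ULift.{u} (Fin N ⊕ Fin m) → EuclideanSpace 𝕜 (Fin n) →ₗ[𝕜] 𝕜 :=
    fun m l => Sum.elim (fun i => innerₛₗ 𝕜 (w i)) (fun k : Fin m => G k) l.down
  -- An isometry would force M k ≤ N + M j. Steps of N + 1 rule this out for j < k, whether or not
  -- the frame functionals themselves are redundant.
  let M : ℕ → ℕ := fun k => k * (N + 1)
  have hmax : ∀ m, IsMaximizer.{u} 𝕜 n (polySpace (g m)) := fun m =>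
    (isMaximizer_polySpace hupper hN hfr hκ hδ (fun i => ⟨ULift.up (Sum.inl i), fun x => rfl⟩)
      (by
        rintro ⟨i | k⟩ x
        · exact hwle i x
        · exact hG k x)).1
  have hno : ∀ j k, j < k → ∀ _ : polySpace (g (M k)) ≃ₗᵢ[𝕜] polySpace (g (M j)), False := by
    intro j k hjk Ψ
    let u : ULift.{u} (Fin N ⊕ Fin (M j)) → EuclideanSpace 𝕜 (Fin n) →ₗ[𝕜] 𝕜 := fun l =>
      LinearMap.proj l ∘ₗ (polySpace (g (M j))).subtype ∘ₗ Ψ.toLinearEquiv.toLinearMap ∘ₗ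
        (LinearMap.pi (g (M k))).rangeRestrict
    have hgu : ∀ x, ‖LinearMap.pi u x‖ = ‖LinearMap.pi (g (M k)) x‖ := fun x =>
      Ψ.norm_map ((LinearMap.pi (g (M k))).rangeRestrict x)
    have h := le_card_of_irredundant (g (M k)) u hgu
      (fun l : Fin (M k) => ULift.up (Sum.inr l))
      (fun a b hab => by simpa using hab) (fun l => p l)
      (fun l => (norm_nonneg _).trans_lt (hp l ⟨0, by omega⟩)) (by
        rintro l ⟨i | l'⟩ hne
        · exact hp l i
        · refine hpj l' l fun h => hne ?_
          rw [Fin.ext h])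
    simp only [Fintype.card_ulift, Fintype.card_sum, Fintype.card_fin, M] at h
    have h' : (j + 1) * (N + 1) ≤ k * (N + 1) := Nat.mul_le_mul_right _ hjk
    rw [add_mul] at h'
    omega
  refine ⟨fun k => polySpace (g (M k)), fun k => inferInstance, fun k => inferInstance,
    fun k => hmax (M k), fun j k hjk => ⟨fun Ψ => ?_⟩⟩
  rcases hjk.lt_or_gt with h | h
  · exact hno j k h Ψ.symm
  · exact hno k j h Ψ

end Family


/-! ### Assembly for maximal ETFs -/

section Main

variable {𝕜 : Type} [RCLike 𝕜] {n N : ℕ} {w : Fin N → EuclideanSpace 𝕜 (Fin n)}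

/-- For an equiangular tight frame, `maxᵢ |⟨w i, x⟩| ≤ κ ∑ᵢ |⟨w i, x⟩|`. -/
theorem norm_inner_le_sum_of_frame (hn : n ≠ 0) (hN : 2 ≤ N) {c : ℝ} (hc0 : 0 < c)
    (hnorm : ∀ i, ‖w i‖ = 1) (hc : ∀ i j, i ≠ j → ‖inner 𝕜 (w i) (w j)‖ = c)
    (hNn : (N : ℝ) = n * (1 + (N - 1) * c ^ 2))
    (hfr : ∀ x, (N : 𝕜) • x = (n : 𝕜) • ∑ i, inner 𝕜 (w i) x • w i)
    (j : Fin N) (x : EuclideanSpace 𝕜 (Fin n)) :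
    ‖inner 𝕜 (w j) x‖ ≤ (1 + ((N : ℝ) - 1) * c)⁻¹ * ∑ i, ‖inner 𝕜 (w i) x‖ := by
  have hN' : (2 : ℝ) ≤ N := by exact_mod_cast hN
  have hn' : (0 : ℝ) < n := by exact_mod_cast Nat.pos_of_ne_zero hn
  have hpos : 0 < 1 + ((N : ℝ) - 1) * c := by nlinarith
  have hself : inner 𝕜 (w j) (w j) = (1 : 𝕜) := by
    rw [inner_self_eq_norm_sq_to_K, hnorm]
    simp
  have h1 := congrArg (fun v => inner 𝕜 (w j) v) (hfr x)
  simp only [inner_smul_right, inner_sum] at h1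
  rw [← Finset.add_sum_erase _ _ (Finset.mem_univ j), hself, mul_one] at h1
  set S := ∑ i ∈ Finset.univ.erase j, inner 𝕜 (w i) x * inner 𝕜 (w j) (w i) with hS
  have hSle : ‖S‖ ≤ c * ∑ i ∈ Finset.univ.erase j, ‖inner 𝕜 (w i) x‖ := by
    rw [Finset.mul_sum]
    refine (norm_sum_le _ _).trans (Finset.sum_le_sum fun i hi => ?_)
    rw [norm_mul, hc j i (Finset.ne_of_mem_erase hi).symm, mul_comm]
  -- Pair the frame identity with w j and isolate its own term; substituting N = n(1 + (N − 1)c²)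
  -- then cancels a factor nc.
  have h2 : (N : ℝ) * ‖inner 𝕜 (w j) x‖ ≤ n * (‖inner 𝕜 (w j) x‖ + ‖S‖) := by
    have h3 := congrArg norm h1
    rw [norm_mul, norm_mul, RCLike.norm_natCast, RCLike.norm_natCast] at h3
    rw [h3]
    exact mul_le_mul_of_nonneg_left (norm_add_le _ _) hn'.le
  rw [inv_mul_eq_div, le_div_iff₀ hpos, ← Finset.add_sum_erase _ _ (Finset.mem_univ j)]
  set t := ‖inner 𝕜 (w j) x‖
  set s := ∑ i ∈ Finset.univ.erase j, ‖inner 𝕜 (w i) x‖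
  have h4 : n * (c * (t * (((N : ℝ) - 1) * c))) ≤ n * (c * s) := by
    have := mul_le_mul_of_nonneg_left hSle hn'.le
    have e : (N : ℝ) * t = n * (1 + (N - 1) * c ^ 2) * t := by rw [← hNn]
    nlinarith
  have h5 := le_of_mul_le_mul_left (le_of_mul_le_mul_left h4 hn') hc0
  linarith

/-- The phase ζ is the only place where the field matters for non-uniqueness: it must keep c² + ζc(1
− c) off the nonnegative reals, so that the extreme norms differ. -/
theorem frame_infinitelyManyMaximizers (hn : 2 ≤ n) (hN : 2 ≤ N) {c : ℝ} (hc0 : 0 < c) (hc1 : c < 1)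
    (hupper : ∀ (X : Type u) [NormedAddCommGroup X] [NormedSpace 𝕜 X] [FiniteDimensional 𝕜 X],
      Module.finrank 𝕜 X = n → absProjConst 𝕜 X ≤ ENNReal.ofReal ((1 + n * c) / (1 + c)))
    (hnorm : ∀ i, ‖w i‖ = 1) (hc : ∀ i j, i ≠ j → ‖inner 𝕜 (w i) (w j)‖ = c)
    (hNn : (N : ℝ) = n * (1 + (N - 1) * c ^ 2))
    (hfr : ∀ x, (N : 𝕜) • x = (n : 𝕜) • ∑ i, inner 𝕜 (w i) x • w i)
    {ζ : 𝕜} (hζ : ‖ζ‖ = 1)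
    (hζc : RCLike.re ((c : 𝕜) ^ 2 + ζ * (c * (1 - c))) < ‖(c : 𝕜) ^ 2 + ζ * (c * (1 - c))‖) :
    InfinitelyManyMaximizers.{u} 𝕜 n := by
  have hN' : (2 : ℝ) ≤ N := by exact_mod_cast hN
  have hpos : 0 < 1 + ((N : ℝ) - 1) * c := by nlinarith
  obtain ⟨x₀, hx₀, hx₀'⟩ := exists_gap hn hN hc0 hc1 hnorm hc hNn hfr hζ hζc
  exact infinitelyManyMaximizers_of_gap hupper hn (by omega) hfr (inv_pos.mpr hpos)
    (frame_constant_eq hN' hc0 hNn)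
    (norm_inner_le_sum_of_frame (by omega) hN hc0 hnorm hc hNn hfr) hx₀ hx₀'

theorem InfinitelyManyMaximizers.not_uniqueMaximizer (h : InfinitelyManyMaximizers.{u} 𝕜 n) :
    ¬ UniqueMaximizer.{u} 𝕜 n := by
  rintro ⟨-, hu⟩
  obtain ⟨X, _, _, hX, hne⟩ := h
  exact (hne 0 1 zero_ne_one).false (hu (X 0) (X 1) (hX 0) (hX 1)).some

theorem exists_real_parameters (hn : 2 ≤ n)
    {w : Fin (n * (n + 1) / 2) → EuclideanSpace ℝ (Fin n)} (hw : IsETF w) :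
    2 ≤ n * (n + 1) / 2 ∧ ∃ c : ℝ, 0 < c ∧ (n + 2) * c ^ 2 = 1 ∧
      (∀ i j, i ≠ j → ‖inner ℝ (w i) (w j)‖ = c) ∧
      ((n * (n + 1) / 2 : ℕ) : ℝ) = n * (1 + ((n * (n + 1) / 2 : ℕ) - 1) * c ^ 2) ∧
      ∀ x, ((n * (n + 1) / 2 : ℕ) : ℝ) • x = (n : ℝ) • ∑ i, inner ℝ (w i) x • w i := by
  have hN : 2 ≤ n * (n + 1) / 2 := by
    rw [Nat.le_div_iff_mul_le two_pos]
    nlinarith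
  obtain ⟨c, hc0, hc, hNn, hfr⟩ := hw.exists_parameters hN
  have h2 : (((n * (n + 1) / 2 : ℕ) : ℝ)) * 2 = n * (n + 1) := by
    exact_mod_cast Nat.div_mul_cancel (Nat.even_mul_succ_self n).two_dvd
  have hn' : (2 : ℝ) ≤ n := by exact_mod_cast hn
  have hcn : ((n : ℝ) + 2) * c ^ 2 = 1 := by
    -- For N = n(n + 1)/2 one has N − 1 = (n − 1)(n + 2)/2 and N − n = n(n − 1)/2.
    have e : (n : ℝ) * (n - 1) * ((n + 2) * c ^ 2) = n * (n - 1) * 1 := by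
      linear_combination (-2) * hNn + (1 - n * c ^ 2) * h2
    exact mul_left_cancel₀ (mul_pos (by linarith) (by linarith)).ne' e
  refine ⟨hN, c, hc0.lt_of_ne fun h => ?_, hcn, hc, hNn, hfr⟩
  rw [← h] at hcn
  norm_num at hcn

theorem exists_complex_parameters (hn : 2 ≤ n)
    {w : Fin (n ^ 2) → EuclideanSpace ℂ (Fin n)} (hw : IsETF w) :
    2 ≤ n ^ 2 ∧ ∃ c : ℝ, 0 < c ∧ (n + 1) * c ^ 2 = 1 ∧
      (∀ i j, i ≠ j → ‖inner ℂ (w i) (w j)‖ = c) ∧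
      ((n ^ 2 : ℕ) : ℝ) = n * (1 + ((n ^ 2 : ℕ) - 1) * c ^ 2) ∧
      ∀ x, ((n ^ 2 : ℕ) : ℂ) • x = (n : ℂ) • ∑ i, inner ℂ (w i) x • w i := by
  have hN : 2 ≤ n ^ 2 := by nlinarith
  obtain ⟨c, hc0, hc, hNn, hfr⟩ := hw.exists_parameters hN
  have hn' : (2 : ℝ) ≤ n := by exact_mod_cast hn
  have hcn : ((n : ℝ) + 1) * c ^ 2 = 1 := by
    have e : (n : ℝ) * (n - 1) * ((n + 1) * c ^ 2) = n * (n - 1) * 1 := by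
      push_cast at hNn
      linear_combination -hNn
    exact mul_left_cancel₀ (mul_pos (by linarith) (by linarith)).ne' e
  refine ⟨hN, c, hc0.lt_of_ne fun h => ?_, hcn, hc, hNn, hfr⟩
  rw [← h] at hcn
  norm_num at hcn

/-- The real plane: the maximizers exist, and their norms are of the form
`max (max |f₀| |f₁|) |f₀ + f₁|`. -/
theorem isMaximizer_real_two {w : Fin (2 * (2 + 1) / 2) → EuclideanSpace ℝ (Fin 2)}
    (hw : IsETF w) :
    (∃ (X : Type u) (_ : NormedAddCommGroup X) (_ : NormedSpace ℝ X), IsMaximizer ℝ 2 X) ∧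
    ∀ (X : Type u) [NormedAddCommGroup X] [NormedSpace ℝ X], IsMaximizer ℝ 2 X →
      Module.finrank ℝ X = 2 ∧ FiniteDimensional ℝ X ∧
      ∃ f₀ f₁ : StrongDual ℝ X, ∀ x, ‖x‖ = max (max |f₀ x| |f₁ x|) |f₀ x + f₁ x| := by
  have hnorm := hw.1.2.1
  obtain ⟨hN, c, hc0, hcn, hc, hNn, hfr⟩ := exists_real_parameters le_rfl hw
  have hN' : (2 : ℝ) ≤ (2 * (2 + 1) / 2 : ℕ) := by exact_mod_cast hN
  have hpos : 0 < 1 + (((2 * (2 + 1) / 2 : ℕ) : ℝ) - 1) * c := by nlinarith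
  have hch : c = 1 / 2 := by
    push_cast at hcn
    nlinarith
  obtain ⟨hmax, hval⟩ := isMaximizer_polySpace.{u}
    (g := fun l : ULift.{u} (Fin (2 * (2 + 1) / 2)) => innerₛₗ ℝ (w l.down))
    (δ := (1 + (2 : ℕ) * c) / (1 + c)) (fun X _ _ _ h => absProjConst_real_le le_rfl h hc0 hcn)
    (by omega) hfr (inv_pos.mpr hpos) (frame_constant_eq hN' hc0 hNn)
    (fun i => ⟨ULift.up i, fun x => rfl⟩)
    (fun l => norm_inner_le_sum_of_frame (by omega) hN hc0 hnorm hc hNn hfr l.down)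
  refine ⟨⟨_, _, _, hmax⟩, fun X _ _ ⟨hfd, hX2, hX⟩ => ⟨hX2, hfd, ?_⟩⟩
  -- The frame fixes the maximal constant at (1 + 2c)/(1 + c) = 4/3, so every maximizer falls under
  -- the equality case.
  refine exists_norm_eq_max_of_le_absProjConst hX2 ?_
  rw [hX, hval, hch]
  norm_num

end Main


theorem corollary3 (n : ℕ) (hn : 2 ≤ n) :
    -- the real case, where a maximal ETF has `n (n + 1) / 2` elements
    ((∃ w : Fin (n * (n + 1) / 2) → EuclideanSpace ℝ (Fin n), IsETF w) →
      (UniqueMaximizer.{u} ℝ n ↔ n = 2) ∧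
      (n = 2 → ∀ (X : Type u) [NormedAddCommGroup X] [NormedSpace ℝ X], IsMaximizer ℝ n X →
        IsAffineRegularHexagon (Metric.closedBall (0 : X) 1)) ∧
      (n ≠ 2 → InfinitelyManyMaximizers.{u} ℝ n)) ∧
    -- the complex case, where a maximal ETF has `n ^ 2` elements
    ((∃ w : Fin (n ^ 2) → EuclideanSpace ℂ (Fin n), IsETF w) →
      ¬ UniqueMaximizer.{u} ℂ n ∧ InfinitelyManyMaximizers.{u} ℂ n) := by
  refine ⟨?_, ?_⟩
  · rintro ⟨w, hw⟩
    have hne : n ≠ 2 → InfinitelyManyMaximizers.{u} ℝ n := fun h2 => by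
      have hn3 : (3 : ℝ) ≤ n := by exact_mod_cast (show 3 ≤ n by omega)
      obtain ⟨hN, c, hc0, hcn, hc, hNn, hfr⟩ := exists_real_parameters hn hw
      have hc1 : c < 1 / 2 := by nlinarith
      refine frame_infinitelyManyMaximizers hn hN hc0 (by linarith)
        (fun X _ _ _ h => absProjConst_real_le hn h hc0 hcn) hw.1.2.1 hc hNn hfr
        (ζ := -1) (by simp) ?_
      -- The expression is c(2c − 1), negative precisely because c < 1/2. In dimension 2 it
      -- vanishes, and this choice yields no gap.
      have hneg : c ^ 2 + -1 * (c * (1 - c)) < 0 := by nlinarith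
      exact hneg.trans (norm_pos_iff.mpr hneg.ne)
    refine ⟨⟨fun hu => ?_, ?_⟩, ?_, hne⟩
    · by_contra h2
      exact (hne h2).not_uniqueMaximizer hu
    · rintro rfl
      obtain ⟨hex, hform⟩ := isMaximizer_real_two hw
      refine ⟨hex, fun X Y _ _ _ _ hX hY => ?_⟩
      obtain ⟨hX2, _, _, _, hX'⟩ := hform X hX
      obtain ⟨hY2, _, _, _, hY'⟩ := hform Y hY
      exact nonempty_linearIsometryEquiv_of_norm_eq_max hX2 hX' hY2 hY'
    · rintro rfl X _ _ hX
      obtain ⟨hX2, _, _, _, hX'⟩ := (isMaximizer_real_two hw).2 X hX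
      exact isAffineRegularHexagon_closedBall hX2 hX'
  · rintro ⟨w, hw⟩
    obtain ⟨hN, c, hc0, hcn, hc, hNn, hfr⟩ := exists_complex_parameters hn hw
    have hn2 : (2 : ℝ) ≤ n := by exact_mod_cast hn
    have hc1 : c < 1 := by nlinarith
    have h := frame_infinitelyManyMaximizers.{u} hn hN hc0 hc1
      (fun X _ _ _ h => absProjConst_complex_le hn h hc0 hcn) hw.1.2.1 hc hNn hfr
      (ζ := Complex.I) (by simp) (by
        -- A nonzero imaginary part separates the real part from the modulus, with no restriction on
        -- n ≥ 2.
        have him : ((c : ℂ) ^ 2 + Complex.I * (c * (1 - c))).im = c * (1 - c) := by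
          simp [pow_two]
        refine lt_of_le_of_ne (RCLike.re_le_norm _) fun h => ?_
        have h0 : ((c : ℂ) ^ 2 + Complex.I * (c * (1 - c))).im = 0 :=
          (Complex.nonneg_iff.mp (Complex.re_eq_norm.mp h)).2.symm
        rw [him] at h0
        exact (mul_pos hc0 (by linarith : 0 < 1 - c)).ne' h0)
    exact ⟨h.not_uniqueMaximizer, h⟩
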